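/- For $x,y\in\mathbb{R}^2$ let $c(x,y)=(x_1-y_1)(x_2-y_2)$. A set $G\subset\mathbb{R}^2$ is monotone if $c(r,s)\ge 0$ for all $r,s\in G$; let $\mathfrak{M}$ be the family of maximal monotone sets, that is, of monotone sets that are not proper subsets of a monotone set. For $G\in\mathfrak{M}$ put $\phi_G(y)=\inf_{x\in G}c(x,y)\in[-\infty,0]$, and let $E^G$ be the union of all vertical and horizontal line segments of $G$, that is, of all sets $\{x\in G: x_i=t\}$, $i\in\{1,2\}$, $t\in\mathbb{R}$, having more than one point. At interior points of $\{\phi_G>-\infty\}$ the gradient $\nabla\phi_G$ is the classical one; at a boundary point $y$ with $\phi_G(y)>-\infty$ it exists if $\nabla\phi_G(y^n)$ converges to one and the same limit $\nabla\phi_G(y)$ for all sequences $(y^n)$ of interior points of differentiability with $y^n\to y$ (at least one such sequence being required). Where $\nabla\phi_G(y)$ exists, put $$D^c\phi_G(y)=\Big(y_1-\frac{\partial\phi_G}{\partial y_2}(y),\; y_2-\frac{\partial\phi_G}{\partial y_1}(y)\Big).$$ Let $\mathcal{D}$ be the family of graphs of strictly decreasing functions, defined on closed intervals of $\mathbb{R}$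 (one-point intervals allowed), that are Lipschitz together with their inverses. A Borel probability measure $\mu$ on $\mathbb{R}^2$ is $\mathcal{D}$-regular if $\mu(D)=0$ for every $D\in\mathcal{D}$. Let $(\Omega,\mathcal{F},\mathbb{P})$ be a probability space; random variables that are equal almost surely are identified. Let $Y$ be a random variable with values in $\mathbb{R}^2$ and finite second moment, and let $\nu$ be the law of $Y$. An optimal map is a minimizer of $\mathbb{E}[c(X,Y)]$ over all square integrable $Y$-measurable $\mathbb{R}^2$-valued random variables $X$ with $\mathbb{E}[Y\mid X]=X$. An optimal plan is a minimizer of $\int c(x,y)\,d\gamma$ over all probability measures $\gamma(dx,dy)$ on $\mathbb{R}^2\times\mathbb{R}^2$ with finite second moments, with $y$-marginal $\nu$ and such that $\gamma(y\mid x)=x$, where $\gamma(y\mid x)$ is the conditional expectation of $y$ given $x$ under $\gamma$. A dual maximizer is a maximizer of $\int\phi_G\,d\nu$ over $G\in\mathfrak{M}$. Theorem. Suppose that $\nu$ is $\mathcal{D}$-regular. Let $G$ be a dual maximizer and put $\phi=\phi_G$, $E=E^G$. Then $\nabla\phi(Y)$ exists almost surely on $\{Y\notin E\}$, so that $$X=Y\,1_{\{Y\in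 E\}}+D^c\phi(Y)\,1_{\{Y\notin E\}}$$ is well defined almost surely; $X$ is an optimal map, the law $\gamma$ of $(X,Y)$ is an optimal plan, and the law of $X$ is $\mathcal{D}$-regular. Moreover, if $\widetilde X$ is an optimal map and $\widetilde\gamma$ is an optimal plan, then $$X\,1_{\{Y\notin E\}}=\widetilde X\,1_{\{Y\notin E\}}\ \text{ almost surely},\qquad 1_{\{y\notin E\}}\,\gamma(dx,dy)=1_{\{y\notin E\}}\,\widetilde\gamma(dx,dy).$$ -/

import Mathlib

open MeasureTheory Filter Topology

namespace BackwardTransport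

/-- The covariance-type cost `c(x,y) = (x₁ - y₁)(x₂ - y₂)` on the plane. -/
def cost (x y : ℝ × ℝ) : ℝ := (x.1 - y.1) * (x.2 - y.2)

/-! ### Maximal monotone sets and the dual problem -/

/-- Monotone subsets of the plane. -/
def IsMonotoneSet (G : Set (ℝ × ℝ)) : Prop := ∀ r ∈ G, ∀ s ∈ G, 0 ≤ cost r s

/-- Maximal monotone sets: monotone sets that are not proper subsets of a monotone set. -/
def IsMaximalMonotone (G : Set (ℝ × ℝ)) : Prop := Maximal IsMonotoneSet G

/-- `φ_G(y) = inf_{x ∈ G} c(x,y)`, with values in the extended reals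
(in `[-∞, 0]` if `G` is maximal monotone). -/
noncomputable def phi (G : Set (ℝ × ℝ)) (y : ℝ × ℝ) : EReal := ⨅ x ∈ G, (cost x y : EReal)

/-- The integral `∫ φ_G dν ∈ [-∞, 0]` of the nonpositive function `φ_G`, `G` maximal monotone. -/
noncomputable def dualValue (ν : Measure (ℝ × ℝ)) (G : Set (ℝ × ℝ)) : EReal :=
  -((∫⁻ y, (-(phi G y)).toENNReal ∂ν : ENNReal) : EReal)

/-- `G` maximizes `∫ φ_G dν` over all maximal monotone sets. -/
def IsDualMaximizer (ν : Measure (ℝ × ℝ)) (G : Set (ℝ × ℝ)) : Prop :=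
  IsMaximalMonotone G ∧ ∀ G', IsMaximalMonotone G' → dualValue ν G' ≤ dualValue ν G

/-! ### The gradient of `φ_G` and the operator `D^c` -/

/-- The domain of finiteness of `φ_G`. -/
def domPhi (G : Set (ℝ × ℝ)) : Set (ℝ × ℝ) := {y | ⊥ < phi G y}

/-- The real-valued version of `φ_G`, meaningful on `domPhi G`. -/
noncomputable def phiReal (G : Set (ℝ × ℝ)) (y : ℝ × ℝ) : ℝ := (phi G y).toReal

/-- Interior points of the domain at which `φ_G` is differentiable in the classical sense. -/
def smoothDom (G : Set (ℝ × ℝ)) : Set (ℝ × ℝ) :=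
  {y | y ∈ interior (domPhi G) ∧ DifferentiableAt ℝ (phiReal G) y}

/-- The classical gradient `(∂φ_G/∂y₁, ∂φ_G/∂y₂)` at points of `smoothDom G`. -/
noncomputable def classicalGrad (G : Set (ℝ × ℝ)) (y : ℝ × ℝ) : ℝ × ℝ :=
  (fderiv ℝ (phiReal G) y (1, 0), fderiv ℝ (phiReal G) y (0, 1))

/-- `∇φ_G(y)` exists and is equal to `p`: the classical gradient at an interior point of the
domain; at a boundary point belonging to the domain, the limit of the classical gradients along
all sequences of interior points of differentiability that converge to `y`. -/
def HasGrad (G : Set (ℝ × ℝ)) (y p : ℝ × ℝ) : Prop :=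
  (y ∈ smoothDom G ∧ p = classicalGrad G y) ∨
  (y ∈ domPhi G ∧ y ∉ interior (domPhi G) ∧ y ∈ closure (smoothDom G) ∧
    Tendsto (classicalGrad G) (𝓝[smoothDom G] y) (𝓝 p))

/-- The gradient is unique. -/
theorem HasGrad.unique {G : Set (ℝ × ℝ)} {y p q : ℝ × ℝ}
    (hp : HasGrad G y p) (hq : HasGrad G y q) : p = q := by
  rcases hp with ⟨h1, h2⟩ | ⟨_, h2, h3, h4⟩
  · rcases hq with ⟨_, k2⟩ | ⟨_, k2, _, _⟩
    · exact h2.trans k2.symm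
    · exact absurd h1.1 k2
  · rcases hq with ⟨k1, _⟩ | ⟨_, _, _, k4⟩
    · exact absurd k1.1 h2
    · have : (𝓝[smoothDom G] y).NeBot := mem_closure_iff_nhdsWithin_neBot.1 h3
      exact tendsto_nhds_unique h4 k4

/-- `dom ∇φ_G`, the set of points where `∇φ_G` exists. -/
def domGrad (G : Set (ℝ × ℝ)) : Set (ℝ × ℝ) := {y | ∃ p, HasGrad G y p}

open Classical in
/-- The gradient of `φ_G` (zero, by convention, where it does not exist). -/
noncomputable def gradPhi (G : Set (ℝ × ℝ)) (y : ℝ × ℝ) : ℝ × ℝ :=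
  if h : ∃ p, HasGrad G y p then h.choose else 0

/-- `D^cφ_G(y) = (y₁ - ∂φ_G/∂y₂(y), y₂ - ∂φ_G/∂y₁(y))`. -/
noncomputable def Dc (G : Set (ℝ × ℝ)) (y : ℝ × ℝ) : ℝ × ℝ :=
  (y.1 - (gradPhi G y).2, y.2 - (gradPhi G y).1)

/-! ### Vertical and horizontal segments of `G` -/

/-- The union of the vertical line segments of `G`: of the sets `{x ∈ G : x₁ = t}`
having more than one point. -/
def verticalSegments (G : Set (ℝ × ℝ)) : Set (ℝ × ℝ) :=
  ⋃ t ∈ {t : ℝ | {x ∈ G | x.1 = t}.Nontrivial}, {x ∈ G | x.1 = t}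

/-- The union of the horizontal line segments of `G`: of the sets `{x ∈ G : x₂ = t}`
having more than one point. -/
def horizontalSegments (G : Set (ℝ × ℝ)) : Set (ℝ × ℝ) :=
  ⋃ t ∈ {t : ℝ | {x ∈ G | x.2 = t}.Nontrivial}, {x ∈ G | x.2 = t}

/-- `E^G`, the union of all vertical and horizontal line segments of `G`. -/
def segments (G : Set (ℝ × ℝ)) : Set (ℝ × ℝ) := verticalSegments G ∪ horizontalSegments G

/-! ### `𝒟`-regular measures -/

/-- Graphs of strictly decreasing functions on closed intervals (bounded or not, possibly
consisting of one point) that are Lipschitz together with their inverses. -/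
def decreasingGraphs : Set (Set (ℝ × ℝ)) :=
  {D | ∃ (I : Set ℝ) (f : ℝ → ℝ) (K : ℝ), I.Nonempty ∧ IsClosed I ∧ I.OrdConnected ∧ 0 < K ∧
    (∀ s ∈ I, ∀ t ∈ I, s < t → 1 / K * (t - s) ≤ f s - f t ∧ f s - f t ≤ K * (t - s)) ∧
    D = (fun t => (t, f t)) '' I}

/-- A measure on the plane is `𝒟`-regular if it does not charge the sets of `𝒟`. -/
def IsDRegular (μ : Measure (ℝ × ℝ)) : Prop := ∀ D ∈ decreasingGraphs, μ D = 0

/-! ### Plans and maps -/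

/-- `Γ(ν)`: probability measures `γ(dx,dy)` with finite second moments, with `y`-marginal `ν`
and such that the conditional expectation of `y` given `x` is `x`. -/
structure IsPlan (ν : Measure (ℝ × ℝ)) (γ : Measure ((ℝ × ℝ) × (ℝ × ℝ))) : Prop where
  isProb : IsProbabilityMeasure γ
  memLp : MemLp id 2 γ
  marginal : γ.map Prod.snd = ν
  martingale :
    γ[(Prod.snd : (ℝ × ℝ) × (ℝ × ℝ) → ℝ × ℝ) |
      MeasurableSpace.comap (Prod.fst : (ℝ × ℝ) × (ℝ × ℝ) → ℝ × ℝ) inferInstance] =ᵐ[γ] Prod.fst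

/-- Optimal plans: minimizers of `∫ c(x,y) dγ` over `Γ(ν)`. -/
def IsOptimalPlan (ν : Measure (ℝ × ℝ)) (γ : Measure ((ℝ × ℝ) × (ℝ × ℝ))) : Prop :=
  IsPlan ν γ ∧ ∀ γ', IsPlan ν γ' → ∫ z, cost z.1 z.2 ∂γ ≤ ∫ z, cost z.1 z.2 ∂γ'

/-- `𝒳(Y)`: square integrable `Y`-measurable random variables `X` with `E[Y | X] = X`. Random
variables that are equal almost surely are identified, so both properties are required of a
version `X'` of `X`. -/
structure IsMap {Ω : Type*} [MeasurableSpace Ω] (P : Measure Ω) (Y X : Ω → ℝ × ℝ) : Prop where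
  memLp : MemLp X 2 P
  martingale : ∃ X' : Ω → ℝ × ℝ, X =ᵐ[P] X' ∧
    Measurable[MeasurableSpace.comap Y inferInstance] X' ∧
    P[Y | MeasurableSpace.comap X' inferInstance] =ᵐ[P] X'

/-- Optimal maps: minimizers of `E[c(X,Y)]` over `𝒳(Y)`. -/
def IsOptimalMap {Ω : Type*} [MeasurableSpace Ω] (P : Measure Ω) (Y X : Ω → ℝ × ℝ) : Prop :=
  IsMap P Y X ∧ ∀ X', IsMap P Y X' → ∫ ω, cost (X ω) (Y ω) ∂P ≤ ∫ ω, cost (X' ω) (Y ω) ∂P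

end BackwardTransport

open BackwardTransport

namespace BackwardTransport

/-! ### The Minty parametrization of maximal monotone sets -/

/-- Coordinates of the Minty parametrization of a maximal monotone subset of the plane:
monotone functions that add up to the identity. -/
structure IsPair (a b : ℝ → ℝ) : Prop where
  mono_fst : Monotone a
  mono_snd : Monotone b
  add_eq : ∀ t, a t + b t = t

/-- The cost between `y` and the point of parameter `t`. -/
def profile (a b : ℝ → ℝ) (y : ℝ × ℝ) (t : ℝ) : ℝ := (a t - y.1) * (b t - y.2)

/-- The nonnegative function `-φ_G`, for `G` parametrized by `a` and `b`. -/
noncomputable def defect (a b : ℝ → ℝ) (y : ℝ × ℝ) : ENNReal :=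
  ⨆ t, ENNReal.ofReal (-(profile a b y t))

/-- All approximate minimizers of the profile of `y` are close to `t`. -/
def WellPosed (a b : ℝ → ℝ) (y : ℝ × ℝ) (t : ℝ) : Prop :=
  ∀ η > 0, ∃ δ > 0, ∀ s, profile a b y s < -(defect a b y).toReal + δ → |s - t| < η

/-- The points of the vertical and horizontal segments, in terms of the parametrization. -/
def segs (a b : ℝ → ℝ) : Set (ℝ × ℝ) :=
  {y | ∃ s t, s ≠ t ∧ y = (a t, b t) ∧ (a s = a t ∨ b s = b t)}

/-- The function `t ↦ -a (-t)`, which parametrizes the reflected set. -/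
def reflect (a : ℝ → ℝ) (t : ℝ) : ℝ := -a (-t)

variable {a b : ℝ → ℝ}

theorem IsPair.swap (h : IsPair a b) : IsPair b a :=
  ⟨h.mono_snd, h.mono_fst, fun t => by rw [add_comm]; exact h.add_eq t⟩

theorem IsPair.reflect (h : IsPair a b) : IsPair (reflect a) (reflect b) :=
  ⟨fun _ _ hst => neg_le_neg (h.mono_fst (neg_le_neg hst)),
   fun _ _ hst => neg_le_neg (h.mono_snd (neg_le_neg hst)),
   fun t => by have := h.add_eq (-t); simp only [BackwardTransport.reflect]; linarith⟩

theorem IsPair.abs_sub_le (h : IsPair a b) (s t : ℝ) : |a s - a t| ≤ |s - t| := by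
  rcases le_total s t with hst | hst
  · have h1 := h.mono_fst hst; have h2 := h.mono_snd hst
    have := h.add_eq s; have := h.add_eq t
    rw [abs_of_nonpos (by linarith), abs_of_nonpos (by linarith)]; linarith
  · have h1 := h.mono_fst hst; have h2 := h.mono_snd hst
    have := h.add_eq s; have := h.add_eq t
    rw [abs_of_nonneg (by linarith), abs_of_nonneg (by linarith)]; linarith

theorem IsPair.continuous (h : IsPair a b) : Continuous a := by
  refine (LipschitzWith.of_dist_le_mul (K := 1) fun s t => ?_).continuous
  simpa [Real.dist_eq] using h.abs_sub_le s t

theorem profile_swap (a b : ℝ → ℝ) (y : ℝ × ℝ) (t : ℝ) :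
    profile b a y.swap t = profile a b y t := by simp [profile, mul_comm]

theorem profile_reflect (a b : ℝ → ℝ) (y : ℝ × ℝ) (t : ℝ) :
    profile (reflect a) (reflect b) (-y) t = profile a b y (-t) := by
  simp only [profile, reflect, Prod.fst_neg, Prod.snd_neg]; ring

theorem defect_swap (a b : ℝ → ℝ) (y : ℝ × ℝ) : defect b a y.swap = defect a b y := by
  simp [defect, profile_swap]

theorem defect_reflect (a b : ℝ → ℝ) (y : ℝ × ℝ) :
    defect (reflect a) (reflect b) (-y) = defect a b y := by
  simp only [defect, profile_reflect]
  exact (Equiv.neg ℝ).iSup_comp (g := fun t => ENNReal.ofReal (-(profile a b y t)))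

theorem wellPosed_swap {y : ℝ × ℝ} {t : ℝ} :
    WellPosed b a y.swap t ↔ WellPosed a b y t := by
  simp only [WellPosed, profile_swap, defect_swap]

theorem WellPosed.reflect {y : ℝ × ℝ} {t : ℝ} (h : WellPosed a b y t) :
    WellPosed (reflect a) (reflect b) (-y) (-t) := by
  intro η hη
  obtain ⟨δ, hδ, H⟩ := h η hη
  refine ⟨δ, hδ, fun s hs => ?_⟩
  rw [profile_reflect, defect_reflect] at hs
  have := H _ hs
  rwa [← abs_neg, show -(s - -t) = -s - t by ring]

theorem swap_mem_segs {y : ℝ × ℝ} : y.swap ∈ segs b a ↔ y ∈ segs a b := by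
  constructor <;>
  · rintro ⟨s, t, hst, hy, h⟩
    refine ⟨s, t, hst, ?_, h.symm⟩
    simpa [Prod.ext_iff, and_comm] using hy

theorem neg_mem_segs {y : ℝ × ℝ} : -y ∈ segs (reflect a) (reflect b) ↔ y ∈ segs a b := by
  constructor
  · rintro ⟨s, t, hst, hy, h⟩
    refine ⟨-s, -t, by simpa using hst, ?_, by simpa [reflect] using h⟩
    simpa [Prod.ext_iff, reflect] using hy
  · rintro ⟨s, t, hst, hy, h⟩
    refine ⟨-s, -t, by simpa using hst, ?_, by simpa [reflect] using h⟩
    simpa [Prod.ext_iff, reflect] using hy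

theorem IsPair.continuous_profile (h : IsPair a b) (y : ℝ × ℝ) : Continuous (profile a b y) := by
  have h1 := h.continuous; have h2 := h.swap.continuous
  unfold profile; fun_prop

theorem measurable_defect (a b : ℝ → ℝ) : Measurable (defect a b) := by
  refine LowerSemicontinuous.measurable ?_
  refine lowerSemicontinuous_iSup fun t => Continuous.lowerSemicontinuous ?_
  unfold profile
  exact ENNReal.continuous_ofReal.comp (by fun_prop)

theorem IsPair.profile_add (h : IsPair a b) (y : ℝ × ℝ) :
    profile a b y (y.1 + y.2) = -(a (y.1 + y.2) - y.1) ^ 2 := by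
  have := h.add_eq (y.1 + y.2)
  have h2 : b (y.1 + y.2) - y.2 = -(a (y.1 + y.2) - y.1) := by linarith
  rw [profile, h2]; ring

theorem neg_defect_le {y : ℝ × ℝ} (hy : defect a b y < ⊤) (t : ℝ) :
    -(defect a b y).toReal ≤ profile a b y t := by
  have h1 : ENNReal.ofReal (-(profile a b y t)) ≤ defect a b y :=
    le_iSup (fun t => ENNReal.ofReal (-(profile a b y t))) t
  have := (ENNReal.ofReal_le_iff_le_toReal hy.ne).1 h1
  linarith

theorem IsPair.defect_le (h : IsPair a b) {y : ℝ × ℝ} {c : ℝ}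
    (H : ∀ t, -c ≤ profile a b y t) : defect a b y < ⊤ ∧ (defect a b y).toReal ≤ c := by
  have hc : 0 ≤ c := by
    have := H (y.1 + y.2); rw [h.profile_add] at this
    nlinarith [sq_nonneg (a (y.1 + y.2) - y.1)]
  have : defect a b y ≤ ENNReal.ofReal c :=
    iSup_le fun t => ENNReal.ofReal_le_ofReal (by linarith [H t])
  exact ⟨this.trans_lt ENNReal.ofReal_lt_top, ENNReal.toReal_le_of_le_ofReal hc this⟩

theorem IsPair.exists_profile_lt (h : IsPair a b) {y : ℝ × ℝ} {δ : ℝ} (hδ : 0 < δ) :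
    ∃ t, profile a b y t < -(defect a b y).toReal + δ := by
  by_contra! H
  have := (h.defect_le (y := y) (c := (defect a b y).toReal - δ) fun t => by linarith [H t]).2
  linarith

theorem IsPair.defect_eq_zero (h : IsPair a b) (t : ℝ) : defect a b (a t, b t) = 0 := by
  simp only [defect, ENNReal.iSup_eq_zero, ENNReal.ofReal_eq_zero, profile]
  intro s
  rcases le_total s t with hst | hst
  · nlinarith [h.mono_fst hst, h.mono_snd hst]
  · nlinarith [h.mono_fst hst, h.mono_snd hst]

theorem IsPair.eq_of_defect (h : IsPair a b) {y : ℝ × ℝ} (hy : defect a b y < ⊤)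
    (h0 : (defect a b y).toReal = 0) : y = (a (y.1 + y.2), b (y.1 + y.2)) := by
  have := neg_defect_le hy (y.1 + y.2)
  rw [h.profile_add, h0] at this
  have h1 : a (y.1 + y.2) - y.1 = 0 := by nlinarith
  have := h.add_eq (y.1 + y.2)
  ext <;> simp <;> linarith

theorem IsPair.wellPosed_profile (h : IsPair a b) {y : ℝ × ℝ} {t : ℝ}
    (ht : WellPosed a b y t) : profile a b y t ≤ -(defect a b y).toReal := by
  refine le_of_forall_pos_le_add fun e he => ?_
  obtain ⟨r, hr, H⟩ := Metric.continuous_iff.1 (h.continuous_profile y) t (e / 2) (by positivity)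
  obtain ⟨δ, hδ, H2⟩ := ht r hr
  obtain ⟨s, hs⟩ := h.exists_profile_lt (y := y) (lt_min hδ (half_pos he))
  have h1 := H s (by rw [Real.dist_eq]; exact H2 s (hs.trans_le (by gcongr; exact min_le_left _ _)))
  rw [Real.dist_eq, abs_lt] at h1
  have := min_le_right δ (e / 2)
  linarith

theorem WellPosed.eq {y : ℝ × ℝ} {s t : ℝ} (ht : WellPosed a b y t)
    (hs : profile a b y s ≤ -(defect a b y).toReal) : s = t := by
  by_contra hst
  obtain ⟨δ, hδ, H⟩ := ht |s - t| (abs_pos.2 (sub_ne_zero.2 hst))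
  exact lt_irrefl _ (H s (by linarith))

/-! ### Maximal monotone sets and their parametrizations -/

theorem IsPair.isMaximalMonotone (h : IsPair a b) :
    IsMaximalMonotone (Set.range fun t => (a t, b t)) := by
  constructor
  · rintro _ ⟨s, rfl⟩ _ ⟨t, rfl⟩
    simp only [cost]
    rcases le_total s t with hst | hst
    · nlinarith [h.mono_fst hst, h.mono_snd hst]
    · nlinarith [h.mono_fst hst, h.mono_snd hst]
  · intro G' hG' hsub y hy
    have := hG' _ (hsub ⟨y.1 + y.2, rfl⟩) y hy
    have h1 := h.profile_add y
    have h2 := h.add_eq (y.1 + y.2)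
    simp only [cost] at this
    simp only [profile] at h1
    have h3 : a (y.1 + y.2) - y.1 = 0 := by nlinarith
    exact ⟨y.1 + y.2, by ext <;> simp <;> linarith⟩

theorem IsMaximalMonotone.exists_pair {G : Set (ℝ × ℝ)} (hG : IsMaximalMonotone G) :
    ∃ a b, IsPair a b ∧ G = Set.range fun t => (a t, b t) := by
  classical
  have key : ∀ r ∈ G, ∀ s ∈ G, |(r.1 - r.2) - (s.1 - s.2)| ≤ |(r.1 + r.2) - (s.1 + s.2)| := by
    intro r hr s hs
    have := hG.1 r hr s hs
    simp only [cost] at this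
    exact sq_le_sq.1 (by nlinarith)
  let σ : ℝ × ℝ → ℝ := fun x => x.1 + x.2
  have hsel : ∀ t ∈ σ '' G, ∃ x ∈ G, σ x = t := fun t ht => ht
  choose! x hxG hxt using hsel
  have hLip : LipschitzOnWith 1 (fun t => (x t).1 - (x t).2) (σ '' G) := by
    refine LipschitzOnWith.of_dist_le_mul fun s hs t ht => ?_
    have := key _ (hxG s hs) _ (hxG t ht)
    have e1 := hxt s hs
    have e2 := hxt t ht
    simp only [σ] at e1 e2
    rw [e1, e2] at this
    rw [Real.dist_eq, Real.dist_eq, NNReal.coe_one, one_mul]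
    exact this
  obtain ⟨u, hu, huG⟩ := hLip.extend_real
  have hu' : ∀ s t, s ≤ t → |u s - u t| ≤ t - s := by
    intro s t hst
    have := hu.dist_le_mul s t
    simpa [Real.dist_eq, abs_of_nonpos (sub_nonpos.2 hst)] using this
  have hp : IsPair (fun t => (t + u t) / 2) (fun t => (t - u t) / 2) := by
    refine ⟨fun s t hst => ?_, fun s t hst => ?_, fun t => by ring⟩
    · have := abs_le.1 (hu' s t hst); linarith
    · have := abs_le.1 (hu' s t hst); linarith
  refine ⟨_, _, hp, ?_⟩
  have hsub : G ⊆ Set.range fun t => ((t + u t) / 2, (t - u t) / 2) := by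
    intro y hy
    have hy' : σ y ∈ σ '' G := ⟨y, hy, rfl⟩
    have h1 := huG hy'
    have h2 := key y hy _ (hxG _ hy')
    have h3 := hxt _ hy'
    simp only [σ] at h1 h2 h3
    rw [h3, sub_self, abs_zero, abs_nonpos_iff] at h2
    refine ⟨y.1 + y.2, ?_⟩
    ext <;> simp only <;> linarith
  exact hsub.antisymm (hG.2 hp.isMaximalMonotone.1 hsub)

theorem IsPair.phi_range (h : IsPair a b) (y : ℝ × ℝ) :
    phi (Set.range fun t => (a t, b t)) y = -((defect a b y : ENNReal) : EReal) := by
  simp only [phi, iInf_range]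
  apply le_antisymm
  · rw [← EReal.neg_le_neg_iff, neg_neg]
    by_cases htop : -(⨅ t, ((cost (a t, b t) y : ℝ) : EReal)) = ⊤
    · rw [htop]; exact le_top
    rw [defect]
    have h0 : (0 : EReal) ≤ -(⨅ t, ((cost (a t, b t) y : ℝ) : EReal)) := by
      rw [← EReal.neg_le_neg_iff, neg_neg, neg_zero]
      refine (iInf_le _ (y.1 + y.2)).trans ?_
      have := h.profile_add y
      rw [profile] at this
      rw [cost, this]
      exact_mod_cast neg_nonpos.2 (sq_nonneg _)
    rw [← EReal.coe_toENNReal h0, EReal.coe_ennreal_le_coe_ennreal_iff]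
    refine iSup_le fun t => ?_
    rw [← EReal.coe_ennreal_le_coe_ennreal_iff, EReal.coe_toENNReal h0]
    rcases le_total 0 (-(profile a b y t)) with hp | hp
    · rw [EReal.coe_ennreal_ofReal, max_eq_left hp, EReal.coe_neg, EReal.neg_le_neg_iff]
      exact iInf_le _ t
    · rw [ENNReal.ofReal_of_nonpos hp]; simpa using h0
  · refine le_iInf fun t => ?_
    rw [← EReal.neg_le_neg_iff, neg_neg, ← EReal.coe_neg]
    refine le_trans ?_ (EReal.coe_ennreal_le_coe_ennreal_iff.2
      (le_iSup (fun t => ENNReal.ofReal (-(profile a b y t))) t))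
    rw [EReal.coe_ennreal_ofReal]
    exact_mod_cast le_max_left _ _

theorem IsPair.dualValue_range (h : IsPair a b) (ν : Measure (ℝ × ℝ)) :
    dualValue ν (Set.range fun t => (a t, b t)) =
      -((∫⁻ y, defect a b y ∂ν : ENNReal) : EReal) := by
  simp [dualValue, h.phi_range]

/-- `a, b` parametrize a dual maximizer. -/
structure IsOptPair (ν : Measure (ℝ × ℝ)) (a b : ℝ → ℝ) : Prop where
  isPair : IsPair a b
  le : ∀ a' b', IsPair a' b' → ∫⁻ y, defect a b y ∂ν ≤ ∫⁻ y, defect a' b' y ∂ν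

theorem IsDualMaximizer.exists_pair {ν : Measure (ℝ × ℝ)} {G : Set (ℝ × ℝ)}
    (hG : IsDualMaximizer ν G) :
    ∃ a b, IsOptPair ν a b ∧ G = Set.range fun t => (a t, b t) := by
  obtain ⟨a, b, hp, rfl⟩ := hG.1.exists_pair
  refine ⟨a, b, ⟨hp, fun a' b' hp' => ?_⟩, rfl⟩
  have := hG.2 _ hp'.isMaximalMonotone
  rw [hp.dualValue_range, hp'.dualValue_range, EReal.neg_le_neg_iff] at this
  exact_mod_cast this

theorem IsOptPair.swap {ν : Measure (ℝ × ℝ)} (h : IsOptPair ν a b) :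
    IsOptPair (ν.map Prod.swap) b a := by
  refine ⟨h.isPair.swap, fun a' b' hp => ?_⟩
  rw [lintegral_map (measurable_defect _ _) measurable_swap,
    lintegral_map (measurable_defect _ _) measurable_swap]
  simp only [defect_swap]
  simpa only [defect_swap] using (h.le b' a' hp.swap).trans_eq
    (lintegral_congr fun y => (defect_swap b' a' y).symm)

theorem IsOptPair.reflect {ν : Measure (ℝ × ℝ)} (h : IsOptPair ν a b) :
    IsOptPair (ν.map Neg.neg) (reflect a) (reflect b) := by
  refine ⟨h.isPair.reflect, fun a' b' hp => ?_⟩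
  rw [lintegral_map (measurable_defect _ _) measurable_neg,
    lintegral_map (measurable_defect _ _) measurable_neg]
  simp only [defect_reflect]
  refine (h.le _ _ hp.reflect).trans_eq (lintegral_congr fun y => ?_)
  rw [← defect_reflect a' b' (-y), neg_neg]

theorem segments_range (h : IsPair a b) :
    segments (Set.range fun t => (a t, b t)) = segs a b := by
  ext y
  simp only [segments, verticalSegments, horizontalSegments, Set.mem_union, Set.mem_iUnion,
    Set.mem_ofPred_eq, segs, exists_prop, Set.mem_range]
  have inj : ∀ s t, a s = a t → b s = b t → s = t := fun s t h1 h2 => by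
    rw [← h.add_eq s, ← h.add_eq t, h1, h2]
  constructor
  · rintro (⟨c, hc, ⟨t, rfl⟩, h2⟩ | ⟨c, hc, ⟨t, rfl⟩, h2⟩)
    · obtain ⟨z, ⟨⟨s, rfl⟩, hz⟩, hne⟩ := hc.exists_ne (a t, b t)
      exact ⟨s, t, fun e => hne (by rw [e]), rfl, Or.inl (hz.trans h2.symm)⟩
    · obtain ⟨z, ⟨⟨s, rfl⟩, hz⟩, hne⟩ := hc.exists_ne (a t, b t)
      exact ⟨s, t, fun e => hne (by rw [e]), rfl, Or.inr (hz.trans h2.symm)⟩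
  · rintro ⟨s, t, hst, rfl, h1 | h1⟩
    · refine Or.inl ⟨a t, ⟨(a s, b s), ⟨⟨s, rfl⟩, h1⟩, (a t, b t), ⟨⟨t, rfl⟩, rfl⟩, ?_⟩, ⟨t, rfl⟩, rfl⟩
      intro e; rw [Prod.mk.injEq] at e; exact hst (inj s t e.1 e.2)
    · refine Or.inr ⟨b t, ⟨(a s, b s), ⟨⟨s, rfl⟩, h1⟩, (a t, b t), ⟨⟨t, rfl⟩, rfl⟩, ?_⟩, ⟨t, rfl⟩, rfl⟩
      intro e; rw [Prod.mk.injEq] at e; exact hst (inj s t e.1 e.2)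

/-- Between two parameters with the same coordinate the coordinate is constant, so a rational
parameter can be found. -/
theorem exists_rat_eq (ha : Monotone a) {s t : ℝ} (hst : s ≠ t) (h : a s = a t) :
    ∃ q : ℚ, (q : ℝ) ≠ t ∧ a q = a t := by
  rcases lt_or_gt_of_ne hst with hlt | hlt
  · obtain ⟨q, h1, h2⟩ := exists_rat_btwn hlt
    exact ⟨q, h2.ne, le_antisymm (ha h2.le) (h ▸ ha h1.le)⟩
  · obtain ⟨q, h1, h2⟩ := exists_rat_btwn hlt
    exact ⟨q, h1.ne', le_antisymm (h ▸ ha h2.le) (ha h1.le)⟩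

theorem IsPair.measurableSet_segs (h : IsPair a b) : MeasurableSet (segs a b) := by
  have hc1 := h.continuous.measurable
  have hc2 := h.swap.continuous.measurable
  have : segs a b = ⋃ q : ℚ, {y | ((q : ℝ) ≠ y.1 + y.2 ∧ a (y.1 + y.2) = y.1 ∧ b (y.1 + y.2) = y.2)
      ∧ (a q = y.1 ∨ b q = y.2)} := by
    ext y
    simp only [segs, Set.mem_ofPred_eq, Set.mem_iUnion]
    constructor
    · rintro ⟨s, t, hst, rfl, h1 | h1⟩
      · obtain ⟨q, hq, e⟩ := exists_rat_eq h.mono_fst hst h1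
        exact ⟨q, by simp only [h.add_eq]; exact ⟨⟨hq, trivial, trivial⟩, Or.inl e⟩⟩
      · obtain ⟨q, hq, e⟩ := exists_rat_eq h.mono_snd hst h1
        exact ⟨q, by simp only [h.add_eq]; exact ⟨⟨hq, trivial, trivial⟩, Or.inr e⟩⟩
    · rintro ⟨q, ⟨hq, h1, h2⟩, h3⟩
      exact ⟨q, y.1 + y.2, hq, by rw [h1, h2], by rwa [h1, h2]⟩
  rw [this]
  have hs : Measurable fun y : ℝ × ℝ => y.1 + y.2 := by fun_prop
  refine MeasurableSet.iUnion fun q => ?_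
  refine MeasurableSet.inter (MeasurableSet.inter ?_ (MeasurableSet.inter ?_ ?_))
    (MeasurableSet.union ?_ ?_)
  · exact (measurableSet_eq_fun measurable_const hs).compl
  · exact measurableSet_eq_fun (hc1.comp hs) measurable_fst
  · exact measurableSet_eq_fun (hc2.comp hs) measurable_snd
  · exact measurableSet_eq_fun measurable_const measurable_fst
  · exact measurableSet_eq_fun measurable_const measurable_snd

end BackwardTransport

namespace BackwardTransport

variable {a b : ℝ → ℝ} {ν : Measure (ℝ × ℝ)}

/-! ### First variation of the dual problem -/

theorem IsPair.exists_perturbation (h : IsPair a b) {k : ℝ → ℝ} (hk : Continuous k) {C : ℝ}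
    (hC : ∀ t, |k t| ≤ C) (hm : Monotone fun t => b t + k t) :
    ∃ a' b', IsPair a' b' ∧ ∀ s, ∃ t, a' s = a t ∧ b' s = b t + k t := by
  have hsurj : Function.Surjective fun t => t + k t := by
    refine Continuous.surjective (by fun_prop) ?_ ?_
    · refine tendsto_atTop_mono (fun t => ?_) (tendsto_atTop_add_const_right atTop (-C) tendsto_id)
      have := (abs_le.1 (hC t)).1; simp only [id]; linarith
    · refine tendsto_atBot_mono (fun t => ?_) (tendsto_atBot_add_const_right atBot C tendsto_id)
      have := (abs_le.1 (hC t)).2; simp only [id]; linarith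
  choose r hr using hsurj
  have hr' : ∀ s, a (r s) + (b (r s) + k (r s)) = s := fun s => by
    rw [← add_assoc, h.add_eq]; exact hr s
  have hrm : Monotone r := by
    intro s s' hss
    rcases hss.eq_or_lt with rfl | hlt
    · rfl
    · by_contra! hlt'
      have h1 := h.mono_fst hlt'.le
      have h2 := hm hlt'.le
      have h3 := hr' s
      have h4 := hr' s'
      simp only at h2
      linarith
  exact ⟨a ∘ r, (fun t => b t + k t) ∘ r, ⟨h.mono_fst.comp hrm, hm.comp hrm, hr'⟩,
    fun s => ⟨r s, rfl, rfl⟩⟩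

/-- One-sided first-order optimality condition for the perturbation `b + ε h`. -/
theorem IsOptPair.first_variation (ho : IsOptPair ν a b) (hfin : ∫⁻ y, defect a b y ∂ν ≠ ⊤)
    {h : ℝ → ℝ} (hh : Continuous h) {C : ℝ} (hC : ∀ t, |h t| ≤ C)
    (hm : ∃ ε₀ > 0, ∀ ε, 0 < ε → ε ≤ ε₀ → Monotone fun t => b t + ε * h t)
    {w : ℝ × ℝ → ℝ} (hw : Measurable w) (hw0 : ∀ y, 0 ≤ w y)
    (hwfin : ∫⁻ y, ENNReal.ofReal (w y) ∂ν ≠ ⊤) (hb : ∀ t y, -w y ≤ h t * (a t - y.1)) :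
    ∃ L : ℝ × ℝ → ENNReal, Measurable L ∧ ∫⁻ y, L y ∂ν ≤ ∫⁻ y, ENNReal.ofReal (w y) ∂ν ∧
      ∀ y, defect a b y < ⊤ → ∀ α ≥ 0, ∀ δ > 0,
        (∀ t, profile a b y t < -(defect a b y).toReal + δ → α ≤ h t * (a t - y.1) + w y) →
        ENNReal.ofReal α ≤ L y := by
  obtain ⟨ε₀, hε₀, hm⟩ := hm
  let ε : ℕ → ℝ := fun n => ε₀ / (n + 1)
  have hεpos : ∀ n, 0 < ε n := fun n => by positivity
  have hεle : ∀ n, ε n ≤ ε₀ := fun n => div_le_self hε₀.le (by linarith [n.cast_nonneg (α := ℝ)])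
  have hεlim : Tendsto ε atTop (𝓝 0) := by
    have := tendsto_one_div_add_atTop_nhds_zero_nat.const_mul ε₀
    simpa [ε, div_eq_mul_inv] using this
  have hpert : ∀ n, ∃ a' b', IsPair a' b' ∧ ∀ s, ∃ t, a' s = a t ∧ b' s = b t + ε n * h t :=
    fun n => ho.isPair.exists_perturbation (k := fun t => ε n * h t) (by fun_prop)
      (C := ε n * C)
      (fun t => by rw [abs_mul, abs_of_pos (hεpos n)]; gcongr; exact hC t)
      (hm _ (hεpos n) (hεle n))
  choose a' b' hp hst using hpert
  have hprof : ∀ n y s, ∃ t, profile (a' n) (b' n) y s =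
      profile a b y t + ε n * (h t * (a t - y.1)) := by
    intro n y s
    obtain ⟨t, h1, h2⟩ := hst n s
    exact ⟨t, by rw [profile, profile, h1, h2]; ring⟩
  have hle : ∀ n y, defect (a' n) (b' n) y ≤ defect a b y + ENNReal.ofReal (ε n * w y) := by
    intro n y
    refine iSup_le fun s => ?_
    obtain ⟨t, ht⟩ := hprof n y s
    have h1 : -(profile (a' n) (b' n) y s) ≤ -(profile a b y t) + ε n * w y := by
      rw [ht]; nlinarith [hb t y, hεpos n]
    refine (ENNReal.ofReal_le_ofReal h1).trans (ENNReal.ofReal_add_le.trans ?_)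
    gcongr
    exact le_iSup (fun t => ENNReal.ofReal (-(profile a b y t))) t
  let D : ℕ → ℝ × ℝ → ENNReal := fun n y =>
    (defect a b y + ENNReal.ofReal (ε n * w y) - defect (a' n) (b' n) y) *
      (ENNReal.ofReal (ε n))⁻¹
  have hmw : ∀ n, Measurable fun y => ENNReal.ofReal (ε n * w y) := fun n => by fun_prop
  have hDm : ∀ n, Measurable (D n) := fun n =>
    ((((measurable_defect a b).add (hmw n)).sub (measurable_defect _ _)).mul_const _)
  have hDint : ∀ n, ∫⁻ y, D n y ∂ν ≤ ∫⁻ y, ENNReal.ofReal (w y) ∂ν := by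
    intro n
    have hε0 : ENNReal.ofReal (ε n) ≠ 0 := by simpa using hεpos n
    have e1 : ∫⁻ y, ENNReal.ofReal (ε n * w y) ∂ν =
        ENNReal.ofReal (ε n) * ∫⁻ y, ENNReal.ofReal (w y) ∂ν := by
      rw [← lintegral_const_mul _ (by fun_prop)]
      exact lintegral_congr fun y => ENNReal.ofReal_mul (hεpos n).le
    have e2 : ∫⁻ y, (defect a b y + ENNReal.ofReal (ε n * w y)) ∂ν =
        ∫⁻ y, defect a b y ∂ν + ENNReal.ofReal (ε n) * ∫⁻ y, ENNReal.ofReal (w y) ∂ν := by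
      rw [lintegral_add_right _ (hmw n), e1]
    have hfin' : ∫⁻ y, defect (a' n) (b' n) y ∂ν ≠ ⊤ := by
      refine ((lintegral_mono (hle n)).trans_lt ?_).ne
      rw [e2]
      exact ENNReal.add_lt_top.2 ⟨hfin.lt_top, ENNReal.mul_lt_top ENNReal.ofReal_lt_top hwfin.lt_top⟩
    have hm1 : Measurable fun y =>
        defect a b y + ENNReal.ofReal (ε n * w y) - defect (a' n) (b' n) y :=
      ((measurable_defect a b).add (hmw n)).sub (measurable_defect _ _)
    simp only [D]
    rw [lintegral_mul_const _ hm1,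
      lintegral_sub (measurable_defect _ _) hfin' (Eventually.of_forall (hle n)), e2]
    rw [← div_eq_mul_inv]
    refine ENNReal.div_le_of_le_mul ?_
    rw [tsub_le_iff_left, mul_comm]
    exact add_le_add (ho.le _ _ (hp n)) le_rfl
  refine ⟨fun y => liminf (fun n => D n y) atTop, Measurable.liminf hDm,
    (lintegral_liminf_le hDm).trans ?_, ?_⟩
  · refine (liminf_le_liminf (Eventually.of_forall hDint)).trans ?_
    simp
  · intro y hy α hα δ hδ H
    refine le_liminf_of_le (by isBoundedDefault) ?_
    have hev : ∀ᶠ n in atTop, ε n * α < δ := by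
      have := hεlim.mul_const α
      rw [zero_mul] at this
      exact this.eventually (gt_mem_nhds hδ)
    filter_upwards [hev] with n hn
    set W := (defect a b y).toReal
    have hVW : defect a b y = ENNReal.ofReal W := (ENNReal.ofReal_toReal hy.ne).symm
    have hW : 0 ≤ W := ENNReal.toReal_nonneg
    have hlow : ∀ s, -(W + ε n * w y - ε n * α) ≤ profile (a' n) (b' n) y s := by
      intro s
      obtain ⟨t, ht⟩ := hprof n y s
      rw [ht]
      have h1 := neg_defect_le hy t
      by_cases hc : profile a b y t < -W + δ
      · have := mul_le_mul_of_nonneg_left (H t hc) (hεpos n).le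
        have e : (defect a b y).toReal = W := rfl
        rw [e] at h1
        linarith
      · have := mul_le_mul_of_nonneg_left (hb t y) (hεpos n).le
        push Not at hc
        linarith
    obtain ⟨h1, h2⟩ := (hp n).defect_le hlow
    have h3 : defect (a' n) (b' n) y ≤ ENNReal.ofReal (W + ε n * w y - ε n * α) := by
      rw [← ENNReal.ofReal_toReal h1.ne]; exact ENNReal.ofReal_le_ofReal h2
    have h4 : 0 ≤ W + ε n * w y - ε n * α := ENNReal.toReal_nonneg.trans h2
    have hε0 : ENNReal.ofReal (ε n) ≠ 0 := by simpa using hεpos n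
    change _ ≤ _ * _
    rw [← div_eq_mul_inv, ENNReal.le_div_iff_mul_le (Or.inl hε0) (Or.inl ENNReal.ofReal_ne_top)]
    refine ENNReal.le_sub_of_add_le_right h1.ne ?_
    rw [hVW, ← ENNReal.ofReal_mul hα, ← ENNReal.ofReal_add hW (mul_nonneg (hεpos n).le (hw0 y))]
    refine (add_le_add_right h3 _).trans ?_
    rw [← ENNReal.ofReal_add (by have := hεpos n; positivity) h4]
    exact ENNReal.ofReal_le_ofReal (by linarith)

/-- The one-sided optimality condition along a sequence of perturbations. -/
theorem IsOptPair.first_variation_seq (ho : IsOptPair ν a b)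
    (hfin : ∫⁻ y, defect a b y ∂ν ≠ ⊤)
    {h : ℕ → ℝ → ℝ} (hh : ∀ n, Continuous (h n)) {C : ℝ} (hC : ∀ n t, |h n t| ≤ C)
    (hm : ∀ n, ∃ ε₀ > 0, ∀ ε, 0 < ε → ε ≤ ε₀ → Monotone fun t => b t + ε * h n t)
    {w : ℝ × ℝ → ℝ} (hw : Measurable w) (hw0 : ∀ y, 0 ≤ w y)
    (hwfin : ∫⁻ y, ENNReal.ofReal (w y) ∂ν ≠ ⊤) (hb : ∀ n t y, -w y ≤ h n t * (a t - y.1)) :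
    ∃ L : ℝ × ℝ → ENNReal, Measurable L ∧ ∫⁻ y, L y ∂ν ≤ ∫⁻ y, ENNReal.ofReal (w y) ∂ν ∧
      ∀ y, defect a b y < ⊤ → ∀ α ≥ 0, (∀ᶠ n in atTop, ∃ δ > 0, ∀ t,
        profile a b y t < -(defect a b y).toReal + δ → α ≤ h n t * (a t - y.1) + w y) →
        ENNReal.ofReal α ≤ L y := by
  choose L hLm hLi hL using fun n =>
    ho.first_variation hfin (hh n) (hC n) (hm n) hw hw0 hwfin (hb n)
  refine ⟨fun y => liminf (fun n => L n y) atTop, Measurable.liminf hLm,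
    (lintegral_liminf_le hLm).trans ?_, ?_⟩
  · refine (liminf_le_liminf (Eventually.of_forall hLi)).trans ?_
    simp
  · intro y hy α hα H
    refine le_liminf_of_le (by isBoundedDefault) ?_
    filter_upwards [H] with n ⟨δ, hδ, hn⟩
    exact hL n y hy α hα δ hδ hn

end BackwardTransport

namespace BackwardTransport

variable {a b : ℝ → ℝ} {ν : Measure (ℝ × ℝ)}

/-! ### Sets with uniformly decreasing chords -/

/-- All chords of `A` have nonpositive slopes, bounded away from zero and infinity. -/
def DecreasingChords (K : ℝ) (A : Set (ℝ × ℝ)) : Prop :=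
  ∀ y ∈ A, ∀ z ∈ A, (y.1 - z.1) * (y.2 - z.2) ≤ 0 ∧ |y.1 - z.1| ≤ K * |y.2 - z.2| ∧
    |y.2 - z.2| ≤ K * |y.1 - z.1|

theorem IsDRegular.measure_eq_zero (hν : IsDRegular ν) {K : ℝ} (hK : 1 ≤ K) {A : Set (ℝ × ℝ)}
    (hA : DecreasingChords K A) : ν A = 0 := by
  have hK0 : 0 < K := by linarith
  have hsel : ∀ t ∈ Prod.fst '' A, ∃ y ∈ A, y.1 = t := fun t ht => ht
  choose! y hyA hyt using hsel
  set c := (K + 1 / K) / 2 with hc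
  have hKc : 1 / K ≤ K := by
    rw [div_le_iff₀ hK0]; nlinarith
  have hbound : ∀ s ∈ Prod.fst '' A, ∀ t ∈ Prod.fst '' A, s < t →
      1 / K * (t - s) ≤ (y s).2 - (y t).2 ∧ (y s).2 - (y t).2 ≤ K * (t - s) := by
    intro s hs t ht hst
    obtain ⟨h1, h2, h3⟩ := hA _ (hyA s hs) _ (hyA t ht)
    rw [hyt s hs, hyt t ht] at h1 h2 h3
    have h4 : 0 ≤ (y s).2 - (y t).2 := by nlinarith
    rw [abs_of_neg (by linarith : s - t < 0), abs_of_nonneg h4] at h2 h3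
    refine ⟨?_, by linarith⟩
    rw [one_div, inv_mul_le_iff₀ hK0]; linarith
  have hLip : LipschitzOnWith ((K - 1 / K) / 2).toNNReal (fun t => (y t).2 + c * t)
      (Prod.fst '' A) := by
    refine LipschitzOnWith.of_dist_le_mul fun s hs t ht => ?_
    rw [Real.dist_eq, Real.dist_eq, Real.coe_toNNReal _ (by linarith)]
    rcases lt_trichotomy s t with hst | rfl | hst
    · obtain ⟨h1, h2⟩ := hbound s hs t ht hst
      rw [abs_of_neg (by linarith : s - t < 0), abs_le]
      constructor <;> rw [hc] <;> nlinarith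
    · simp
    · obtain ⟨h1, h2⟩ := hbound t ht s hs hst
      rw [abs_of_pos (by linarith : 0 < s - t), abs_le]
      constructor <;> rw [hc] <;> nlinarith
  obtain ⟨g, hg, hgA⟩ := hLip.extend_real
  have hD : (fun t => (t, g t - c * t)) '' Set.univ ∈ decreasingGraphs := by
    refine ⟨Set.univ, fun t => g t - c * t, K, Set.univ_nonempty, isClosed_univ,
      Set.ordConnected_univ, hK0, fun s _ t _ hst => ?_, rfl⟩
    have := hg.dist_le_mul s t
    rw [Real.dist_eq, Real.dist_eq, Real.coe_toNNReal _ (by linarith), abs_of_neg (by linarith : s - t < 0),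
      abs_le] at this
    rw [hc]
    constructor <;> nlinarith [this.1, this.2]
  refine measure_mono_null (fun z hz => ?_) (hν _ hD)
  have hz1 : z.1 ∈ Prod.fst '' A := ⟨z, hz, rfl⟩
  have h1 := hgA hz1
  obtain ⟨-, -, h2⟩ := hA _ (hyA _ hz1) z hz
  rw [hyt _ hz1, sub_self, abs_zero, mul_zero, abs_nonpos_iff] at h2
  refine ⟨z.1, trivial, ?_⟩
  ext
  · rfl
  · simp only at h1 ⊢; linarith

/-- A probability measure with finite second moment that does not charge sets with decreasing
chords, and a parametrized dual maximizer. -/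
structure RegularOptPair (ν : Measure (ℝ × ℝ)) (a b : ℝ → ℝ) : Prop where
  isProb : IsProbabilityMeasure ν
  opt : IsOptPair ν a b
  moment : ∫⁻ y, ENNReal.ofReal (y.1 ^ 2 + y.2 ^ 2) ∂ν ≠ ⊤
  null : ∀ K, 1 ≤ K → ∀ A, DecreasingChords K A → ν A = 0

theorem RegularOptPair.swap (S : RegularOptPair ν a b) :
    RegularOptPair (ν.map Prod.swap) b a := by
  have := S.isProb
  refine ⟨Measure.isProbabilityMeasure_map measurable_swap.aemeasurable, S.opt.swap, ?_, ?_⟩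
  · rw [lintegral_map (by fun_prop) measurable_swap]
    simpa only [Prod.fst_swap, Prod.snd_swap, add_comm] using S.moment
  · intro K hK A hA
    rw [show (Prod.swap : ℝ × ℝ → ℝ × ℝ) = MeasurableEquiv.prodComm from rfl,
      MeasurableEquiv.map_apply]
    refine S.null K hK _ fun y hy z hz => ?_
    obtain ⟨h1, h2, h3⟩ := hA _ hy _ hz
    exact ⟨by rw [mul_comm]; exact h1, h3, h2⟩

theorem RegularOptPair.reflect (S : RegularOptPair ν a b) :
    RegularOptPair (ν.map Neg.neg) (reflect a) (reflect b) := by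
  have := S.isProb
  refine ⟨Measure.isProbabilityMeasure_map measurable_neg.aemeasurable, S.opt.reflect, ?_, ?_⟩
  · rw [lintegral_map (by fun_prop) measurable_neg]
    simpa using S.moment
  · intro K hK A hA
    rw [show (Neg.neg : ℝ × ℝ → ℝ × ℝ) = MeasurableEquiv.neg (ℝ × ℝ) from rfl,
      MeasurableEquiv.map_apply]
    refine S.null K hK _ fun y hy z hz => ?_
    obtain ⟨h1, h2, h3⟩ := hA _ hy _ hz
    simp only [MeasurableEquiv.neg_apply, Prod.fst_neg, Prod.snd_neg] at h1 h2 h3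
    rw [← abs_neg (-y.1 - -z.1), ← abs_neg (-y.2 - -z.2)] at h2 h3
    simp only [neg_sub, sub_neg_eq_add, neg_add_eq_sub] at h1 h2 h3
    exact ⟨by linarith, h2, h3⟩

theorem RegularOptPair.isPair (S : RegularOptPair ν a b) : IsPair a b := S.opt.isPair

theorem RegularOptPair.null_of_subsingleton (S : RegularOptPair ν a b) {A : Set (ℝ × ℝ)}
    (hA : A.Subsingleton) : ν A = 0 :=
  S.null 1 le_rfl A fun y hy z hz => by rw [hA hy hz]; simp

theorem RegularOptPair.ae_of_swap (_ : RegularOptPair ν a b) {p : ℝ × ℝ → Prop}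
    (h : ∀ᵐ y ∂(ν.map Prod.swap), p y) : ∀ᵐ y ∂ν, p y.swap :=
  ae_of_ae_map measurable_swap.aemeasurable h

theorem RegularOptPair.ae_of_reflect (_ : RegularOptPair ν a b) {p : ℝ × ℝ → Prop}
    (h : ∀ᵐ y ∂(ν.map Neg.neg), p y) : ∀ᵐ y ∂ν, p (-y) :=
  ae_of_ae_map measurable_neg.aemeasurable h

theorem RegularOptPair.lintegral_defect_ne_top (S : RegularOptPair ν a b) :
    ∫⁻ y, defect a b y ∂ν ≠ ⊤ := by
  have hp : IsPair (fun t => t / 2) (fun t => t / 2) :=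
    ⟨fun s t h => by linarith, fun s t h => by linarith, fun t => by ring⟩
  refine ((S.opt.le _ _ hp).trans (lintegral_mono fun y => ?_)).trans_lt
    S.moment.lt_top |>.ne
  refine iSup_le fun t => ENNReal.ofReal_le_ofReal ?_
  simp only [profile]
  nlinarith [sq_nonneg (t / 2 - (y.1 + y.2) / 2), sq_nonneg (y.1 + y.2), sq_nonneg (y.1 - y.2)]

theorem RegularOptPair.lintegral_affine_ne_top (S : RegularOptPair ν a b) (C : ℝ) :
    ∫⁻ y, ENNReal.ofReal (C + |y.1|) ∂ν ≠ ⊤ := by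
  have := S.isProb
  have h : ∀ y : ℝ × ℝ, ENNReal.ofReal (C + |y.1|) ≤
      ENNReal.ofReal (C + 1) + ENNReal.ofReal (y.1 ^ 2 + y.2 ^ 2) := by
    intro y
    refine (ENNReal.ofReal_le_ofReal ?_).trans ENNReal.ofReal_add_le
    nlinarith [sq_nonneg (|y.1| - 1), sq_abs y.1, sq_nonneg y.2, abs_nonneg y.1]
  refine ((lintegral_mono h).trans_lt ?_).ne
  rw [lintegral_add_left measurable_const, lintegral_const]
  simp [S.moment.lt_top]

theorem RegularOptPair.ae_defect_lt_top (S : RegularOptPair ν a b) :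
    ∀ᵐ y ∂ν, defect a b y < ⊤ :=
  ae_lt_top (measurable_defect a b) S.lintegral_defect_ne_top

/-! ### Minimizing sequences do not escape to infinity -/

theorem RegularOptPair.ae_not_escape_fst (S : RegularOptPair ν a b) :
    ∀ᵐ y ∂ν, defect a b y < ⊤ → ∃ M, ∀ δ > 0, ∃ t,
      profile a b y t < -(defect a b y).toReal + δ ∧ a t < M := by
  have hmono : Monotone fun t => max 0 (min 1 (a t)) := fun s t hst =>
    max_le_max le_rfl (min_le_min le_rfl (S.isPair.mono_fst hst))
  have ha := S.isPair.continuous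
  obtain ⟨L, hLm, hLi, hL⟩ := S.opt.first_variation S.lintegral_defect_ne_top
    (h := fun t => max 0 (min 1 (a t))) (by fun_prop) (C := 1)
    (fun t => by
      rw [abs_of_nonneg (le_max_left _ _)]; exact max_le zero_le_one (min_le_left _ _))
    ⟨1, one_pos, fun ε hε _ s t hst => by
      have h1 := S.isPair.mono_snd hst
      have h2 := mul_le_mul_of_nonneg_left (hmono hst) hε.le
      simp only at h2 ⊢; linarith⟩
    (w := fun y => 0 + |y.1|) (by fun_prop) (fun y => by positivity)
    (S.lintegral_affine_ne_top 0)
    (fun t y => by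
      rcases le_total (a t) 0 with h0 | h0
      · rw [max_eq_left (min_le_of_right_le h0)]
        have := abs_nonneg y.1; simp only [zero_add, zero_mul]; linarith
      · have h1 : 0 ≤ min 1 (a t) := le_min zero_le_one h0
        have h2 : min 1 (a t) ≤ 1 := min_le_left _ _
        rw [max_eq_right h1]
        nlinarith [abs_nonneg y.1, le_abs_self y.1, mul_nonneg h1 h0])
  have hLfin := ae_lt_top hLm (hLi.trans_lt (S.lintegral_affine_ne_top 0).lt_top).ne
  filter_upwards [hLfin] with y hy hdom
  by_contra! H
  refine hy.ne (ENNReal.eq_top_of_forall_nnreal_le fun α => ?_)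
  obtain ⟨δ, hδ, hM⟩ := H (max 1 (α + |y.1|))
  rw [← ENNReal.ofReal_coe_nnreal]
  refine hL y hdom α α.2 δ hδ fun t ht => ?_
  have h1 := hM t ht
  have h2 := (le_max_left _ _).trans h1
  have h3 := (le_max_right _ _).trans h1
  rw [min_eq_left h2, max_eq_right zero_le_one]
  have := le_abs_self y.1
  linarith [abs_nonneg y.1]

/-- There are approximate minimizers of the profile of `y` with arbitrarily large parameters. -/
def Escapes (a b : ℝ → ℝ) (y : ℝ × ℝ) : Prop :=
  ∀ δ > 0, ∀ M, ∃ t > M, profile a b y t < -(defect a b y).toReal + δ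

theorem IsPair.escapes_snd_lt (h : IsPair a b) (hub : ∀ N, ∃ t, N ≤ a t) {y : ℝ × ℝ}
    (hy : y ∉ segs a b) (hdom : defect a b y < ⊤) (hesc : Escapes a b y) :
    (∀ t, b t < y.2) ∧ ∀ κ > 0, ∃ t, y.2 - κ < b t := by
  have hW : 0 ≤ (defect a b y).toReal := ENNReal.toReal_nonneg
  have hle : ∀ t, b t ≤ y.2 := by
    by_contra! H
    obtain ⟨t₀, ht₀⟩ := H
    obtain ⟨t₁, ht₁⟩ := hub (y.1 + 1 / (b t₀ - y.2))
    obtain ⟨t, ht, htp⟩ := hesc 1 one_pos (max t₀ t₁)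
    have h1 := h.mono_snd ((le_max_left _ _).trans ht.le)
    have h2 := h.mono_fst ((le_max_right _ _).trans ht.le)
    have h3 : 0 < b t₀ - y.2 := by linarith
    have h4 : 1 / (b t₀ - y.2) * (b t₀ - y.2) = 1 := by field_simp
    have h5 : 1 / (b t₀ - y.2) * (b t₀ - y.2) ≤ profile a b y t :=
      mul_le_mul (by linarith) (by linarith) h3.le (by
        have : 0 < 1 / (b t₀ - y.2) := by positivity
        linarith)
    linarith
  refine ⟨fun t₀ => (hle t₀).lt_of_ne fun heq => hy ?_, ?_⟩
  · have hconst : ∀ t, t₀ ≤ t → b t = y.2 := fun t ht =>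
      le_antisymm (hle t) (heq ▸ h.mono_snd ht)
    have hW0 : (defect a b y).toReal = 0 := by
      refine le_antisymm (le_of_forall_pos_le_add fun δ hδ => ?_) hW
      obtain ⟨t, ht, htp⟩ := hesc δ hδ t₀
      rw [profile, hconst t ht.le, sub_self, mul_zero] at htp
      linarith
    have := h.eq_of_defect hdom hW0
    refine ⟨max t₀ (y.1 + y.2) + 1, y.1 + y.2, ?_, this, Or.inr ?_⟩
    · have := le_max_right t₀ (y.1 + y.2); intro e; linarith
    · rw [hconst _ (by linarith [le_max_left t₀ (y.1 + y.2)])]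
      exact congrArg Prod.snd this
  · intro κ hκ
    by_contra! H
    obtain ⟨t, ht⟩ := hub (y.1 + ((defect a b y).toReal + 1) / κ)
    have h1 := neg_defect_le hdom t
    have h2 : ((defect a b y).toReal + 1) / κ * κ = (defect a b y).toReal + 1 := by field_simp
    have h3 : 0 ≤ ((defect a b y).toReal + 1) / κ := by positivity
    rw [profile] at h1
    have h4 : ((defect a b y).toReal + 1) / κ * κ ≤ (a t - y.1) * (y.2 - b t) :=
      mul_le_mul (by linarith) (by linarith [H t]) hκ.le (by linarith)
    linarith

theorem RegularOptPair.ae_not_escapes_of_fst (S : RegularOptPair ν a b)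
    (hub : ∀ N, ∃ t, N ≤ a t) :
    ∀ᵐ y ∂ν, y ∉ segs a b → defect a b y < ⊤ → ¬ Escapes a b y := by
  have hsub : {y | y ∉ segs a b ∧ defect a b y < ⊤ ∧ Escapes a b y ∧ ∃ M, ∀ δ > 0, ∃ t,
      profile a b y t < -(defect a b y).toReal + δ ∧ a t < M}.Subsingleton := by
    have key : ∀ y z, (y ∉ segs a b ∧ defect a b y < ⊤ ∧ Escapes a b y) →
        (z ∉ segs a b ∧ defect a b z < ⊤ ∧ Escapes a b z ∧ ∃ M, ∀ δ > 0, ∃ t,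
          profile a b z t < -(defect a b z).toReal + δ ∧ a t < M) → y.2 = z.2 ∧ z.1 ≤ y.1 := by
      rintro y z ⟨hy1, hy2, hy3⟩ ⟨hz1, hz2, hz3, M, hM⟩
      obtain ⟨hylt, hyl⟩ := S.isPair.escapes_snd_lt hub hy1 hy2 hy3
      obtain ⟨hzlt, hzl⟩ := S.isPair.escapes_snd_lt hub hz1 hz2 hz3
      have hle : y.2 = z.2 := by
        apply le_antisymm
        · refine le_of_forall_pos_le_add fun κ hκ => ?_
          obtain ⟨t, ht⟩ := hyl κ hκ
          linarith [hzlt t]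
        · refine le_of_forall_pos_le_add fun κ hκ => ?_
          obtain ⟨t, ht⟩ := hzl κ hκ
          linarith [hylt t]
      refine ⟨hle, ?_⟩
      by_contra! hlt
      have hpr : ∀ t, profile a b y t = profile a b z t - (z.1 - y.1) * (y.2 - b t) := by
        intro t; rw [profile, profile, hle]; ring
      have hd : 0 < z.1 - y.1 := by linarith
      have hWle : -(defect a b z).toReal ≤ -(defect a b y).toReal := by
        refine le_of_forall_pos_le_add fun e he => ?_
        obtain ⟨t₁, ht₁⟩ := hyl (e / 2 / (z.1 - y.1)) (by positivity)
        obtain ⟨t, ht, htp⟩ := hy3 (e / 2) (by positivity) t₁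
        have h1 := neg_defect_le hz2 t
        have h2 := S.isPair.mono_snd ht.le
        have h3 : (z.1 - y.1) * (y.2 - b t) ≤ (z.1 - y.1) * (e / 2 / (z.1 - y.1)) := by
          gcongr; linarith
        rw [mul_div_cancel₀ _ hd.ne'] at h3
        linarith [hpr t]
      obtain ⟨tM, htM⟩ := hub M
      obtain ⟨t, ht1, ht2⟩ := hM ((z.1 - y.1) * (y.2 - b tM))
        (mul_pos hd (by linarith [hylt tM]))
      have h1 : t ≤ tM := by
        by_contra! h; linarith [S.isPair.mono_fst h.le]
      have h2 : (z.1 - y.1) * (y.2 - b tM) ≤ (z.1 - y.1) * (y.2 - b t) := by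
        gcongr; exact S.isPair.mono_snd h1
      linarith [hpr t, neg_defect_le hy2 t]
    rintro y ⟨hy1, hy2, hy3, hy4⟩ z ⟨hz1, hz2, hz3, hz4⟩
    obtain ⟨e1, e2⟩ := key y z ⟨hy1, hy2, hy3⟩ ⟨hz1, hz2, hz3, hz4⟩
    obtain ⟨-, e3⟩ := key z y ⟨hz1, hz2, hz3⟩ ⟨hy1, hy2, hy3, hy4⟩
    exact Prod.ext (le_antisymm e3 e2) e1
  have hnull := S.null_of_subsingleton hsub
  filter_upwards [S.ae_not_escape_fst, measure_eq_zero_iff_ae_notMem.1 hnull] with y h1 h2 h3 h4 h5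
  exact h2 ⟨h3, h4, h5, h1 h4⟩

theorem escapes_swap {y : ℝ × ℝ} : Escapes b a y.swap ↔ Escapes a b y := by
  simp only [Escapes, profile_swap, defect_swap]

theorem RegularOptPair.ae_not_escapes (S : RegularOptPair ν a b) :
    ∀ᵐ y ∂ν, y ∉ segs a b → defect a b y < ⊤ → ¬ Escapes a b y := by
  by_cases hub : ∀ N, ∃ t, N ≤ a t
  · exact S.ae_not_escapes_of_fst hub
  · push Not at hub
    obtain ⟨N, hN⟩ := hub
    have hub' : ∀ N', ∃ t, N' ≤ b t := fun N' => ⟨N + N', by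
      linarith [hN (N + N'), S.isPair.add_eq (N + N')]⟩
    filter_upwards [S.ae_of_swap (S.swap.ae_not_escapes_of_fst hub')] with y hy
    rwa [swap_mem_segs, defect_swap, escapes_swap] at hy

/-! ### Uniqueness of minimizers -/

theorem chord_bounds {δ R A B A' B' x z : ℝ} (hδ : 0 < δ) (hA : δ ≤ A ∧ A ≤ R)
    (hB : δ ≤ B ∧ B ≤ R) (hA' : δ ≤ A' ∧ A' ≤ R) (hB' : δ ≤ B' ∧ B' ≤ R)
    (h : 0 ≤ A * z + B * x) (h' : A' * z + B' * x ≤ 0) :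
    x * z ≤ 0 ∧ |x| ≤ R / δ * |z| ∧ |z| ≤ R / δ * |x| := by
  have e : ∀ p q : ℝ, p ≤ R / δ * q ↔ δ * p ≤ R * q := fun p q => by
    rw [div_mul_eq_mul_div, le_div_iff₀ hδ, mul_comm p]
  rw [e, e]
  rcases lt_trichotomy x 0 with hx | rfl | hx
  · have hz : 0 ≤ z := by
      by_contra! hz; nlinarith
    rw [abs_of_neg hx, abs_of_nonneg hz]
    exact ⟨by nlinarith, by nlinarith, by nlinarith⟩
  · have h1 : 0 ≤ z := by
      by_contra! hz; nlinarith
    have h2 : z ≤ 0 := by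
      by_contra! hz; nlinarith
    have : z = 0 := le_antisymm h2 h1
    simp [this]
  · have hz : z ≤ 0 := by
      by_contra! hz; nlinarith
    rw [abs_of_pos hx, abs_of_nonpos hz]
    exact ⟨by nlinarith, by nlinarith, by nlinarith⟩

theorem minimizer_monotone {y z : ℝ × ℝ} {s t : ℝ} (hy : defect a b y < ⊤)
    (hz : defect a b z < ⊤) (hs : profile a b y s ≤ -(defect a b y).toReal)
    (ht : profile a b z t ≤ -(defect a b z).toReal) :
    0 ≤ (a s - a t) * (y.2 - z.2) + (b s - b t) * (y.1 - z.1) := by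
  have h1 := hs.trans (neg_defect_le hy t)
  have h2 := ht.trans (neg_defect_le hz s)
  simp only [profile] at h1 h2
  linarith

theorem RegularOptPair.ae_not_two_minimizers (S : RegularOptPair ν a b) :
    ∀ᵐ y ∂ν, ¬ (defect a b y < ⊤ ∧ ∃ s t, a s < a t ∧ b s < b t ∧
      profile a b y s ≤ -(defect a b y).toReal ∧ profile a b y t ≤ -(defect a b y).toReal) := by
  let A : (ℚ × ℚ) × (ℚ × ℚ) × ℕ → Set (ℝ × ℝ) := fun i =>
    {y | defect a b y < ⊤ ∧ (i.1.1 : ℝ) < i.1.2 ∧ (i.2.1.1 : ℝ) < i.2.1.2 ∧ ∃ s t,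
      (-(i.2.2 : ℝ) ≤ a s ∧ a s ≤ i.1.1 ∧ i.1.2 ≤ a t ∧ a t ≤ i.2.2) ∧
      (-(i.2.2 : ℝ) ≤ b s ∧ b s ≤ i.2.1.1 ∧ i.2.1.2 ≤ b t ∧ b t ≤ i.2.2) ∧
      profile a b y s ≤ -(defect a b y).toReal ∧ profile a b y t ≤ -(defect a b y).toReal}
  have hA : ∀ i, ν (A i) = 0 := by
    intro i
    obtain ⟨⟨p, q⟩, ⟨p', q'⟩, N⟩ := i
    by_cases hpq : (p : ℝ) < q ∧ (p' : ℝ) < q'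
    swap
    · have : A ((p, q), (p', q'), N) = ∅ := by
        ext y; simp only [A, Set.mem_ofPred_eq, Set.mem_empty_iff_false, iff_false]
        rintro ⟨-, h1, h2, -⟩; exact hpq ⟨h1, h2⟩
      rw [this, measure_empty]
    set δ : ℝ := min (q - p) (q' - p')
    have hδ : 0 < δ := lt_min (by linarith) (by linarith)
    have hδ1 : δ ≤ q - p := min_le_left _ _
    have hδ2 : δ ≤ q' - p' := min_le_right _ _
    refine S.null (max 1 ((2 * N) / δ)) (le_max_left _ _) _ ?_
    rintro y ⟨hy, -, -, s, t, h1, h2, h3, h4⟩ z ⟨hz, -, -, s', t', h1', h2', h3', h4'⟩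
    have m1 := minimizer_monotone hy hz h4 h3'
    have m2 := minimizer_monotone hy hz h3 h4'
    dsimp only at h1 h2 h1' h2'
    obtain ⟨c1, c2, c3⟩ := chord_bounds (δ := δ) (R := 2 * N) (A := a t - a s') (B := b t - b s')
      (A' := a t' - a s) (B' := b t' - b s) (x := y.1 - z.1) (z := y.2 - z.2) hδ
      ⟨by linarith, by linarith⟩ ⟨by linarith, by linarith⟩ ⟨by linarith, by linarith⟩
      ⟨by linarith, by linarith⟩ m1 (by linarith)
    exact ⟨c1, c2.trans (by gcongr; exact le_max_right _ _),
      c3.trans (by gcongr; exact le_max_right _ _)⟩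
  have hU := measure_iUnion_null hA
  filter_upwards [measure_eq_zero_iff_ae_notMem.1 hU] with y hy
  rintro ⟨hdom, s, t, h1, h2, h3, h4⟩
  apply hy
  obtain ⟨p, hp1, hp2⟩ := exists_rat_btwn h1
  obtain ⟨q, hq1, hq2⟩ := exists_rat_btwn hp2
  obtain ⟨p', hp1', hp2'⟩ := exists_rat_btwn h2
  obtain ⟨q', hq1', hq2'⟩ := exists_rat_btwn hp2'
  obtain ⟨N, hN⟩ := exists_nat_ge (max (max (-a s) (a t)) (max (-b s) (b t)))
  simp only [max_le_iff] at hN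
  exact Set.mem_iUnion.2 ⟨((p, q), (p', q'), N), hdom, hq1, hq1', s, t,
    ⟨by linarith, hp1.le, hq2.le, hN.1.2⟩, ⟨by linarith, hp1'.le, hq2'.le, hN.2.2⟩, h3, h4⟩

theorem IsPair.lt_of_two_minimizers (h : IsPair a b) {y : ℝ × ℝ} (hy : y ∉ segs a b)
    (hdom : defect a b y < ⊤) {s t : ℝ} (hst : s < t)
    (hs : profile a b y s ≤ -(defect a b y).toReal)
    (ht : profile a b y t ≤ -(defect a b y).toReal) : a s < a t ∧ b s < b t := by
  have hs' := le_antisymm hs (neg_defect_le hdom s)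
  have ht' := le_antisymm ht (neg_defect_le hdom t)
  have e1 := h.add_eq s
  have e2 := h.add_eq t
  constructor
  · refine (h.mono_fst hst.le).lt_of_ne fun heq => hy ?_
    have h1 : (a t - y.1) * (b t - b s) = 0 := by
      have := hs'.trans ht'.symm
      simp only [profile] at this; rw [heq] at this; linarith
    have h2 : a t - y.1 = 0 := (mul_eq_zero.1 h1).resolve_right (by intro e; linarith)
    have h3 : (defect a b y).toReal = 0 := by rw [profile, h2] at ht'; linarith
    have h4 := h.eq_of_defect hdom h3
    have h5 : y.1 = a (y.1 + y.2) := congrArg Prod.fst h4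
    by_cases hc : s = y.1 + y.2
    · exact ⟨t, y.1 + y.2, by rw [← hc]; exact hst.ne', h4, Or.inl (by linarith)⟩
    · exact ⟨s, y.1 + y.2, hc, h4, Or.inl (by linarith)⟩
  · refine (h.mono_snd hst.le).lt_of_ne fun heq => hy ?_
    have h1 : (b t - y.2) * (a t - a s) = 0 := by
      have := hs'.trans ht'.symm
      simp only [profile] at this; rw [heq] at this; linarith
    have h2 : b t - y.2 = 0 := (mul_eq_zero.1 h1).resolve_right (by intro e; linarith)
    have h3 : (defect a b y).toReal = 0 := by rw [profile, h2] at ht'; linarith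
    have h4 := h.eq_of_defect hdom h3
    have h5 : y.2 = b (y.1 + y.2) := congrArg Prod.snd h4
    by_cases hc : s = y.1 + y.2
    · exact ⟨t, y.1 + y.2, by rw [← hc]; exact hst.ne', h4, Or.inr (by linarith)⟩
    · exact ⟨s, y.1 + y.2, hc, h4, Or.inr (by linarith)⟩

theorem RegularOptPair.ae_wellPosed (S : RegularOptPair ν a b) :
    ∀ᵐ y ∂ν, y ∉ segs a b → defect a b y < ⊤ ∧ ∃ t, WellPosed a b y t := by
  have h := S.isPair
  filter_upwards [S.ae_defect_lt_top, S.ae_not_escapes,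
    S.ae_of_reflect S.reflect.ae_not_escapes, S.ae_not_two_minimizers] with y h1 h2 h3 h4 hy
  refine ⟨h1, ?_⟩
  rw [neg_mem_segs, defect_reflect] at h3
  have h2 := h2 hy h1
  have h3 := h3 hy h1
  simp only [Escapes, profile_reflect, defect_reflect] at h2 h3
  push Not at h2 h3
  obtain ⟨δ₁, hδ₁, M₁, hM₁⟩ := h2
  obtain ⟨δ₂, hδ₂, M₂, hM₂⟩ := h3
  set W := (defect a b y).toReal
  have hcpt : ∀ s, profile a b y s < -W + min δ₁ δ₂ → s ∈ Set.Icc (-M₂) M₁ := by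
    intro s hs
    constructor
    · by_contra! hlt
      have := hM₂ (-s) (by linarith)
      rw [neg_neg] at this
      linarith [min_le_right δ₁ δ₂]
    · by_contra! hlt
      linarith [hM₁ s hlt, min_le_left δ₁ δ₂]
  have hδ : 0 < min δ₁ δ₂ := lt_min hδ₁ hδ₂
  obtain ⟨s₀, hs₀⟩ := h.exists_profile_lt (y := y) hδ
  have hcont := h.continuous_profile y
  obtain ⟨t, htI, htmin⟩ := isCompact_Icc.exists_isMinOn ⟨s₀, hcpt s₀ hs₀⟩ hcont.continuousOn
  have htW : profile a b y t ≤ -W := by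
    refine le_of_forall_pos_le_add fun e he => ?_
    obtain ⟨s, hs⟩ := h.exists_profile_lt (y := y) (lt_min hδ he)
    have := htmin (hcpt s (by linarith [min_le_left (min δ₁ δ₂) e]))
    simp only [Set.mem_ofPred_eq] at this
    linarith [min_le_right (min δ₁ δ₂) e]
  refine ⟨t, fun η hη => ?_⟩
  have hK : IsCompact (Set.Icc (-M₂) M₁ ∩ {s | η ≤ |s - t|}) :=
    isCompact_Icc.inter_right (isClosed_le continuous_const (by fun_prop))
  rcases (Set.Icc (-M₂) M₁ ∩ {s | η ≤ |s - t|}).eq_empty_or_nonempty with hemp | hne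
  · refine ⟨_, hδ, fun s hs => ?_⟩
    by_contra! hlt
    have : s ∈ Set.Icc (-M₂) M₁ ∩ {s | η ≤ |s - t|} := ⟨hcpt s hs, hlt⟩
    rw [hemp] at this; exact this
  · obtain ⟨r, hrK, hrmin⟩ := hK.exists_isMinOn hne hcont.continuousOn
    have hr : -W < profile a b y r := by
      by_contra! hle
      have hrt : r ≠ t := by
        rintro rfl
        have := hrK.2
        simp only [Set.mem_ofPred_eq, sub_self, abs_zero] at this
        linarith
      rcases lt_or_gt_of_ne hrt with hlt | hlt
      · obtain ⟨k1, k2⟩ := h.lt_of_two_minimizers hy h1 hlt hle htW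
        exact h4 ⟨h1, r, t, k1, k2, hle, htW⟩
      · obtain ⟨k1, k2⟩ := h.lt_of_two_minimizers hy h1 hlt htW hle
        exact h4 ⟨h1, t, r, k1, k2, htW, hle⟩
    refine ⟨min (min δ₁ δ₂) (profile a b y r + W), lt_min hδ (by linarith), fun s hs => ?_⟩
    by_contra! hlt
    have := hrmin (show s ∈ Set.Icc (-M₂) M₁ ∩ {s | η ≤ |s - t|} from
      ⟨hcpt s (by linarith [min_le_left (min δ₁ δ₂) (profile a b y r + W)]), hlt⟩)
    simp only [Set.mem_ofPred_eq] at this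
    linarith [min_le_right (min δ₁ δ₂) (profile a b y r + W)]

/-- A measurable selection of the minimizers. -/
theorem RegularOptPair.exists_selection (S : RegularOptPair ν a b) :
    ∃ τ : ℝ × ℝ → ℝ, Measurable τ ∧
      ∀ᵐ y ∂ν, y ∉ segs a b → defect a b y < ⊤ ∧ WellPosed a b y (τ y) := by
  classical
  have h := S.isPair
  obtain ⟨e, he⟩ := exists_surjective_nat ℚ
  have hex : ∀ (n : ℕ) (y : ℝ × ℝ), ∃ k, profile a b y (e k) <
      -(defect a b y).toReal + 1 / (n + 1) := by
    intro n y
    obtain ⟨t, ht⟩ := h.exists_profile_lt (y := y) (δ := 1 / (n + 1)) (by positivity)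
    have hopen : IsOpen {s | profile a b y s < -(defect a b y).toReal + 1 / (n + 1)} :=
      isOpen_lt (h.continuous_profile y) continuous_const
    obtain ⟨q, hq⟩ := Rat.denseRange_cast.exists_mem_open hopen ⟨t, ht⟩
    obtain ⟨k, rfl⟩ := he q
    exact ⟨k, hq⟩
  let f : ℕ → ℝ × ℝ → ℝ := fun n y => (e (Nat.find (hex n y)) : ℝ)
  have hfm : ∀ n, Measurable (f n) := by
    intro n
    have h1 : Measurable fun y => Nat.find (hex n y) := by
      refine measurable_find _ fun k => measurableSet_lt ?_ ?_
      · unfold profile; fun_prop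
      · exact (measurable_defect a b).ennreal_toReal.neg.add_const _
    exact (measurable_from_nat (f := fun k => ((e k : ℚ) : ℝ))).comp h1
  have hlim : ∀ y t, WellPosed a b y t → Tendsto (fun n => f n y) atTop (𝓝 t) := by
    intro y t ht
    rw [Metric.tendsto_atTop]
    intro η hη
    obtain ⟨δ, hδ, H⟩ := ht η hη
    obtain ⟨N, hN⟩ := exists_nat_one_div_lt hδ
    refine ⟨N, fun n hn => ?_⟩
    rw [Real.dist_eq]
    refine H _ ((Nat.find_spec (hex n y)).trans ?_)
    have : (1 : ℝ) / (n + 1) ≤ 1 / (N + 1) := by gcongr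
    linarith
  have hE := h.measurableSet_segs
  have hae : ∀ᵐ y ∂(ν.restrict (segs a b)ᶜ), defect a b y < ⊤ ∧ ∃ t, WellPosed a b y t := by
    rw [ae_restrict_iff' hE.compl]
    exact S.ae_wellPosed
  obtain ⟨τ, hτm, hτ⟩ := measurable_limit_of_tendsto_metrizable_ae (L := atTop)
    (μ := ν.restrict (segs a b)ᶜ) (fun n => (hfm n).aemeasurable)
    (hae.mono fun y ⟨_, t, ht⟩ => ⟨t, hlim y t ht⟩)
  refine ⟨τ, hτm, ?_⟩
  rw [ae_restrict_iff' hE.compl] at hτ hae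
  filter_upwards [hτ, hae] with y h1 h2 hy
  obtain ⟨h3, t, ht⟩ := h2 hy
  have := tendsto_nhds_unique (h1 hy) (hlim y t ht)
  exact ⟨h3, this ▸ ht⟩

end BackwardTransport

namespace BackwardTransport

variable {a b : ℝ → ℝ} {ν : Measure (ℝ × ℝ)} {τ : ℝ × ℝ → ℝ}

/-! ### First-order conditions off the segments -/

theorem RegularOptPair.integrable_affine (S : RegularOptPair ν a b) (C : ℝ) :
    Integrable (fun y : ℝ × ℝ => |C| + |y.1|) ν := by
  refine ⟨by fun_prop, ?_⟩
  rw [hasFiniteIntegral_iff_ofReal (Eventually.of_forall fun y => by positivity)]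
  exact (S.lintegral_affine_ne_top _).lt_top

theorem RegularOptPair.integrable_fst (S : RegularOptPair ν a b) :
    Integrable (fun y : ℝ × ℝ => y.1) ν :=
  (S.integrable_affine 0).mono' (by fun_prop) (Eventually.of_forall fun y => by simp)

theorem RegularOptPair.setIntegral_nonpos (S : RegularOptPair ν a b) (hτm : Measurable τ)
    (hτ : ∀ᵐ y ∂ν, y ∉ segs a b → defect a b y < ⊤ ∧ WellPosed a b y (τ y))
    {h : ℕ → ℝ → ℝ} (hh : ∀ n, Continuous (h n)) (h1 : ∀ n t, |h n t| ≤ 1)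
    (hm : ∀ n, ∃ ε₀ > 0, ∀ ε, 0 < ε → ε ≤ ε₀ → Monotone fun t => b t + ε * h n t)
    {p q : ℝ} (hpq : ∀ n t, h n t ≠ 0 → t ∈ Set.Icc p q) {g : ℝ → ℝ}
    (hg : ∀ t, Tendsto (fun n => h n t) atTop (𝓝 (g t)))
    (hE : ∀ y ∈ segs a b, ∀ η > 0, ∀ᶠ n in atTop, ∃ δ > 0, ∀ t, profile a b y t < δ →
      -η ≤ h n t * (a t - y.1)) :
    Integrable (fun y => g (τ y) * (a (τ y) - y.1)) (ν.restrict (segs a b)ᶜ) ∧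
    ∫ y in (segs a b)ᶜ, g (τ y) * (a (τ y) - y.1) ∂ν ≤ 0 := by
  have hpair := S.isPair
  have hac := hpair.continuous
  have hEm := hpair.measurableSet_segs
  set C := max |a p| |a q| with hCdef
  have hC0 : 0 ≤ C := (abs_nonneg _).trans (le_max_left _ _)
  have hbd : ∀ n t (y : ℝ × ℝ), |h n t * (a t - y.1)| ≤ |C| + |y.1| := by
    intro n t y
    rw [abs_of_nonneg hC0]
    by_cases h0 : h n t = 0
    · rw [h0, zero_mul, abs_zero]; positivity
    · obtain ⟨k1, k2⟩ := hpq n t h0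
      have k3 : |a t| ≤ C := abs_le_max_abs_abs (hpair.mono_fst k1) (hpair.mono_fst k2)
      rw [abs_mul]
      calc |h n t| * |a t - y.1| ≤ 1 * |a t - y.1| := by gcongr; exact h1 n t
        _ ≤ C + |y.1| := by rw [one_mul]; exact (abs_sub _ _).trans (by gcongr)
  have hbg : ∀ t (y : ℝ × ℝ), |g t * (a t - y.1)| ≤ |C| + |y.1| := fun t y =>
    le_of_tendsto ((hg t).mul_const _).abs (Eventually.of_forall fun n => hbd n t y)
  have hgm : Measurable g := measurable_of_tendsto_metrizable (fun n => (hh n).measurable)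
    (tendsto_pi_nhds.2 hg)
  have hfm : Measurable fun y : ℝ × ℝ => g (τ y) * (a (τ y) - y.1) :=
    (hgm.comp hτm).mul ((hac.measurable.comp hτm).sub measurable_fst)
  have hfi : Integrable (fun y => g (τ y) * (a (τ y) - y.1)) ν :=
    (S.integrable_affine C).mono' hfm.aestronglyMeasurable
      (Eventually.of_forall fun y => hbg _ y)
  refine ⟨hfi.integrableOn, ?_⟩
  obtain ⟨L, -, hLi, hL⟩ := S.opt.first_variation_seq S.lintegral_defect_ne_top hh h1 hm
    (w := fun y => |C| + |y.1|) (by fun_prop) (fun y => by positivity)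
    (S.lintegral_affine_ne_top _) (fun n t y => (abs_le.1 (hbd n t y)).1)
  set f := (segs a b)ᶜ.indicator fun y => g (τ y) * (a (τ y) - y.1) with hf
  have hfi' : Integrable f ν := hfi.indicator hEm.compl
  have hw0 : ∀ y, 0 ≤ |C| + |y.1| + f y := by
    intro y
    by_cases hy : y ∈ segs a b
    · rw [hf, Set.indicator_of_notMem (by simpa using hy)]; positivity
    · rw [hf, Set.indicator_of_mem (by simpa using hy)]
      linarith [(abs_le.1 (hbg (τ y) y)).1]
  have hle : ∀ᵐ y ∂ν, ENNReal.ofReal (|C| + |y.1| + f y) ≤ L y := by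
    filter_upwards [hτ] with y hy
    have key : ∀ α ≥ 0, α < |C| + |y.1| + f y → ENNReal.ofReal α ≤ L y := by
      intro α hα hlt
      by_cases hyE : y ∈ segs a b
      · rw [hf, Set.indicator_of_notMem (by simpa using hyE), add_zero] at hlt
        have hd0 : defect a b y = 0 := by
          obtain ⟨s, t, -, rfl, -⟩ := hyE
          exact hpair.defect_eq_zero t
        refine hL y (by simp [hd0]) α hα ?_
        filter_upwards [hE y hyE (|C| + |y.1| - α) (by linarith)] with n ⟨δ, hδ, H⟩
        refine ⟨δ, hδ, fun t ht => ?_⟩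
        rw [hd0] at ht
        have := H t (by simpa using ht)
        linarith
      · rw [hf, Set.indicator_of_mem (by simpa using hyE)] at hlt
        obtain ⟨hdom, hwp⟩ := hy hyE
        refine hL y hdom α hα ?_
        have hev := (((hg (τ y)).mul_const (a (τ y) - y.1)).const_add
          (|C| + |y.1|)).eventually (lt_mem_nhds hlt)
        filter_upwards [hev] with n hn
        have hcn : Continuous fun t => |C| + |y.1| + h n t * (a t - y.1) := by
          have := hh n; fun_prop
        obtain ⟨r, hr, H⟩ := Metric.eventually_nhds_iff.1
          (hcn.continuousAt.eventually (lt_mem_nhds hn))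
        obtain ⟨δ, hδ, H2⟩ := hwp r hr
        refine ⟨δ, hδ, fun t ht => ?_⟩
        have := H (y := t) (by rw [Real.dist_eq]; exact H2 t ht)
        linarith
    refine le_of_forall_lt fun c hc => ?_
    have hcfin : c ≠ ⊤ := (hc.trans ENNReal.ofReal_lt_top).ne
    obtain ⟨d, hcd, hd⟩ := exists_between hc
    have hdfin : d ≠ ⊤ := (hd.trans ENNReal.ofReal_lt_top).ne
    refine hcd.trans_le ?_
    rw [← ENNReal.ofReal_toReal hdfin]
    refine key _ ENNReal.toReal_nonneg ?_
    exact (ENNReal.lt_ofReal_iff_toReal_lt hdfin).1 hd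
  have hint : ∫⁻ y, ENNReal.ofReal (|C| + |y.1| + f y) ∂ν ≤
      ∫⁻ y, ENNReal.ofReal (|C| + |y.1|) ∂ν := (lintegral_mono_ae hle).trans hLi
  have hwi := S.integrable_affine C
  have hadd : Integrable (fun y => |C| + |y.1| + f y) ν := hwi.add hfi'
  rw [← ofReal_integral_eq_lintegral_ofReal hadd (Eventually.of_forall hw0),
    ← ofReal_integral_eq_lintegral_ofReal hwi (Eventually.of_forall fun y => by positivity),
    ENNReal.ofReal_le_ofReal_iff (integral_nonneg fun y => by positivity)] at hint
  rw [← integral_indicator hEm.compl]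
  have := integral_add hwi hfi'
  change ∫ y, f y ∂ν ≤ 0
  linarith

theorem IsPair.lt_fst_of_wellPosed (h : IsPair a b) {y : ℝ × ℝ} (hdom : defect a b y < ⊤)
    {t q : ℝ} (ht : WellPosed a b y t) (hq : t < q) (hb : b q = b t) :
    a t < y.1 ∧ y.2 < b t := by
  have hW : 0 ≤ (defect a b y).toReal := ENNReal.toReal_nonneg
  have h1 := h.wellPosed_profile ht
  have h2 : profile a b y t < profile a b y q := by
    by_contra! hle
    exact hq.ne' (ht.eq (hle.trans h1))
  have h3 : a t < a q := by linarith [h.add_eq t, h.add_eq q]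
  have h4 : y.2 < b t := by
    rw [profile, profile, hb] at h2
    by_contra! hle
    nlinarith
  refine ⟨?_, h4⟩
  by_contra! hle
  have h5 : 0 ≤ profile a b y t := mul_nonneg (by linarith) (by linarith)
  have h6 := h.eq_of_defect hdom (by linarith)
  have h7 : profile a b y (y.1 + y.2) ≤ -(defect a b y).toReal := by
    rw [h.profile_add]
    linarith [sq_nonneg (a (y.1 + y.2) - y.1)]
  have h8 := ht.eq h7
  rw [h8] at h6
  linarith [congrArg Prod.snd h6]

/-- The minimizer is almost surely not the left end of a horizontal segment. -/
theorem RegularOptPair.ae_not_wellPosed_left (S : RegularOptPair ν a b) {t₀ q : ℝ}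
    (hq : t₀ < q) (hbq : b q = b t₀) (hleft : ∀ s < t₀, b s < b t₀) :
    ∀ᵐ y ∂ν, y ∉ segs a b → ¬ WellPosed a b y t₀ := by
  obtain ⟨τ, hτm, hτ⟩ := S.exists_selection
  have h := S.isPair
  have hac := h.continuous
  have hbc := h.swap.continuous
  have haq : a t₀ < a q := by linarith [h.add_eq t₀, h.add_eq q]
  obtain ⟨N, hN⟩ := exists_nat_one_div_lt (lt_min (sub_pos.2 (hleft (t₀ - 1) (by linarith)))
    (sub_pos.2 haq))
  let P : ℝ → ℝ := fun t => max (b t₀ - b t) 0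
  let Q : ℝ → ℝ := fun t => max (a t - a t₀) 0
  let M : ℕ → ℝ := fun n => n + N + 1
  have hM0 : ∀ n, 0 < M n := fun n => by positivity
  have hMN : ∀ n, 1 / M n ≤ 1 / (N + 1) := fun n =>
    one_div_le_one_div_of_le (by positivity) (by simp only [M]; linarith [n.cast_nonneg (α := ℝ)])
  have hMlim : ∀ κ > 0, ∀ᶠ n in atTop, 1 / M n < κ := by
    intro κ hκ
    obtain ⟨m, hm⟩ := exists_nat_one_div_lt hκ
    filter_upwards [eventually_ge_atTop m] with n hn
    refine lt_of_le_of_lt (one_div_le_one_div_of_le (by positivity) ?_) hm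
    have : (m : ℝ) ≤ n := by exact_mod_cast hn
    simp only [M]; linarith [N.cast_nonneg (α := ℝ)]
  have hP0 : ∀ t, 0 ≤ P t := fun t => le_max_right _ _
  have hQ0 : ∀ t, 0 ≤ Q t := fun t => le_max_right _ _
  let k : ℕ → ℝ → ℝ := fun n t => -max 0 (1 - M n * P t - M n * Q t)
  have hk0 : ∀ n t, k n t ≤ 0 := fun n t => neg_nonpos.2 (le_max_left _ _)
  have hk1 : ∀ n t, -1 ≤ k n t := fun n t => neg_le_neg (max_le zero_le_one (by
    have := mul_nonneg (hM0 n).le (hP0 t); have := mul_nonneg (hM0 n).le (hQ0 t); linarith))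
  have hsupp : ∀ n t, k n t ≠ 0 → P t < 1 / M n ∧ Q t < 1 / M n := by
    intro n t hne
    have hpos : 0 < 1 - M n * P t - M n * Q t := by
      by_contra! hle
      exact hne (by simp only [k]; rw [max_eq_left hle, neg_zero])
    have e1 := mul_nonneg (hM0 n).le (hP0 t)
    have e2 := mul_nonneg (hM0 n).le (hQ0 t)
    constructor <;> rw [lt_div_iff₀ (hM0 n)] <;> linarith
  have hPl : ∀ t, b t₀ - b t ≤ P t := fun t => le_max_left _ _
  have hQl : ∀ t, a t - a t₀ ≤ Q t := fun t => le_max_left _ _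
  have hQpos : ∀ t > t₀, 0 < a t - a t₀ := by
    intro t ht
    have h1 : b (min t q) = b t₀ := le_antisymm (hbq ▸ h.mono_snd (min_le_right _ _))
      (h.mono_snd (le_min ht.le hq.le))
    have h2 := h.add_eq (min t q)
    have h3 := h.add_eq t₀
    have h4 := h.mono_fst (min_le_left t q)
    have h5 : t₀ < min t q := lt_min ht hq
    linarith
  have hint := S.setIntegral_nonpos hτm hτ (h := k) (p := t₀ - 1) (q := q)
    (g := fun t => if t = t₀ then -1 else 0)
    (fun n => by simp only [k, P, Q]; fun_prop)
    (fun n t => abs_le.2 ⟨hk1 n t, (hk0 n t).trans zero_le_one⟩)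
    (fun n => ⟨1 / M n, one_div_pos.2 (hM0 n), fun ε hε hεM s t hst => by
      rw [le_div_iff₀ (hM0 n)] at hεM
      have hb := h.mono_snd hst
      have h1 : P s - P t ≤ b t - b s := by
        have : P s ≤ P t + (b t - b s) := max_le (by linarith [hPl t]) (by linarith [hP0 t])
        linarith
      have h1' : 0 ≤ P s - P t := sub_nonneg.2 (max_le_max (by linarith) le_rfl)
      have h2 : Q s ≤ Q t := max_le_max (by linarith [h.mono_fst hst]) le_rfl
      have h3 : max 0 (1 - M n * P t - M n * Q t) ≤
          max 0 (1 - M n * P s - M n * Q s) + M n * (P s - P t) := by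
        have := mul_le_mul_of_nonneg_left h2 (hM0 n).le
        have := mul_nonneg (hM0 n).le h1'
        refine max_le (by linarith [le_max_left 0 (1 - M n * P s - M n * Q s)]) ?_
        linarith [le_max_right 0 (1 - M n * P s - M n * Q s)]
      have h4 := mul_le_mul_of_nonneg_left h3 hε.le
      have h5 := mul_le_mul_of_nonneg_right hεM h1'
      simp only [k]
      nlinarith⟩)
    (fun n t hne => by
      obtain ⟨h1, h2⟩ := hsupp n t hne
      have h3 := (hMN n).trans_lt hN
      constructor
      · by_contra! hlt
        linarith [h.mono_snd hlt.le, hPl t,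
          min_le_left (b t₀ - b (t₀ - 1)) (a q - a t₀)]
      · by_contra! hlt
        linarith [h.mono_fst hlt.le, hQl t,
          min_le_right (b t₀ - b (t₀ - 1)) (a q - a t₀)])
    (fun t => by
      by_cases ht : t = t₀
      · refine tendsto_const_nhds.congr fun n => ?_
        simp [ht, k, P, Q]
      · refine Tendsto.congr' ?_ tendsto_const_nhds
        have hpos : 0 < max (P t) (Q t) := by
          rcases lt_or_gt_of_ne ht with hlt | hlt
          · exact lt_max_of_lt_left ((sub_pos.2 (hleft t hlt)).trans_le (hPl t))
          · exact lt_max_of_lt_right ((hQpos t hlt).trans_le (hQl t))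
        filter_upwards [hMlim _ hpos] with n hn
        rw [if_neg ht]
        by_contra hne
        obtain ⟨h1, h2⟩ := hsupp n t (Ne.symm hne)
        exact lt_asymm hn (max_lt h1 h2))
    (by
      rintro y ⟨-, σ, -, rfl, -⟩ η hη
      by_cases hc : a t₀ ≤ a σ
      · filter_upwards [hMlim η hη] with n hn
        refine ⟨1, one_pos, fun t _ => ?_⟩
        by_cases hne : k n t = 0
        · rw [hne, zero_mul]; linarith
        · have h2 := (hsupp n t hne).2
          have h3 := hQl t
          rcases le_total (a t - a σ) 0 with h4 | h4
          · nlinarith [hk0 n t]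
          · nlinarith [hk1 n t]
      · push Not at hc
        have hσ : σ < t₀ := by
          by_contra! hle; linarith [h.mono_fst hle]
        have hbσ := hleft σ hσ
        set κ := min ((a t₀ - a σ) / 2) ((b t₀ - b σ) / 2) with hκ
        have hκ0 : 0 < κ := lt_min (by linarith) (by linarith)
        have hκ1 : κ ≤ (a t₀ - a σ) / 2 := min_le_left _ _
        have hκ2 : κ ≤ (b t₀ - b σ) / 2 := min_le_right _ _
        have hr := hleft (t₀ - κ) (by linarith)
        filter_upwards [hMlim _ (lt_min hκ0 (sub_pos.2 hr))] with n hn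
        refine ⟨κ ^ 2, by positivity, fun t ht => ?_⟩
        have hz : k n t = 0 := by
          by_contra hne
          have h1 := (hsupp n t hne).1
          have h2 := hPl t
          have h3 := lt_min_iff.1 hn
          have h4 : t₀ - κ ≤ t := by
            by_contra! hlt; linarith [h.mono_snd hlt.le]
          have h5 := h.mono_fst h4
          have h6 := h.abs_sub_le t₀ (t₀ - κ)
          rw [show t₀ - (t₀ - κ) = κ by ring, abs_of_pos hκ0] at h6
          have h7 := (abs_le.1 h6).2
          simp only [profile] at ht
          nlinarith
        rw [hz, zero_mul]; linarith)
  obtain ⟨hi, hle⟩ := hint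
  have hEm := h.measurableSet_segs.compl
  have hnn : ∀ᵐ y ∂(ν.restrict (segs a b)ᶜ),
      0 ≤ (if τ y = t₀ then (-1 : ℝ) else 0) * (a (τ y) - y.1) := by
    rw [ae_restrict_iff' hEm]
    filter_upwards [hτ] with y hy hyE
    obtain ⟨h1, h2⟩ := hy hyE
    by_cases hc : τ y = t₀
    · rw [if_pos hc, hc]
      rw [hc] at h2
      linarith [(h.lt_fst_of_wellPosed h1 h2 hq hbq).1]
    · rw [if_neg hc, zero_mul]
  have hz := (integral_eq_zero_iff_of_nonneg_ae hnn hi).1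
    (le_antisymm hle (integral_nonneg_of_ae hnn))
  rw [Filter.EventuallyEq, ae_restrict_iff' hEm] at hz
  filter_upwards [hz, hτ] with y h1 h2 hyE hwp
  obtain ⟨h3, h4⟩ := h2 hyE
  have h5 : τ y = t₀ := hwp.eq (h.wellPosed_profile h4)
  have h6 := h1 hyE
  rw [if_pos h5, h5] at h6
  have := (h.lt_fst_of_wellPosed h3 hwp hq hbq).1
  simp only [Pi.zero_apply] at h6
  linarith

/-- Left ends of horizontal segments. -/
def leftEnds (b : ℝ → ℝ) : Set ℝ := {t | (∃ q > t, b q = b t) ∧ ∀ s < t, b s < b t}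

theorem countable_leftEnds (hb : Monotone b) : (leftEnds b).Countable := by
  have : ∀ t ∈ leftEnds b, ∃ q > t, b q = b t := fun t ht => ht.1
  choose! q hq1 hq2 using this
  refine Set.PairwiseDisjoint.countable_of_Ioo (y := q) ?_ hq1
  have key : ∀ t ∈ leftEnds b, ∀ t' ∈ leftEnds b, t < t' → q t ≤ t' := by
    intro t ht t' ht' hlt
    by_contra! h
    have h1 := ht'.2 t hlt
    have h2 := hb h.le
    rw [hq2 t ht] at h2
    linarith
  intro t ht t' ht' hne
  rw [Function.onFun, Set.disjoint_left]
  rintro x ⟨h1, h2⟩ ⟨h3, h4⟩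
  rcases lt_or_gt_of_ne hne with hlt | hlt
  · linarith [key t ht t' ht' hlt]
  · linarith [key t' ht' t ht hlt]

theorem RegularOptPair.ae_not_leftEnd (S : RegularOptPair ν a b) :
    ∀ᵐ y ∂ν, ∀ t ∈ leftEnds b, y ∉ segs a b → ¬ WellPosed a b y t := by
  rw [ae_ball_iff (countable_leftEnds S.isPair.mono_snd)]
  rintro t ⟨⟨q, hq1, hq2⟩, ht⟩
  exact S.ae_not_wellPosed_left hq1 hq2 ht

theorem RegularOptPair.ae_snd_ne (S : RegularOptPair ν a b) :
    ∀ᵐ y ∂ν, y ∉ segs a b → ∀ t, WellPosed a b y t → ∀ s, s ≠ t → b s ≠ b t := by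
  have h := S.isPair
  filter_upwards [S.ae_wellPosed, S.ae_not_leftEnd, S.ae_of_reflect S.reflect.ae_not_leftEnd]
    with y h1 h2 h3 hy t ht s hst heq
  have hdom := (h1 hy).1
  rw [neg_mem_segs] at h3
  have hl : ∃ u < t, b u = b t := by
    rcases lt_or_gt_of_ne hst with hlt | hlt
    · exact ⟨s, hlt, heq⟩
    · by_contra! hno
      exact h2 t ⟨⟨s, hlt, heq⟩, fun u hu => (h.mono_snd hu.le).lt_of_ne (hno u hu)⟩ hy ht
  have hr : ∃ u > t, b u = b t := by
    rcases lt_or_gt_of_ne hst with hlt | hlt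
    · by_contra! hno
      refine h3 (-t) ⟨⟨-s, neg_lt_neg hlt, by simp [BackwardTransport.reflect, heq]⟩, fun u hu => ?_⟩ hy
        ht.reflect
      have hu' : t < -u := by linarith
      simp only [BackwardTransport.reflect, neg_neg]
      exact neg_lt_neg ((h.mono_snd hu'.le).lt_of_ne (hno _ hu').symm)
    · exact ⟨s, hlt, heq⟩
  obtain ⟨u, hu, hbu⟩ := hl
  obtain ⟨v, hv, hbv⟩ := hr
  have k1 := (h.lt_fst_of_wellPosed hdom ht hv hbv).1
  have k2 := (h.reflect.lt_fst_of_wellPosed (y := -y) (by rwa [defect_reflect]) ht.reflect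
    (q := -u) (neg_lt_neg hu) (by simp [BackwardTransport.reflect, hbu])).1
  simp only [BackwardTransport.reflect, neg_neg, Prod.fst_neg] at k2
  linarith

/-- The parameters at which both coordinates are strictly monotone. -/
def strictParams (a b : ℝ → ℝ) : Set ℝ := {t | ∀ s, s ≠ t → a s ≠ a t ∧ b s ≠ b t}

theorem IsPair.measurableSet_strictParams (h : IsPair a b) :
    MeasurableSet (strictParams a b) := by
  have : strictParams a b = ⋂ q : ℚ, ({t | (q : ℝ) = t} ∪ ({t | a q = a t}ᶜ ∩ {t | b q = b t}ᶜ)) := by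
    ext t
    simp only [strictParams, Set.mem_ofPred_eq, Set.mem_iInter, Set.mem_union, Set.mem_inter_iff,
      Set.mem_compl_iff]
    constructor
    · intro H q
      by_cases hq : (q : ℝ) = t
      · exact Or.inl hq
      · exact Or.inr (H q hq)
    · intro H s hs
      constructor
      · intro heq
        obtain ⟨q, hq, e⟩ := exists_rat_eq h.mono_fst hs heq
        exact ((H q).resolve_left hq).1 e
      · intro heq
        obtain ⟨q, hq, e⟩ := exists_rat_eq h.mono_snd hs heq
        exact ((H q).resolve_left hq).2 e
  rw [this]
  refine MeasurableSet.iInter fun q => MeasurableSet.union ?_ (MeasurableSet.inter ?_ ?_)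
  · exact measurableSet_eq_fun measurable_const measurable_id
  · exact (measurableSet_eq_fun measurable_const h.continuous.measurable).compl
  · exact (measurableSet_eq_fun measurable_const h.swap.continuous.measurable).compl

theorem RegularOptPair.ae_mem_strictParams (S : RegularOptPair ν a b) :
    ∀ᵐ y ∂ν, y ∉ segs a b → ∀ t, WellPosed a b y t → t ∈ strictParams a b := by
  filter_upwards [S.ae_snd_ne, S.ae_of_swap S.swap.ae_snd_ne] with y h1 h2 hy t ht s hst
  rw [swap_mem_segs] at h2
  exact ⟨h2 hy t (wellPosed_swap.2 ht) s hst, h1 hy t ht s hst⟩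

theorem RegularOptPair.sign_mul_setIntegral_compact (S : RegularOptPair ν a b) (hτm : Measurable τ)
    (hτ : ∀ᵐ y ∂ν, y ∉ segs a b → defect a b y < ⊤ ∧ WellPosed a b y (τ y))
    {K : Set ℝ} (hK : IsCompact K) (hne : K.Nonempty) (hKs : K ⊆ strictParams a b)
    {c : ℝ} (hc : |c| = 1) :
    Integrable (fun y => K.indicator (fun _ => c) (τ y) * (a (τ y) - y.1))
      (ν.restrict (segs a b)ᶜ) ∧
    ∫ y in (segs a b)ᶜ, K.indicator (fun _ => c) (τ y) * (a (τ y) - y.1) ∂ν ≤ 0 := by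
  have h := S.isPair
  have hac := h.continuous
  have hbc := h.swap.continuous
  have hbK : IsCompact (b '' K) := hK.image hbc
  have hbne : (b '' K).Nonempty := hne.image b
  obtain ⟨p, hp⟩ := hK.exists_isLeast hne
  obtain ⟨q, hq⟩ := hK.exists_isGreatest hne
  have hp' : b (p - 1) < b p := (h.mono_snd (by linarith)).lt_of_ne
    (hKs hp.1 (p - 1) (by linarith)).2
  have hq' : b q < b (q + 1) := (h.mono_snd (by linarith)).lt_of_ne
    (hKs hq.1 (q + 1) (by linarith)).2.symm
  obtain ⟨N, hN⟩ := exists_nat_one_div_lt (lt_min (sub_pos.2 hp') (sub_pos.2 hq'))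
  let d : ℝ → ℝ := fun x => Metric.infDist x (b '' K)
  have hd0 : ∀ x, 0 ≤ d x := fun x => Metric.infDist_nonneg
  have hdL : ∀ x z, d x ≤ d z + |x - z| := fun x z => by
    rw [← Real.dist_eq]; exact Metric.infDist_le_infDist_add_dist
  have hdc : Continuous d := Metric.continuous_infDist_pt _
  have hdpos : ∀ x, x ∉ b '' K → 0 < d x := fun x hx =>
    (hbK.isClosed.notMem_iff_infDist_pos hbne).1 hx
  let M : ℕ → ℝ := fun n => n + N + 1
  have hM0 : ∀ n, 0 < M n := fun n => by positivity
  have hMN : ∀ n, 1 / M n ≤ 1 / (N + 1) := fun n =>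
    one_div_le_one_div_of_le (by positivity) (by simp only [M]; linarith [n.cast_nonneg (α := ℝ)])
  have hMlim : ∀ κ > 0, ∀ᶠ n in atTop, 1 / M n < κ := by
    intro κ hκ
    obtain ⟨m, hm⟩ := exists_nat_one_div_lt hκ
    filter_upwards [eventually_ge_atTop m] with n hn
    refine lt_of_le_of_lt (one_div_le_one_div_of_le (by positivity) ?_) hm
    have : (m : ℝ) ≤ n := by exact_mod_cast hn
    simp only [M]; linarith [N.cast_nonneg (α := ℝ)]
  let k : ℕ → ℝ → ℝ := fun n t => c * max 0 (1 - M n * d (b t))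
  have hk1 : ∀ n t, |k n t| ≤ 1 := fun n t => by
    simp only [k]
    rw [abs_mul, hc, one_mul, abs_of_nonneg (le_max_left _ _)]
    exact max_le zero_le_one (by linarith [mul_nonneg (hM0 n).le (hd0 (b t))])
  have hsupp : ∀ n t, k n t ≠ 0 → d (b t) < 1 / M n := by
    intro n t hne
    have hpos : 0 < 1 - M n * d (b t) := by
      by_contra! hle
      exact hne (by simp only [k]; rw [max_eq_left hle, mul_zero])
    rw [lt_div_iff₀ (hM0 n)]; linarith
  refine S.setIntegral_nonpos hτm hτ (h := k) (p := p - 1) (q := q + 1)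
    (fun n => by simp only [k]; fun_prop) hk1
    (fun n => ⟨1 / M n, one_div_pos.2 (hM0 n), fun ε hε hεM s t hst => ?_⟩)
    (fun n t hne => ?_) (fun t => ?_) ?_
  · rw [le_div_iff₀ (hM0 n)] at hεM
    have hb := h.mono_snd hst
    have h1 : |max 0 (1 - M n * d (b t)) - max 0 (1 - M n * d (b s))| ≤ M n * (b t - b s) := by
      refine (abs_max_sub_max_le_max _ _ _ _).trans ?_
      rw [sub_self, abs_zero]
      refine max_le (mul_nonneg (hM0 n).le (by linarith)) ?_
      have e1 := mul_le_mul_of_nonneg_left (hdL (b t) (b s)) (hM0 n).le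
      have e2 := mul_le_mul_of_nonneg_left (hdL (b s) (b t)) (hM0 n).le
      rw [abs_of_nonneg (by linarith : 0 ≤ b t - b s)] at e1
      rw [abs_of_nonpos (by linarith : b s - b t ≤ 0)] at e2
      rw [abs_le]; constructor <;> linarith
    have h2 : |k n t - k n s| ≤ M n * (b t - b s) := by
      simp only [k]
      rw [← mul_sub, abs_mul, hc, one_mul]; exact h1
    have h3 := mul_le_mul_of_nonneg_left (abs_le.1 h2).1 hε.le
    have h4 := mul_le_mul_of_nonneg_right hεM (by linarith : 0 ≤ b t - b s)
    simp only
    nlinarith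
  · have h1 := hsupp n t hne
    have h2 := (hMN n).trans_lt hN
    obtain ⟨_, ⟨r, hr, rfl⟩, hlt⟩ := (Metric.infDist_lt_iff hbne).1 (h1.trans h2)
    rw [Real.dist_eq] at hlt
    have h3 := lt_min_iff.1 hlt
    have hpr := h.mono_snd (hp.2 hr)
    have hrq := h.mono_snd (hq.2 hr)
    constructor
    · by_contra! hlt
      have := h.mono_snd hlt.le
      linarith [neg_abs_le (b t - b r)]
    · by_contra! hlt
      have := h.mono_snd hlt.le
      linarith [le_abs_self (b t - b r)]
  · by_cases ht : t ∈ K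
    · rw [Set.indicator_of_mem ht]
      refine tendsto_const_nhds.congr fun n => ?_
      have : d (b t) = 0 := Metric.infDist_zero_of_mem ⟨t, ht, rfl⟩
      simp [k, this]
    · rw [Set.indicator_of_notMem ht]
      refine Tendsto.congr' ?_ tendsto_const_nhds
      have hpos : 0 < d (b t) := by
        refine hdpos _ ?_
        rintro ⟨r, hr, e⟩
        exact (hKs hr t (by rintro rfl; exact ht hr)).2 e.symm
      filter_upwards [hMlim _ hpos] with n hn
      by_contra hne
      exact lt_asymm hn (hsupp n t (Ne.symm hne))
  · rintro y ⟨s, σ, hsσ, rfl, hseg⟩ η hη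
    have hnot : b σ ∉ b '' K := by
      rintro ⟨r, hr, e⟩
      have hrσ : r = σ := by
        by_contra hne
        exact (hKs hr σ (Ne.symm hne)).2 e.symm
      obtain ⟨h1, h2⟩ := hKs hr s (hrσ ▸ hsσ)
      rw [hrσ] at h1 h2
      exact hseg.elim h1 h2
    have hpos := hdpos _ hnot
    filter_upwards [hMlim _ (half_pos hpos)] with n hn
    refine ⟨d (b σ) / 2 * η, by positivity, fun t ht => ?_⟩
    by_cases hz : k n t = 0
    · rw [hz, zero_mul]; linarith
    · have h1 := hsupp n t hz
      have h2 := hdL (b σ) (b t)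
      have h3 : d (b σ) / 2 ≤ |b t - b σ| := by rw [abs_sub_comm]; linarith
      have h4 : profile a b (a σ, b σ) t = |a t - a σ| * |b t - b σ| := by
        rw [← abs_mul, profile, abs_of_nonneg]
        rcases le_total t σ with hle | hle
        · exact mul_nonneg_of_nonpos_of_nonpos (by linarith [h.mono_fst hle])
            (by linarith [h.mono_snd hle])
        · exact mul_nonneg (by linarith [h.mono_fst hle]) (by linarith [h.mono_snd hle])
      have h5 : |a t - a σ| ≤ η := by
        by_contra! hlt
        rw [h4] at ht
        have : η * (d (b σ) / 2) ≤ |a t - a σ| * |b t - b σ| :=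
          mul_le_mul hlt.le h3 (by positivity) (abs_nonneg _)
        linarith
      have h6 : |k n t * (a t - a σ)| ≤ η := by
        rw [abs_mul]
        calc _ ≤ 1 * |a t - a σ| := by gcongr; exact hk1 n t
          _ ≤ η := by rwa [one_mul]
      exact (abs_le.1 h6).1

theorem RegularOptPair.setIntegral_compact (S : RegularOptPair ν a b) (hτm : Measurable τ)
    (hτ : ∀ᵐ y ∂ν, y ∉ segs a b → defect a b y < ⊤ ∧ WellPosed a b y (τ y))
    {K : Set ℝ} (hK : IsCompact K) (hKs : K ⊆ strictParams a b) :
    ∫ y in τ ⁻¹' K, (a (τ y) - y.1) ∂(ν.restrict (segs a b)ᶜ) = 0 := by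
  rcases K.eq_empty_or_nonempty with rfl | hne
  · simp
  have h1 := (S.sign_mul_setIntegral_compact hτm hτ hK hne hKs (c := 1) (by simp)).2
  have h2 := (S.sign_mul_setIntegral_compact hτm hτ hK hne hKs (c := -1) (by simp)).2
  have e : ∀ c : ℝ, ∫ y in (segs a b)ᶜ, K.indicator (fun _ => c) (τ y) * (a (τ y) - y.1) ∂ν =
      c * ∫ y in τ ⁻¹' K, (a (τ y) - y.1) ∂(ν.restrict (segs a b)ᶜ) := by
    intro c
    rw [← integral_indicator (hτm hK.measurableSet), ← integral_const_mul]
    refine integral_congr_ae (Eventually.of_forall fun y => ?_)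
    by_cases hy : τ y ∈ K
    · have : y ∈ τ ⁻¹' K := hy
      simp [hy]
    · have : y ∉ τ ⁻¹' K := hy
      simp [hy]
  rw [e] at h1 h2
  linarith

end BackwardTransport

namespace BackwardTransport

variable {a b : ℝ → ℝ} {ν : Measure (ℝ × ℝ)} {τ : ℝ × ℝ → ℝ}

/-! ### The conditional mean of `y` given the minimizer -/

/-- A measurable selection of the minimizers. -/
structure RegularOptPair.Selection (ν : Measure (ℝ × ℝ)) (a b : ℝ → ℝ) (τ : ℝ × ℝ → ℝ) : Prop where
  measurable : Measurable τ
  wellPosed : ∀ᵐ y ∂ν, y ∉ segs a b → defect a b y < ⊤ ∧ WellPosed a b y (τ y)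

theorem RegularOptPair.Selection.swap (T : RegularOptPair.Selection ν a b τ) :
    RegularOptPair.Selection (ν.map Prod.swap) b a (τ ∘ Prod.swap) := by
  refine ⟨T.measurable.comp measurable_swap, ?_⟩
  rw [show (Prod.swap : ℝ × ℝ → ℝ × ℝ) = MeasurableEquiv.prodComm from rfl,
    (MeasurableEquiv.prodComm (α := ℝ) (β := ℝ)).measurableEmbedding.ae_map_iff]
  filter_upwards [T.wellPosed] with y hy h
  change y.swap ∉ segs b a at h
  change defect b a y.swap < ⊤ ∧ WellPosed b a y.swap ((τ ∘ Prod.swap) y.swap)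
  rw [swap_mem_segs] at h
  rw [defect_swap, wellPosed_swap, Function.comp, Prod.swap_swap]
  exact hy h

/-- The truncated integrals agree as measures in the parameter. -/
theorem RegularOptPair.truncated (S : RegularOptPair ν a b) (T : RegularOptPair.Selection ν a b τ)
    (N : ℕ) {g : ℝ → ℝ} (hg : Measurable g) {C : ℝ}
    (hgC : ∀ t ∈ Set.Icc (-(N : ℝ)) N, |g t| ≤ C) :
    ∫ y in τ ⁻¹' (Set.Icc (-(N : ℝ)) N), g (τ y) * (a (τ y) - y.1) ∂(ν.restrict (segs a b)ᶜ) = 0 := by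
  have := S.isProb
  have h := S.isPair
  have hac := h.continuous
  have hτm := T.measurable
  set I := Set.Icc (-(N : ℝ)) N with hI
  have hIm : MeasurableSet (τ ⁻¹' I) := hτm measurableSet_Icc
  set ρ := ν.restrict (segs a b)ᶜ with hρ
  set κ := ρ.restrict (τ ⁻¹' I) with hκ
  set f : ℝ × ℝ → ℝ := fun y => a (τ y) - y.1 with hf
  have hfm : Measurable f := (hac.measurable.comp hτm).sub measurable_fst
  have hfi : Integrable f κ := by
    refine Integrable.sub ?_ S.integrable_fst.restrict.restrict
    refine Integrable.mono' (integrable_const (max |a (-N)| |a N|))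
      (hac.measurable.comp hτm).aestronglyMeasurable ?_
    rw [hκ, ae_restrict_iff' hIm]
    refine Eventually.of_forall fun y hy => ?_
    rw [Real.norm_eq_abs]
    exact abs_le_max_abs_abs (h.mono_fst hy.1) (h.mono_fst hy.2)
  let m : (ℝ × ℝ → ℝ) → Measure ℝ := fun f =>
    (κ.withDensity fun y => ((f y).toNNReal : ENNReal)).map τ
  have hm : ∀ f' : ℝ × ℝ → ℝ, Measurable f' → ∀ B, MeasurableSet B → m f' B =
      ∫⁻ y in τ ⁻¹' B, ENNReal.ofReal (f' y) ∂κ := by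
    intro f' hf' B hB
    simp only [m]
    rw [Measure.map_apply hτm hB, withDensity_apply _ (hτm hB)]
    rfl
  have hfin : ∀ f' : ℝ × ℝ → ℝ, Integrable f' κ → IsFiniteMeasure (m f') := by
    intro f' hf'
    have : IsFiniteMeasure (κ.withDensity fun y => ((f' y).toNNReal : ENNReal)) :=
      isFiniteMeasure_withDensity_ofReal hf'.2
    exact Measure.isFiniteMeasure_map _ _
  have hstrict : ∀ᵐ y ∂κ, τ y ∈ strictParams a b := by
    refine ae_restrict_of_ae ?_
    rw [hρ, ae_restrict_iff' h.measurableSet_segs.compl]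
    filter_upwards [T.wellPosed, S.ae_mem_strictParams] with y h1 h2 hy
    exact h2 hy _ (h1 hy).2
  have hA := h.measurableSet_strictParams
  have hnull : ∀ f' : ℝ × ℝ → ℝ, m f' (strictParams a b)ᶜ = 0 := by
    intro f'
    simp only [m]
    rw [Measure.map_apply hτm hA.compl]
    refine withDensity_absolutelyContinuous _ _ ?_
    exact hstrict
  have i1 := hfin f hfi
  have i2 := hfin (-f) hfi.neg
  have hcomp : ∀ K, IsCompact K → K ⊆ strictParams a b → m f K = m (-f) K := by
    intro K hK hKs
    have h0 := S.setIntegral_compact hτm T.wellPosed (hK.inter_right (isClosed_Icc (a := -(N : ℝ)) (b := N)))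
      (Set.inter_subset_left.trans hKs)
    rw [Set.preimage_inter, ← Measure.restrict_restrict (hτm hK.measurableSet)] at h0
    change ∫ y in τ ⁻¹' K, f y ∂κ = 0 at h0
    rw [integral_eq_lintegral_pos_part_sub_lintegral_neg_part hfi.restrict] at h0
    have k1 := hm f hfm K hK.measurableSet
    have k2 := hm (-f) hfm.neg K hK.measurableSet
    simp only [Pi.neg_apply] at k2
    rw [← k1, ← k2] at h0
    exact (ENNReal.toReal_eq_toReal_iff' (measure_ne_top _ _) (measure_ne_top _ _)).1 (sub_eq_zero.1 h0)
  have heq : m f = m (-f) := by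
    refine Measure.ext fun B hB => ?_
    have e : ∀ f', m f' B = m f' (B ∩ strictParams a b) := fun f' => by
      refine (measure_inter_conull ?_).symm
      exact hnull f'
    rw [e f, e (-f), (hB.inter hA).measure_eq_iSup_isCompact,
      (hB.inter hA).measure_eq_iSup_isCompact]
    refine iSup_congr fun K => iSup_congr fun hKB => iSup_congr fun hK => ?_
    exact hcomp K hK (hKB.trans Set.inter_subset_right)
  have hint : ∀ f' : ℝ × ℝ → ℝ, Measurable f' → ∫ t, g t ∂(m f') =
      ∫ y, (f' y).toNNReal * g (τ y) ∂κ := by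
    intro f' hf'
    simp only [m]
    rw [integral_map hτm.aemeasurable hg.aestronglyMeasurable,
      integral_withDensity_eq_integral_smul (by fun_prop)]
    rfl
  have hgi : ∀ f' : ℝ × ℝ → ℝ, Measurable f' → Integrable f' κ →
      Integrable (fun y => ((f' y).toNNReal : ℝ) * g (τ y)) κ := by
    intro f' hf' hi
    refine Integrable.mono' (hi.norm.mul_const C) (by fun_prop) ?_
    rw [hκ, ae_restrict_iff' hIm]
    refine Eventually.of_forall fun y hy => ?_
    rw [norm_mul, Real.norm_eq_abs, Real.norm_eq_abs, Real.norm_eq_abs, NNReal.abs_eq,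
      Real.coe_toNNReal']
    gcongr
    · exact max_le (le_abs_self _) (abs_nonneg _)
    · exact hgC _ hy
  have h1 := hint f hfm
  have h2 := hint (-f) hfm.neg
  rw [heq, h2, eq_comm, ← sub_eq_zero, ← integral_sub (hgi f hfm hfi) (hgi _ hfm.neg hfi.neg)] at h1
  rw [← h1]
  refine integral_congr_ae (Eventually.of_forall fun y => ?_)
  simp only [Pi.neg_apply, Real.coe_toNNReal']
  change g (τ y) * f y = _
  rw [← sub_mul]
  rcases le_total 0 (f y) with h0 | h0
  · rw [max_eq_left h0, max_eq_right (by linarith)]; ring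
  · rw [max_eq_right h0, max_eq_left (by linarith)]; ring

theorem RegularOptPair.integrable_fst_sq (S : RegularOptPair ν a b) :
    Integrable (fun y : ℝ × ℝ => y.1 ^ 2) ν := by
  refine ⟨by fun_prop, ?_⟩
  rw [hasFiniteIntegral_iff_ofReal (Eventually.of_forall fun y => by positivity)]
  exact (lintegral_mono fun y => ENNReal.ofReal_le_ofReal (by nlinarith [sq_nonneg y.2])).trans_lt
    S.moment.lt_top

theorem RegularOptPair.integrable_sq (S : RegularOptPair ν a b)
    (T : RegularOptPair.Selection ν a b τ) :
    Integrable (fun y => a (τ y) ^ 2) (ν.restrict (segs a b)ᶜ) := by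
  have := S.isProb
  have h := S.isPair
  have hac := h.continuous
  have hτm := T.measurable
  set ρ := ν.restrict (segs a b)ᶜ with hρ
  have ham : Measurable fun y => a (τ y) := hac.measurable.comp hτm
  let I : ℕ → Set (ℝ × ℝ) := fun N => τ ⁻¹' (Set.Icc (-(N : ℝ)) N)
  have hIm : ∀ N, MeasurableSet (I N) := fun N => hτm measurableSet_Icc
  have hbd : ∀ N : ℕ, ∀ t ∈ Set.Icc (-(N : ℝ)) N, |a t| ≤ max |a (-N)| |a N| := fun N t ht =>
    abs_le_max_abs_abs (h.mono_fst ht.1) (h.mono_fst ht.2)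
  have hbdI : ∀ N : ℕ, ∀ᵐ y ∂(ρ.restrict (I N)), ‖a (τ y)‖ ≤ max |a (-N)| |a N| := fun N => by
    rw [ae_restrict_iff' (hIm N)]
    exact Eventually.of_forall fun y hy => hbd N _ hy
  have hle : ∀ N, ∫⁻ y in I N, ENNReal.ofReal (a (τ y) ^ 2) ∂ρ ≤
      ENNReal.ofReal (∫ y, y.1 ^ 2 ∂ν) := by
    intro N
    have h0 := S.truncated T N (g := a) hac.measurable (hbd N)
    have hi1 : Integrable (fun y => a (τ y) ^ 2) (ρ.restrict (I N)) := by
      refine Integrable.mono' (integrable_const ((max |a (-N)| |a N|) ^ 2))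
        (ham.pow_const 2).aestronglyMeasurable ?_
      filter_upwards [hbdI N] with y hy
      rw [norm_pow]; gcongr
    have hi2 : Integrable (fun y => a (τ y) * y.1) (ρ.restrict (I N)) :=
      S.integrable_fst.restrict.restrict.bdd_mul ham.aestronglyMeasurable (hbdI N)
    have hi3 : Integrable (fun y : ℝ × ℝ => y.1 ^ 2) (ρ.restrict (I N)) :=
      S.integrable_fst_sq.restrict.restrict
    have e1 : ∫ y in I N, a (τ y) ^ 2 ∂ρ = ∫ y in I N, a (τ y) * y.1 ∂ρ := by
      rw [← sub_eq_zero, ← integral_sub hi1 hi2, ← h0]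
      exact integral_congr_ae (Eventually.of_forall fun y => by simp only; ring)
    have e2 : ∫ y in I N, a (τ y) * y.1 ∂ρ ≤
        ∫ y in I N, (a (τ y) ^ 2 / 2 + y.1 ^ 2 / 2) ∂ρ := by
      refine integral_mono hi2 ((hi1.div_const 2).add (hi3.div_const 2)) fun y => ?_
      simp only
      nlinarith [sq_nonneg (a (τ y) - y.1)]
    rw [integral_add (hi1.div_const 2) (hi3.div_const 2), integral_div, integral_div] at e2
    have e3 : ∫ y in I N, y.1 ^ 2 ∂ρ ≤ ∫ y, y.1 ^ 2 ∂ν :=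
      (setIntegral_le_integral S.integrable_fst_sq.restrict
        (Eventually.of_forall fun y => sq_nonneg _)).trans
        (setIntegral_le_integral S.integrable_fst_sq (Eventually.of_forall fun y => sq_nonneg _))
    rw [← ofReal_integral_eq_lintegral_ofReal hi1 (Eventually.of_forall fun y => sq_nonneg _)]
    exact ENNReal.ofReal_le_ofReal (by linarith)
  have hmonoI : Monotone I := fun N N' hN y hy => by
    have : (N : ℝ) ≤ N' := by exact_mod_cast hN
    exact ⟨by linarith [hy.1], by linarith [hy.2]⟩
  have hU : ⋃ N, I N = Set.univ := by
    ext y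
    simp only [Set.mem_iUnion, Set.mem_univ, iff_true]
    obtain ⟨N, hN⟩ := exists_nat_ge |τ y|
    exact ⟨N, (abs_le.1 hN).1, (abs_le.1 hN).2⟩
  refine ⟨(ham.pow_const 2).aestronglyMeasurable, ?_⟩
  rw [hasFiniteIntegral_iff_ofReal (Eventually.of_forall fun y => sq_nonneg _),
    ← setLIntegral_univ, ← hU, setLIntegral_iUnion_of_directed _ hmonoI.directed_le]
  exact (iSup_le hle).trans_lt ENNReal.ofReal_lt_top

theorem RegularOptPair.integrable_of_selection (S : RegularOptPair ν a b)
    (T : RegularOptPair.Selection ν a b τ) :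
    Integrable (fun y => a (τ y)) (ν.restrict (segs a b)ᶜ) := by
  have := S.isProb
  have hac := S.isPair.continuous
  refine Integrable.mono' ((integrable_const (1 : ℝ)).add (S.integrable_sq T))
    (hac.measurable.comp T.measurable).aestronglyMeasurable (Eventually.of_forall fun y => ?_)
  simp only [Pi.add_apply, Real.norm_eq_abs]
  nlinarith [sq_abs (a (τ y)), sq_nonneg (|a (τ y)| - 1), abs_nonneg (a (τ y))]

theorem RegularOptPair.setIntegral_eq (S : RegularOptPair ν a b)
    (T : RegularOptPair.Selection ν a b τ) {B : Set ℝ} (hB : MeasurableSet B) :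
    ∫ y in τ ⁻¹' B, a (τ y) ∂(ν.restrict (segs a b)ᶜ) =
      ∫ y in τ ⁻¹' B, y.1 ∂(ν.restrict (segs a b)ᶜ) := by
  have hτm := T.measurable
  set ρ := ν.restrict (segs a b)ᶜ with hρ
  have hi1 : Integrable (fun y => a (τ y)) ρ := S.integrable_of_selection T
  have hi2 : Integrable (fun y : ℝ × ℝ => y.1) ρ := S.integrable_fst.restrict
  rw [← sub_eq_zero, ← integral_sub hi1.restrict hi2.restrict]
  let I : ℕ → Set (ℝ × ℝ) := fun N => τ ⁻¹' (Set.Icc (-(N : ℝ)) N)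
  have hIm : ∀ N, MeasurableSet (I N) := fun N => hτm measurableSet_Icc
  have hmonoI : Monotone I := fun N N' hN y hy => by
    have : (N : ℝ) ≤ N' := by exact_mod_cast hN
    exact ⟨by linarith [hy.1], by linarith [hy.2]⟩
  have hU : ⋃ N, I N = Set.univ := by
    ext y
    simp only [Set.mem_iUnion, Set.mem_univ, iff_true]
    obtain ⟨N, hN⟩ := exists_nat_ge |τ y|
    exact ⟨N, (abs_le.1 hN).1, (abs_le.1 hN).2⟩
  have hlim := tendsto_setIntegral_of_monotone (μ := ρ.restrict (τ ⁻¹' B))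
    (f := fun y => a (τ y) - y.1) hIm hmonoI ((hi1.sub hi2).restrict.integrableOn)
  rw [hU, setIntegral_univ] at hlim
  refine tendsto_nhds_unique hlim (tendsto_const_nhds.congr fun N => ?_)
  have h0 := S.truncated T N (g := B.indicator fun _ => 1) (measurable_const.indicator hB)
    (C := 1) (fun t _ => by
      by_cases ht : t ∈ B
      · simp [ht]
      · simp [ht])
  rw [← h0, Measure.restrict_restrict (μ := ρ) (hIm N), Set.inter_comm,
    ← Measure.restrict_restrict (μ := ρ) (hτm hB), ← integral_indicator (hτm hB)]
  refine integral_congr_ae (Eventually.of_forall fun y => ?_)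
  by_cases hy : τ y ∈ B
  · have : y ∈ τ ⁻¹' B := hy
    simp [hy]
  · have : y ∉ τ ⁻¹' B := hy
    simp [hy]

end BackwardTransport

namespace BackwardTransport

variable {a b : ℝ → ℝ} {y z : ℝ × ℝ}

/-! ### The gradient of `φ_G` at well-posed points -/

theorem IsPair.snd_le_of_forall_le (h : IsPair a b) (hy : defect a b y < ⊤) {β : ℝ}
    (hβ : ∀ t, b t ≤ β) : y.2 ≤ β := by
  by_contra! hlt
  set W := (defect a b y).toReal with hW
  have hW0 : 0 ≤ W := ENNReal.toReal_nonneg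
  have hκ : 0 < y.2 - β := by linarith
  set t := β + y.1 + (W + 1) / (y.2 - β) with ht
  have h1 := neg_defect_le hy t
  have h2 : (W + 1) / (y.2 - β) ≤ a t - y.1 := by linarith [h.add_eq t, hβ t]
  have h3 : (W + 1) / (y.2 - β) * (y.2 - β) ≤ (a t - y.1) * (y.2 - b t) :=
    mul_le_mul h2 (by linarith [hβ t]) hκ.le (le_trans (by positivity) h2)
  rw [div_mul_cancel₀ _ hκ.ne'] at h3
  rw [profile] at h1
  linarith

theorem IsPair.fst_le_of_forall_le (h : IsPair a b) (hy : defect a b y < ⊤) {β : ℝ}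
    (hβ : ∀ t, a t ≤ β) : y.1 ≤ β :=
  h.swap.snd_le_of_forall_le (y := y.swap) (by rwa [defect_swap]) hβ

theorem IsPair.le_snd_of_forall_le (h : IsPair a b) (hy : defect a b y < ⊤) {β : ℝ}
    (hβ : ∀ t, β ≤ b t) : β ≤ y.2 := by
  have := h.reflect.snd_le_of_forall_le (y := -y) (β := -β) (by rwa [defect_reflect])
    (fun t => neg_le_neg (hβ _))
  simpa using this

theorem IsPair.le_fst_of_forall_le (h : IsPair a b) (hy : defect a b y < ⊤) {β : ℝ}
    (hβ : ∀ t, β ≤ a t) : β ≤ y.1 :=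
  h.swap.le_snd_of_forall_le (y := y.swap) (by rwa [defect_swap]) hβ

theorem profile_sub_profile (a b : ℝ → ℝ) (y z : ℝ × ℝ) (t : ℝ) :
    profile a b z t = profile a b y t + (y.2 - b t) * (z.1 - y.1) + (y.1 - a t) * (z.2 - y.2) +
      (z.1 - y.1) * (z.2 - y.2) := by
  simp only [profile]; ring

/-- Approximate minimizers at points near `y` have bounded parameters. -/
def LocallyBoundedAbove (a b : ℝ → ℝ) (y : ℝ × ℝ) : Prop :=
  ∃ ρ > 0, ∃ M, ∀ z, defect a b z < ⊤ → |z.1 - y.1| < ρ → |z.2 - y.2| < ρ →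
    ∀ s, profile a b z s < -(defect a b z).toReal + ρ → s ≤ M

theorem IsPair.locallyBoundedAbove_of_snd_le (h : IsPair a b)
    {t : ℝ} (ht : WellPosed a b y t) (hb : ∀ s, b s ≤ y.2) : LocallyBoundedAbove a b y := by
  obtain ⟨δ, hδ, H⟩ := ht 1 one_pos
  set W := (defect a b y).toReal with hW
  set M := max (t + 1) (y.1 + y.2) with hM
  set Q := |a t - y.1| + |b t - y.2| + 1 with hQ
  set R := y.2 - b M + 1 with hR
  have hQ0 : 0 < Q := by positivity
  have hR0 : 0 < R := by linarith [hb M]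
  set ρ := min 1 (δ / (2 * (Q + R + 1))) with hρ
  have hρ0 : 0 < ρ := lt_min one_pos (by positivity)
  have hρ1 : ρ ≤ 1 := min_le_left _ _
  have hρ2 : ρ * (2 * (Q + R + 1)) ≤ δ := by
    rw [← le_div_iff₀ (by positivity)]; exact min_le_right _ _
  refine ⟨ρ, hρ0, M, fun z hz h1 h2 s hs => ?_⟩
  by_contra! hlt
  have hz2 : z.2 ≤ y.2 := h.snd_le_of_forall_le hz hb
  have hfar : -W + δ ≤ profile a b y s := by
    by_contra! hc
    have := (abs_lt.1 (H s hc)).2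
    linarith [le_max_left (t + 1) (y.1 + y.2)]
  have has : y.1 ≤ a s := by
    have := h.add_eq s
    linarith [hb s, le_max_right (t + 1) (y.1 + y.2)]
  have hbs : b M ≤ b s := h.mono_snd hlt.le
  have e1 : profile a b y s - profile a b z s =
      (a s - y.1) * (z.2 - y.2) + (z.1 - y.1) * (b s - z.2) := by
    simp only [profile]; ring
  have e2 : (a s - y.1) * (z.2 - y.2) ≤ 0 :=
    mul_nonpos_of_nonneg_of_nonpos (by linarith) (by linarith)
  have e3 : (z.1 - y.1) * (b s - z.2) ≤ ρ * R := by
    have hb3 : |b s - z.2| ≤ R := by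
      have := abs_lt.1 h2
      rw [abs_le]; constructor <;> linarith [hb s]
    calc _ ≤ |z.1 - y.1| * |b s - z.2| := by rw [← abs_mul]; exact le_abs_self _
      _ ≤ ρ * R := by gcongr
  have e4 : profile a b z t ≤ profile a b y t + ρ * Q := by
    rw [profile_sub_profile a b y z t]
    have k1 : (y.2 - b t) * (z.1 - y.1) ≤ |b t - y.2| * ρ := by
      rw [abs_sub_comm]
      calc _ ≤ |y.2 - b t| * |z.1 - y.1| := by rw [← abs_mul]; exact le_abs_self _
        _ ≤ _ := by gcongr
    have k2 : (y.1 - a t) * (z.2 - y.2) ≤ |a t - y.1| * ρ := by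
      rw [abs_sub_comm]
      calc _ ≤ |y.1 - a t| * |z.2 - y.2| := by rw [← abs_mul]; exact le_abs_self _
        _ ≤ _ := by gcongr
    have k3 : (z.1 - y.1) * (z.2 - y.2) ≤ 1 * ρ := by
      calc _ ≤ |z.1 - y.1| * |z.2 - y.2| := by rw [← abs_mul]; exact le_abs_self _
        _ ≤ _ := by gcongr; linarith
    rw [hQ]; linarith
  have e5 := neg_defect_le hz t
  have e6 := h.wellPosed_profile ht
  nlinarith

theorem IsPair.locallyBoundedAbove (h : IsPair a b)
    {t : ℝ} (ht : WellPosed a b y t) : LocallyBoundedAbove a b y := by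
  by_cases hb : ∀ s, b s ≤ y.2
  · exact h.locallyBoundedAbove_of_snd_le ht hb
  by_cases ha : ∀ s, a s ≤ y.1
  · obtain ⟨ρ, hρ, M, H⟩ := h.swap.locallyBoundedAbove_of_snd_le (y := y.swap)
      (wellPosed_swap.2 ht) ha
    refine ⟨ρ, hρ, M, fun z hz h1 h2 s hs => H z.swap (by rwa [defect_swap]) h2 h1 s ?_⟩
    rwa [profile_swap, defect_swap]
  push Not at ha hb
  obtain ⟨t₁, h₁⟩ := ha
  obtain ⟨t₂, h₂⟩ := hb
  set κ := min (a t₁ - y.1) (b t₂ - y.2) / 2 with hκ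
  have hκ0 : 0 < κ := half_pos (lt_min (by linarith) (by linarith))
  have hκ1 : κ * 2 ≤ a t₁ - y.1 := by rw [hκ, div_mul_cancel₀ _ two_ne_zero]; exact min_le_left _ _
  have hκ2 : κ * 2 ≤ b t₂ - y.2 := by rw [hκ, div_mul_cancel₀ _ two_ne_zero]; exact min_le_right _ _
  refine ⟨min κ (κ * κ), lt_min hκ0 (by positivity), max t₁ t₂, fun z hz h1 h2 s hs => ?_⟩
  by_contra! hlt
  have k1 := h.mono_fst ((le_max_left _ _).trans hlt.le)
  have k2 := h.mono_snd ((le_max_right _ _).trans hlt.le)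
  have k3 := (abs_lt.1 (h1.trans_le (min_le_left _ _))).2
  have k4 := (abs_lt.1 (h2.trans_le (min_le_left _ _))).2
  have k5 : κ * κ ≤ profile a b z s :=
    mul_le_mul (by linarith) (by linarith) hκ0.le (by linarith)
  have k6 : 0 ≤ (defect a b z).toReal := ENNReal.toReal_nonneg
  linarith [min_le_right κ (κ * κ)]

theorem IsPair.wellPosed_stable (h : IsPair a b)
    {t : ℝ} (ht : WellPosed a b y t) {η : ℝ} (hη : 0 < η) :
    ∃ ρ > 0, ∀ z, defect a b z < ⊤ → |z.1 - y.1| < ρ → |z.2 - y.2| < ρ →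
      ∀ s, profile a b z s < -(defect a b z).toReal + ρ → |s - t| < η := by
  obtain ⟨ρ₁, hρ₁, M₁, H₁⟩ := h.locallyBoundedAbove ht
  obtain ⟨ρ₂, hρ₂, M₂, H₂⟩ := h.reflect.locallyBoundedAbove (y := -y) ht.reflect
  obtain ⟨δ, hδ, H⟩ := ht η hη
  set M := max |t| (max |M₁| |M₂|) with hM
  set Q := |a 0 - y.1| + |b 0 - y.2| + 2 * M + 1 with hQ
  have hM0 : 0 ≤ M := (abs_nonneg _).trans (le_max_left _ _)
  have hQ0 : 0 < Q := by positivity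
  set ρ := min (min ρ₁ ρ₂) (min 1 (δ / (2 * Q + 1))) with hρ
  have hρ0 : 0 < ρ := lt_min (lt_min hρ₁ hρ₂) (lt_min one_pos (by positivity))
  have hρ11 : ρ ≤ ρ₁ := (min_le_left _ _).trans (min_le_left _ _)
  have hρ12 : ρ ≤ ρ₂ := (min_le_left _ _).trans (min_le_right _ _)
  have hρ1 : ρ ≤ 1 := (min_le_right _ _).trans (min_le_left _ _)
  have hρ2 : ρ * (2 * Q + 1) ≤ δ := by
    rw [← le_div_iff₀ (by positivity)]; exact (min_le_right _ _).trans (min_le_right _ _)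
  refine ⟨ρ, hρ0, fun z hz h1 h2 s hs => ?_⟩
  have hs1 : s ≤ M₁ := H₁ z hz (by linarith) (by linarith) s (by linarith)
  have hs2 : -s ≤ M₂ := by
    refine H₂ (-z) (by rwa [defect_reflect]) ?_ ?_ (-s) ?_
    · rw [Prod.fst_neg, Prod.fst_neg, ← abs_neg]
      rw [show -(-z.1 - -y.1) = z.1 - y.1 by ring]
      exact h1.trans_le hρ12
    · rw [Prod.snd_neg, Prod.snd_neg, ← abs_neg]
      rw [show -(-z.2 - -y.2) = z.2 - y.2 by ring]
      exact h2.trans_le hρ12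
    · rw [profile_reflect, defect_reflect, neg_neg]; linarith
  have hsM : |s| ≤ M := by
    rw [abs_le]
    have := (le_max_left |M₁| |M₂|).trans (le_max_right |t| _)
    have := (le_max_right |M₁| |M₂|).trans (le_max_right |t| _)
    constructor <;> linarith [le_abs_self M₁, le_abs_self M₂]
  have hdiff : ∀ u, |u| ≤ M → |profile a b z u - profile a b y u| ≤ ρ * Q := by
    intro u hu
    have k1 : |y.1 - a u| ≤ |a 0 - y.1| + M := by
      have := h.abs_sub_le u 0
      rw [sub_zero] at this
      have e : y.1 - a u = -(a u - a 0) - (a 0 - y.1) := by ring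
      rw [e]; refine (abs_sub _ _).trans ?_; rw [abs_neg]; linarith
    have k2 : |y.2 - b u| ≤ |b 0 - y.2| + M := by
      have := h.swap.abs_sub_le u 0
      rw [sub_zero] at this
      have e : y.2 - b u = -(b u - b 0) - (b 0 - y.2) := by ring
      rw [e]; refine (abs_sub _ _).trans ?_; rw [abs_neg]; linarith
    have e : profile a b z u - profile a b y u = (y.2 - b u) * (z.1 - y.1) +
        (y.1 - a u) * (z.2 - y.2) + (z.1 - y.1) * (z.2 - y.2) := by
      rw [profile_sub_profile a b y z u]; ring
    rw [e]
    calc _ ≤ |y.2 - b u| * |z.1 - y.1| + |y.1 - a u| * |z.2 - y.2| + |z.1 - y.1| * |z.2 - y.2| := by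
          rw [← abs_mul, ← abs_mul, ← abs_mul]; exact abs_add_three _ _ _
      _ ≤ (|b 0 - y.2| + M) * ρ + (|a 0 - y.1| + M) * ρ + 1 * ρ := by gcongr; linarith
      _ = ρ * Q := by rw [hQ]; ring
  apply H
  have k1 := (abs_le.1 (hdiff s hsM)).1
  have k2 := (abs_le.1 (hdiff t (le_max_left _ _))).2
  have k3 := neg_defect_le hz t
  have k4 := h.wellPosed_profile ht
  nlinarith

theorem IsPair.exists_minimizer (h : IsPair a b) {p q δ : ℝ} (hδ : 0 < δ)
    (H : ∀ s, profile a b y s < -(defect a b y).toReal + δ → s ∈ Set.Icc p q) :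
    ∃ s ∈ Set.Icc p q, profile a b y s ≤ -(defect a b y).toReal := by
  obtain ⟨s₀, hs₀⟩ := h.exists_profile_lt (y := y) hδ
  obtain ⟨t, htI, htmin⟩ := isCompact_Icc.exists_isMinOn ⟨s₀, H s₀ hs₀⟩
    (h.continuous_profile y).continuousOn
  refine ⟨t, htI, le_of_forall_pos_le_add fun e he => ?_⟩
  obtain ⟨s, hs⟩ := h.exists_profile_lt (y := y) (lt_min hδ he)
  have := htmin (H s (by linarith [min_le_left δ e]))
  simp only [Set.mem_ofPred_eq] at this
  linarith [min_le_right δ e]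

/-- The linear form `d ↦ (y₂ - b t) d₁ + (y₁ - a t) d₂`. -/
noncomputable def gradForm (a b : ℝ → ℝ) (y : ℝ × ℝ) (t : ℝ) : ℝ × ℝ →L[ℝ] ℝ :=
  (y.2 - b t) • ContinuousLinearMap.fst ℝ ℝ ℝ + (y.1 - a t) • ContinuousLinearMap.snd ℝ ℝ ℝ

theorem gradForm_apply (a b : ℝ → ℝ) (y : ℝ × ℝ) (t : ℝ) (d : ℝ × ℝ) :
    gradForm a b y t d = (y.2 - b t) * d.1 + (y.1 - a t) * d.2 := by
  simp [gradForm]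

theorem hasFDerivAt_profile (a b : ℝ → ℝ) (y : ℝ × ℝ) (t : ℝ) :
    HasFDerivAt (fun z => profile a b z t) (gradForm a b y t) y := by
  have h1 : HasFDerivAt (fun z : ℝ × ℝ => a t - z.1) (-ContinuousLinearMap.fst ℝ ℝ ℝ) y :=
    (hasFDerivAt_fst (p := y)).const_sub (a t)
  have h2 : HasFDerivAt (fun z : ℝ × ℝ => b t - z.2) (-ContinuousLinearMap.snd ℝ ℝ ℝ) y :=
    (hasFDerivAt_snd (p := y)).const_sub (b t)
  refine (h1.mul h2).congr_fderiv ?_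
  ext <;> simp [gradForm]

theorem IsPair.mem_domPhi (h : IsPair a b) :
    y ∈ domPhi (Set.range fun t => (a t, b t)) ↔ defect a b y < ⊤ := by
  rw [domPhi, Set.mem_ofPred_eq, h.phi_range, bot_lt_iff_ne_bot, lt_top_iff_ne_top, Ne, Ne,
    EReal.neg_eq_bot_iff, EReal.coe_ennreal_eq_top_iff]

theorem IsPair.phiReal_eq (h : IsPair a b) :
    phiReal (Set.range fun t => (a t, b t)) y = -(defect a b y).toReal := by
  rw [phiReal, h.phi_range, EReal.toReal_neg_eq, EReal.toReal_coe_ennreal]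

theorem IsPair.hasFDerivAt_phiReal (h : IsPair a b)
    (hint : y ∈ interior (domPhi (Set.range fun t => (a t, b t)))) {t : ℝ}
    (ht : WellPosed a b y t) :
    HasFDerivAt (phiReal (Set.range fun t => (a t, b t))) (gradForm a b y t) y := by
  rw [hasFDerivAt_iff_isLittleO, Asymptotics.isLittleO_iff]
  intro c hc
  obtain ⟨ρ, hρ, H⟩ := h.wellPosed_stable ht (η := c / 4) (by positivity)
  have hy := h.mem_domPhi.1 (interior_subset hint)
  filter_upwards [mem_interior_iff_mem_nhds.1 hint,
    Metric.ball_mem_nhds y (lt_min hρ (by positivity : 0 < c / 4))] with z hz hzb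
  rw [h.mem_domPhi] at hz
  rw [h.phiReal_eq, h.phiReal_eq, gradForm_apply, Prod.fst_sub, Prod.snd_sub]
  rw [Metric.mem_ball, dist_eq_norm] at hzb
  set d := z - y with hd
  have d1 : |z.1 - y.1| ≤ ‖d‖ := norm_fst_le d
  have d2 : |z.2 - y.2| ≤ ‖d‖ := norm_snd_le d
  have hdρ : ‖d‖ < ρ := hzb.trans_le (min_le_left _ _)
  have hdc : ‖d‖ < c / 4 := hzb.trans_le (min_le_right _ _)
  have d3 : |(z.1 - y.1) * (z.2 - y.2)| ≤ c / 4 * ‖d‖ := by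
    rw [abs_mul]; gcongr; linarith
  have hWt := h.wellPosed_profile ht
  rw [Real.norm_eq_abs, abs_le]
  constructor
  · suffices ∀ e > 0, e < ρ → -(defect a b y).toReal + (y.2 - b t) * (z.1 - y.1) +
        (y.1 - a t) * (z.2 - y.2) - c * ‖d‖ ≤ -(defect a b z).toReal + e by
      have key : -(defect a b y).toReal + (y.2 - b t) * (z.1 - y.1) +
        (y.1 - a t) * (z.2 - y.2) - c * ‖d‖ ≤ -(defect a b z).toReal := by
        refine le_of_forall_pos_le_add fun e he => ?_
        have := this (min e (ρ / 2)) (lt_min he (by positivity))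
          ((min_le_right _ _).trans_lt (by linarith))
        linarith [min_le_left e (ρ / 2)]
      linarith
    intro e he heρ
    obtain ⟨s, hs⟩ := h.exists_profile_lt (y := z) he
    have hst := (H z hz (d1.trans_lt hdρ) (d2.trans_lt hdρ) s (by linarith)).le
    have k1 := (h.abs_sub_le s t).trans hst
    have k2 := (h.swap.abs_sub_le s t).trans hst
    rw [profile_sub_profile a b y z s] at hs
    have k3 := neg_defect_le hy s
    have k4 : |(b s - b t) * (z.1 - y.1)| ≤ c / 4 * ‖d‖ := by rw [abs_mul]; gcongr
    have k5 : |(a s - a t) * (z.2 - y.2)| ≤ c / 4 * ‖d‖ := by rw [abs_mul]; gcongr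
    have := (abs_le.1 k4).2
    have := (abs_le.1 k5).2
    have := (abs_le.1 d3).1
    nlinarith [norm_nonneg d]
  · have k1 := neg_defect_le hz t
    rw [profile_sub_profile a b y z t] at k1
    have := (abs_le.1 d3).2
    nlinarith [norm_nonneg d]

theorem IsPair.classicalGrad_eq (h : IsPair a b)
    (hy : y ∈ smoothDom (Set.range fun t => (a t, b t))) {t : ℝ}
    (ht : profile a b y t ≤ -(defect a b y).toReal) :
    classicalGrad (Set.range fun t => (a t, b t)) y = (y.2 - b t, y.1 - a t) := by
  have hmin : IsLocalMin (fun z => profile a b z t - phiReal (Set.range fun t => (a t, b t)) z) y := by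
    filter_upwards [mem_interior_iff_mem_nhds.1 hy.1] with z hz
    rw [h.phiReal_eq, h.phiReal_eq]
    linarith [neg_defect_le (h.mem_domPhi.1 hz) t]
  have h0 := hmin.hasFDerivAt_eq_zero ((hasFDerivAt_profile a b y t).sub hy.2.hasFDerivAt)
  rw [classicalGrad, ← sub_eq_zero.1 h0, gradForm_apply, gradForm_apply]
  simp

/-- The open rectangle spanned by the ranges of the coordinates. -/
def openBox (a b : ℝ → ℝ) : Set (ℝ × ℝ) :=
  {z | (∃ s, a s < z.1) ∧ (∃ s, z.1 < a s) ∧ (∃ s, b s < z.2) ∧ ∃ s, z.2 < b s}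

theorem isOpen_openBox (a b : ℝ → ℝ) : IsOpen (openBox a b) := by
  have : openBox a b = (⋃ s, {z | a s < z.1}) ∩ ((⋃ s, {z | z.1 < a s}) ∩
      ((⋃ s, {z | b s < z.2}) ∩ ⋃ s, {z | z.2 < b s})) := by
    ext z; simp [openBox]
  rw [this]
  refine (isOpen_iUnion fun s => isOpen_lt ?_ ?_).inter ((isOpen_iUnion fun s => isOpen_lt ?_ ?_).inter
    ((isOpen_iUnion fun s => isOpen_lt ?_ ?_).inter (isOpen_iUnion fun s => isOpen_lt ?_ ?_))) <;>
  fun_prop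

theorem convex_openBox (h : IsPair a b) : Convex ℝ (openBox a b) := by
  rintro x ⟨⟨s1, x1⟩, ⟨s2, x2⟩, ⟨s3, x3⟩, s4, x4⟩ z ⟨⟨r1, z1⟩, ⟨r2, z2⟩, ⟨r3, z3⟩, r4, z4⟩
    α β hα hβ hαβ
  have e : ∀ u : ℝ, u = α * u + β * u := fun u => by rw [← add_mul, hαβ, one_mul]
  have key : ∀ {u v w w' : ℝ}, u < w → v < w' → ∀ {m : ℝ}, (w ≤ m) → (w' ≤ m) →
      α * u + β * v < m := by
    intro u v w w' h1 h2 m h3 h4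
    rw [e m]
    rcases hα.eq_or_lt with h0 | h0
    · have : 0 < β := by linarith
      rw [← h0]; nlinarith
    · nlinarith
  have key' : ∀ {u v w w' : ℝ}, w < u → w' < v → ∀ {m : ℝ}, (m ≤ w) → (m ≤ w') →
      m < α * u + β * v := by
    intro u v w w' h1 h2 m h3 h4
    have := key (neg_lt_neg h1) (neg_lt_neg h2) (neg_le_neg h3) (neg_le_neg h4)
    linarith
  simp only [openBox, Set.mem_ofPred_eq, Prod.fst_add, Prod.snd_add, Prod.smul_fst, Prod.smul_snd,
    smul_eq_mul]
  exact ⟨⟨min s1 r1, key' x1 z1 (h.mono_fst (min_le_left _ _)) (h.mono_fst (min_le_right _ _))⟩,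
    ⟨max s2 r2, key x2 z2 (h.mono_fst (le_max_left _ _)) (h.mono_fst (le_max_right _ _))⟩,
    ⟨min s3 r3, key' x3 z3 (h.mono_snd (min_le_left _ _)) (h.mono_snd (min_le_right _ _))⟩,
    ⟨max s4 r4, key x4 z4 (h.mono_snd (le_max_left _ _)) (h.mono_snd (le_max_right _ _))⟩⟩

theorem IsPair.defect_lt_top_of_mem_openBox (h : IsPair a b) (hz : z ∈ openBox a b) :
    defect a b z < ⊤ := by
  obtain ⟨⟨s1, x1⟩, ⟨s2, x2⟩, ⟨s3, x3⟩, s4, x4⟩ := hz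
  obtain ⟨C, hC⟩ := isCompact_Icc.exists_bound_of_continuousOn (s := Set.Icc (min s1 s3) (max s2 s4))
    (h.continuous_profile z).continuousOn
  refine (h.defect_le (c := max C 0) fun t => ?_).1
  have hC0 := le_max_left C 0
  have h00 := le_max_right C 0
  by_cases h1 : t < min s1 s3
  · have k1 := h.mono_fst (h1.le.trans (min_le_left _ _))
    have k2 := h.mono_snd (h1.le.trans (min_le_right _ _))
    rw [profile]; nlinarith
  by_cases h2 : max s2 s4 < t
  · have k1 := h.mono_fst ((le_max_left _ _).trans h2.le)
    have k2 := h.mono_snd ((le_max_right _ _).trans h2.le)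
    rw [profile]; nlinarith
  have := hC t ⟨not_lt.1 h1, not_lt.1 h2⟩
  rw [Real.norm_eq_abs] at this
  linarith [(abs_le.1 this).1]

theorem IsPair.mem_closure_openBox (h : IsPair a b) (hy : defect a b y < ⊤)
    (hE : y ∉ segs a b) : y ∈ closure (openBox a b) := by
  have hconst : ∀ {a b : ℝ → ℝ}, IsPair a b → ∀ {y : ℝ × ℝ}, defect a b y < ⊤ → y ∉ segs a b →
      ∃ s t, a s < a t := by
    intro a b h y hy hE
    by_contra! hc
    have hc' : ∀ s, a s = a 0 := fun s => le_antisymm (hc 0 s) (hc s 0)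
    have h1 : y.1 = a 0 := le_antisymm (h.fst_le_of_forall_le hy fun t => (hc' t).le)
      (h.le_fst_of_forall_le hy fun t => (hc' t).ge)
    refine hE ⟨y.1 + y.2 + 1, y.1 + y.2, by linarith, ?_, Or.inl ((hc' _).trans (hc' _).symm)⟩
    have := h.add_eq (y.1 + y.2)
    have := hc' (y.1 + y.2)
    ext <;> simp only <;> linarith
  obtain ⟨s1, s2, h12⟩ := hconst h hy hE
  obtain ⟨s3, s4, h34⟩ := hconst h.swap (y := y.swap) (by rwa [defect_swap])
    (by rwa [swap_mem_segs])
  set z : ℝ × ℝ := ((a s1 + a s2) / 2, (b s3 + b s4) / 2) with hz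
  have hmem : ∀ θ : ℝ, 0 < θ → θ ≤ 1 →
      (y.1 + θ * (z.1 - y.1), y.2 + θ * (z.2 - y.2)) ∈ openBox a b := by
    intro θ h0 h1
    have zc1 : z.1 = (a s1 + a s2) / 2 := rfl
    have zc2 : z.2 = (b s3 + b s4) / 2 := rfl
    refine ⟨?_, ?_, ?_, ?_⟩
    · by_contra! hc
      have := h.le_fst_of_forall_le hy hc
      have := hc s1
      simp only at *
      nlinarith
    · by_contra! hc
      have := h.fst_le_of_forall_le hy hc
      have := hc s2
      simp only at *
      nlinarith
    · by_contra! hc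
      have := h.le_snd_of_forall_le hy hc
      have := hc s3
      simp only at *
      nlinarith
    · by_contra! hc
      have := h.snd_le_of_forall_le hy hc
      have := hc s4
      simp only at *
      nlinarith
  have hlim : Tendsto (fun n : ℕ => (y.1 + 1 / ((n : ℝ) + 1) * (z.1 - y.1),
      y.2 + 1 / ((n : ℝ) + 1) * (z.2 - y.2))) atTop (𝓝 y) := by
    have h1 := tendsto_one_div_add_atTop_nhds_zero_nat (𝕜 := ℝ)
    have := ((h1.mul_const (z.1 - y.1)).const_add y.1).prodMk_nhds
      ((h1.mul_const (z.2 - y.2)).const_add y.2)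
    simpa using this
  refine mem_closure_of_tendsto hlim (Eventually.of_forall fun n => hmem _ (by positivity) ?_)
  rw [div_le_one (by positivity)]
  linarith [n.cast_nonneg (α := ℝ)]

theorem IsPair.convexOn_openBox (h : IsPair a b) :
    ConvexOn ℝ (openBox a b) fun z => z.1 * z.2 + (defect a b z).toReal := by
  refine ⟨convex_openBox h, fun x hx z hz α β hα hβ hαβ => ?_⟩
  have hx' := h.defect_lt_top_of_mem_openBox hx
  have hz' := h.defect_lt_top_of_mem_openBox hz
  simp only [Prod.fst_add, Prod.snd_add, Prod.smul_fst, Prod.smul_snd, smul_eq_mul]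
  have := (h.defect_le (y := α • x + β • z)
    (c := α * (x.1 * x.2 + (defect a b x).toReal) + β * (z.1 * z.2 + (defect a b z).toReal) -
      (α * x.1 + β * z.1) * (α * x.2 + β * z.2)) fun t => by
    have h1 := mul_le_mul_of_nonneg_left (neg_defect_le hx' t) hα
    have h2 := mul_le_mul_of_nonneg_left (neg_defect_le hz' t) hβ
    simp only [profile, Prod.fst_add, Prod.snd_add, Prod.smul_fst, Prod.smul_snd,
      smul_eq_mul] at h1 h2 ⊢
    have hβ' : β = 1 - α := by linarith
    subst hβ'
    nlinarith).2
  linarith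

theorem IsPair.openBox_subset_closure_smoothDom (h : IsPair a b) :
    openBox a b ⊆ closure (smoothDom (Set.range fun t => (a t, b t))) := by
  intro z hz
  have hopen := isOpen_openBox a b
  obtain ⟨K, U, hU, hLip⟩ := h.convexOn_openBox.locallyLipschitzOn hopen hz
  rw [hopen.nhdsWithin_eq hz] at hU
  rw [mem_closure_iff_nhds]
  intro V hV
  obtain ⟨O, hO, hOo, hzO⟩ := mem_nhds_iff.1 (inter_mem (inter_mem hU (hopen.mem_nhds hz)) hV)
  have hae := (hLip.mono fun x hx => (hO hx).1.1).ae_differentiableWithinAt_of_mem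
    (μ := (volume : Measure (ℝ × ℝ)))
  have hpos : (volume : Measure (ℝ × ℝ)) O ≠ 0 := (hOo.measure_pos volume ⟨z, hzO⟩).ne'
  obtain ⟨x, hxO, hx⟩ : ∃ x ∈ O, DifferentiableWithinAt ℝ
      (fun z : ℝ × ℝ => z.1 * z.2 + (defect a b z).toReal) O x := by
    by_contra! hc
    refine hpos (measure_mono_null (fun x hx => ?_) (ae_iff.1 hae))
    simp only [Set.mem_ofPred_eq, Classical.not_imp]
    exact ⟨hx, hc x hx⟩
  refine ⟨x, (hO hxO).2, ?_, ?_⟩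
  · refine interior_mono (fun w hw => ?_) (hopen.interior_eq.symm ▸ (hO hxO).1.2)
    exact h.mem_domPhi.2 (h.defect_lt_top_of_mem_openBox hw)
  · have h1 := hx.differentiableAt (hOo.mem_nhds hxO)
    have h2 : DifferentiableAt ℝ (fun z : ℝ × ℝ => z.1 * z.2) x := by fun_prop
    refine (h2.sub h1).congr_of_eventuallyEq (Eventually.of_forall fun w => ?_)
    simp only [Pi.sub_apply, h.phiReal_eq]; ring

theorem IsPair.hasGrad (h : IsPair a b) (hy : defect a b y < ⊤) (hE : y ∉ segs a b) {t : ℝ}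
    (ht : WellPosed a b y t) :
    HasGrad (Set.range fun t => (a t, b t)) y (y.2 - b t, y.1 - a t) := by
  by_cases hint : y ∈ interior (domPhi (Set.range fun t => (a t, b t)))
  · have hsm : y ∈ smoothDom (Set.range fun t => (a t, b t)) :=
      ⟨hint, (h.hasFDerivAt_phiReal hint ht).differentiableAt⟩
    exact Or.inl ⟨hsm, (h.classicalGrad_eq hsm (h.wellPosed_profile ht)).symm⟩
  refine Or.inr ⟨h.mem_domPhi.2 hy, hint, ?_, ?_⟩
  · have := closure_mono h.openBox_subset_closure_smoothDom (h.mem_closure_openBox hy hE)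
    rwa [closure_closure] at this
  · rw [Metric.tendsto_nhdsWithin_nhds]
    intro ε hε
    obtain ⟨ρ, hρ, H⟩ := h.wellPosed_stable ht (η := ε / 4) (by positivity)
    refine ⟨min ρ (ε / 4), lt_min hρ (by positivity), fun z hz hd => ?_⟩
    have hzd := h.mem_domPhi.1 (interior_subset hz.1)
    rw [dist_eq_norm] at hd
    have d1 : |z.1 - y.1| ≤ ‖z - y‖ := norm_fst_le (z - y)
    have d2 : |z.2 - y.2| ≤ ‖z - y‖ := norm_snd_le (z - y)
    have hdρ := hd.trans_le (min_le_left _ _)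
    have hdε := hd.trans_le (min_le_right _ _)
    obtain ⟨s, hsI, hs⟩ := h.exists_minimizer (y := z) (p := t - ε / 4) (q := t + ε / 4) hρ
      (fun s hs => by
        have := abs_lt.1 (H z hzd (d1.trans_lt hdρ) (d2.trans_lt hdρ) s hs)
        constructor <;> linarith)
    have hst : |s - t| ≤ ε / 4 := abs_le.2 ⟨by linarith [hsI.1], by linarith [hsI.2]⟩
    rw [h.classicalGrad_eq hz hs, Prod.dist_eq, max_lt_iff, Real.dist_eq, Real.dist_eq]
    have k1 := abs_le.1 ((h.abs_sub_le s t).trans hst)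
    have k2 := abs_le.1 ((h.swap.abs_sub_le s t).trans hst)
    have k3 := abs_le.1 (d1.trans hdε.le)
    have k4 := abs_le.1 (d2.trans hdε.le)
    constructor <;> rw [abs_lt] <;> constructor <;> linarith [k1.1, k1.2, k2.1, k2.2, k3.1, k3.2, k4.1, k4.2]

theorem HasGrad.gradPhi_eq {G : Set (ℝ × ℝ)} {p : ℝ × ℝ} (hp : HasGrad G y p) :
    gradPhi G y = p := by
  have hex : ∃ p, HasGrad G y p := ⟨p, hp⟩
  rw [gradPhi, dif_pos hex]
  exact hex.choose_spec.unique hp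

theorem IsPair.Dc_eq (h : IsPair a b) (hy : defect a b y < ⊤) (hE : y ∉ segs a b) {t : ℝ}
    (ht : WellPosed a b y t) : Dc (Set.range fun t => (a t, b t)) y = (a t, b t) := by
  rw [Dc, (h.hasGrad hy hE ht).gradPhi_eq]
  simp

end BackwardTransport

namespace BackwardTransport

variable {a b : ℝ → ℝ} {ν : Measure (ℝ × ℝ)} {τ : ℝ × ℝ → ℝ}

/-! ### The law of the minimizer has no atoms on decreasing curves -/

open Classical in
/-- The transport map: the identity on the segments, the minimizer elsewhere. -/
noncomputable def transport (a b : ℝ → ℝ) (τ : ℝ × ℝ → ℝ) (y : ℝ × ℝ) : ℝ × ℝ :=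
  if y ∈ segs a b then y else (a (τ y), b (τ y))

theorem transport_of_mem {y : ℝ × ℝ} (hy : y ∈ segs a b) : transport a b τ y = y := if_pos hy

theorem transport_of_notMem {y : ℝ × ℝ} (hy : y ∉ segs a b) :
    transport a b τ y = (a (τ y), b (τ y)) := if_neg hy

theorem IsPair.measurable_transport (h : IsPair a b) (hτ : Measurable τ) :
    Measurable (transport a b τ) := by
  classical
  exact Measurable.ite h.measurableSet_segs measurable_id
    ((h.continuous.measurable.comp hτ).prodMk (h.swap.continuous.measurable.comp hτ))

theorem transport_mem_range (a b : ℝ → ℝ) (τ : ℝ × ℝ → ℝ) (y : ℝ × ℝ) :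
    transport a b τ y ∈ Set.range fun t => (a t, b t) := by
  by_cases hy : y ∈ segs a b
  · rw [transport_of_mem hy]
    obtain ⟨-, t, -, rfl, -⟩ := hy
    exact ⟨t, rfl⟩
  · rw [transport_of_notMem hy]; exact ⟨_, rfl⟩

theorem eq_of_notMem_segs {t r : ℝ} (ht : (a t, b t) ∉ segs a b)
    (hr : a r = a t ∨ b r = b t) : r = t := by
  by_contra hne
  exact ht ⟨r, t, hne, rfl, hr⟩

theorem IsPair.chord_through (h : IsPair a b) {t : ℝ} (ht : (a t, b t) ∉ segs a b)
    {y z : ℝ × ℝ} (hy : defect a b y < ⊤) (hz : defect a b z < ⊤)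
    (hyt : profile a b y t ≤ -(defect a b y).toReal)
    (hzt : profile a b z t ≤ -(defect a b z).toReal)
    (hlt : (z.1 - a t) * (y.1 - a t) < 0) :
    (b t - y.2) * (z.1 - y.1) = (z.2 - y.2) * (a t - y.1) := by
  have hne : z.1 - y.1 ≠ 0 := by
    intro e
    have : z.1 = y.1 := by linarith
    rw [this] at hlt
    linarith [mul_self_nonneg (y.1 - a t)]
  set θ := (a t - y.1) / (z.1 - y.1) with hθ
  have e1 : θ * (z.1 - y.1) = a t - y.1 := div_mul_cancel₀ _ hne
  have hθ0 : 0 ≤ θ := by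
    rw [hθ]
    rcases lt_or_gt_of_ne hne with hn | hn
    · exact div_nonneg_of_nonpos (by nlinarith) hn.le
    · exact div_nonneg (by nlinarith) hn.le
  have hθ1 : 0 ≤ 1 - θ := by
    have : 1 - θ = (z.1 - a t) / (z.1 - y.1) := by rw [hθ]; field_simp; ring
    rw [this]
    rcases lt_or_gt_of_ne hne with hn | hn
    · exact div_nonneg_of_nonpos (by nlinarith) hn.le
    · exact div_nonneg (by nlinarith) hn.le
  set w : ℝ × ℝ := (y.1 + θ * (z.1 - y.1), y.2 + θ * (z.2 - y.2)) with hw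
  have hw1 : w.1 = a t := by simp only [hw]; linarith
  have hpos : ∀ s, -0 ≤ profile a b w s := by
    intro s
    have k1 := mul_nonneg hθ1 (sub_nonneg.2 (hyt.trans (neg_defect_le hy s)))
    have k2 := mul_nonneg hθ0 (sub_nonneg.2 (hzt.trans (neg_defect_le hz s)))
    have k3 : profile a b w t = 0 := by rw [profile, hw1, sub_self, zero_mul]
    have k4 : profile a b w s - profile a b w t =
        (1 - θ) * (profile a b y s - profile a b y t) +
        θ * (profile a b z s - profile a b z t) := by
      simp only [hw, profile]; ring
    linarith
  obtain ⟨h1, h2⟩ := h.defect_le hpos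
  have h3 := h.eq_of_defect h1 (le_antisymm h2 ENNReal.toReal_nonneg)
  have h4 : w.1 + w.2 = t := eq_of_notMem_segs ht (Or.inl (by
    rw [← hw1]; exact (congrArg Prod.fst h3).symm))
  rw [h4] at h3
  have h5 : y.2 + θ * (z.2 - y.2) = b t := congrArg Prod.snd h3
  rw [← h5, ← e1]; ring

theorem IsPair.eq_point_of_coord (h : IsPair a b) {t : ℝ} (ht : (a t, b t) ∉ segs a b)
    {y : ℝ × ℝ} (hy : defect a b y < ⊤) (hyt : profile a b y t ≤ -(defect a b y).toReal)
    (hc : y.1 = a t ∨ y.2 = b t) : y = (a t, b t) := by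
  have h0 : profile a b y t = 0 := by
    rcases hc with hc | hc <;> simp [profile, hc]
  have h3 := h.eq_of_defect hy (le_antisymm (by linarith) ENNReal.toReal_nonneg)
  have h4 : y.1 + y.2 = t := eq_of_notMem_segs ht (hc.imp
    (fun e => by rw [← e]; exact (congrArg Prod.fst h3).symm)
    (fun e => by rw [← e]; exact (congrArg Prod.snd h3).symm))
  rwa [h4] at h3

theorem RegularOptPair.null_opposite (S : RegularOptPair ν a b) {t : ℝ}
    (ht : (a t, b t) ∉ segs a b) {y : ℝ × ℝ} (hy : defect a b y < ⊤)
    (hyt : profile a b y t ≤ -(defect a b y).toReal) (hne : y.1 ≠ a t) :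
    ν {z | defect a b z < ⊤ ∧ profile a b z t ≤ -(defect a b z).toReal ∧
      (z.1 - a t) * (y.1 - a t) < 0} = 0 := by
  have h := S.isPair
  have hp : 0 < -((y.2 - b t) * (y.1 - a t)) := by
    have h1 : profile a b y t ≤ 0 := hyt.trans (neg_nonpos.2 ENNReal.toReal_nonneg)
    have h2 : (y.2 - b t) * (y.1 - a t) ≠ 0 := by
      refine mul_ne_zero (fun e => ?_) (sub_ne_zero.2 hne)
      have := h.eq_point_of_coord ht hy hyt (Or.inr (by linarith))
      exact hne (congrArg Prod.fst this)
    rw [profile] at h1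
    have h3 : (y.2 - b t) * (y.1 - a t) ≤ 0 := by linarith
    have := h3.lt_of_ne h2
    linarith
  set m := -(y.2 - b t) / (y.1 - a t) with hm
  have hd : y.1 - a t ≠ 0 := sub_ne_zero.2 hne
  have hm0 : 0 < m := by
    have : m = -((y.2 - b t) * (y.1 - a t)) / (y.1 - a t) ^ 2 := by rw [hm]; field_simp
    rw [this]; positivity
  have hline : ∀ z : ℝ × ℝ, (defect a b z < ⊤ ∧ profile a b z t ≤ -(defect a b z).toReal ∧
      (z.1 - a t) * (y.1 - a t) < 0) → z.2 = b t - m * (z.1 - a t) := by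
    rintro z ⟨hz1, hz2, hz3⟩
    have := h.chord_through ht hy hz1 hyt hz2 hz3
    rw [hm]
    field_simp
    linarith
  refine S.null (max 1 (max m m⁻¹)) (le_max_left _ _) _ fun z hz z' hz' => ?_
  have e : z.2 - z'.2 = -(m * (z.1 - z'.1)) := by rw [hline z hz, hline z' hz']; ring
  refine ⟨?_, ?_, ?_⟩
  · rw [e]; nlinarith [mul_self_nonneg (z.1 - z'.1)]
  · rw [e, abs_neg, abs_mul, abs_of_pos hm0]
    calc |z.1 - z'.1| = m⁻¹ * (m * |z.1 - z'.1|) := by field_simp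
      _ ≤ _ := by gcongr; exact (le_max_right _ _).trans (le_max_right _ _)
  · rw [e, abs_neg, abs_mul, abs_of_pos hm0]
    gcongr
    exact (le_max_left _ _).trans (le_max_right _ _)

theorem RegularOptPair.measure_fiber_eq_zero (S : RegularOptPair ν a b)
    (T : RegularOptPair.Selection ν a b τ) {t : ℝ} (ht : (a t, b t) ∉ segs a b) :
    ν.restrict (segs a b)ᶜ (τ ⁻¹' {t}) = 0 := by
  have h := S.isPair
  have hEm := h.measurableSet_segs.compl
  set A := τ ⁻¹' {t} with hA
  have hAm : MeasurableSet A := T.measurable (measurableSet_singleton t)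
  set ρ := ν.restrict (segs a b)ᶜ with hρ
  set μ := ρ.restrict A with hμ
  have hgood : ∀ᵐ y ∂μ, defect a b y < ⊤ ∧ profile a b y t ≤ -(defect a b y).toReal := by
    rw [hμ, ae_restrict_iff' hAm, hρ, ae_restrict_iff' hEm]
    filter_upwards [T.wellPosed] with y hy hyE hyA
    obtain ⟨h1, h2⟩ := hy hyE
    have : τ y = t := hyA
    rw [this] at h2
    exact ⟨h1, h.wellPosed_profile h2⟩
  have habs : ∀ p : ℝ × ℝ → Prop, (∀ᵐ y ∂ν, p y) → ∀ᵐ y ∂μ, p y := fun p hp =>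
    ae_restrict_of_ae (ae_restrict_of_ae hp)
  have hne : ∀ᵐ y ∂μ, y.1 ≠ a t := by
    have hsing : ν {(a t, b t)} = 0 := S.null_of_subsingleton Set.subsingleton_singleton
    filter_upwards [hgood, habs _ (measure_eq_zero_iff_ae_notMem.1 hsing)] with y h1 h2 h3
    exact h2 (h.eq_point_of_coord ht h1.1 h1.2 (Or.inl h3))
  have hi : Integrable (fun y : ℝ × ℝ => y.1 - a t) μ := by
    have := S.isProb
    exact S.integrable_fst.restrict.restrict.sub (integrable_const _)
  have hzero : ∫ y, (y.1 - a t) ∂μ = 0 := by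
    have := S.isProb
    have e := S.setIntegral_eq T (measurableSet_singleton t)
    have e2 : ∫ y in τ ⁻¹' {t}, a (τ y) ∂ρ = ∫ y in τ ⁻¹' {t}, a t ∂ρ :=
      setIntegral_congr_fun hAm fun y hy => by rw [show τ y = t from hy]
    rw [integral_sub S.integrable_fst.restrict.restrict (integrable_const _), sub_eq_zero]
    exact e.symm.trans e2
  have hcontra : (∀ᵐ y ∂μ, y.1 = a t) → ρ A = 0 := by
    intro hae
    have hF : ∀ᵐ y ∂μ, False := by
      filter_upwards [hae, hne] with y h1 h2 using h2 h1
    have hbot : ae μ = ⊥ := by simpa using hF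
    rw [ae_eq_bot] at hbot
    rwa [hμ, Measure.restrict_eq_zero] at hbot
  by_cases hex : ∃ y : ℝ × ℝ, defect a b y < ⊤ ∧ profile a b y t ≤ -(defect a b y).toReal ∧
      y.1 < a t
  · obtain ⟨y, hy1, hy2, hy3⟩ := hex
    have hnull := S.null_opposite ht hy1 hy2 hy3.ne
    have hle : ∀ᵐ z ∂μ, 0 ≤ -(z.1 - a t) := by
      filter_upwards [hgood, habs _ (measure_eq_zero_iff_ae_notMem.1 hnull)] with z h1 h2
      by_contra! hc
      exact h2 ⟨h1.1, h1.2, by nlinarith⟩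
    have h0 := (integral_eq_zero_iff_of_nonneg_ae hle hi.neg).1 (by
      rw [integral_neg, hzero, neg_zero])
    refine hcontra ?_
    filter_upwards [h0] with z hz
    simp only [Pi.zero_apply] at hz
    linarith
  · push Not at hex
    have hle : ∀ᵐ z ∂μ, 0 ≤ z.1 - a t := by
      filter_upwards [hgood] with z h1
      linarith [hex z h1.1 h1.2]
    have h0 := (integral_eq_zero_iff_of_nonneg_ae hle hi).1 hzero
    refine hcontra ?_
    filter_upwards [h0] with z hz
    simp only [Pi.zero_apply] at hz
    linarith

theorem RegularOptPair.measure_transport_fiber (S : RegularOptPair ν a b)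
    (T : RegularOptPair.Selection ν a b τ) (x : ℝ × ℝ) :
    ν (transport a b τ ⁻¹' {x}) = 0 := by
  have h := S.isPair
  have hsing : ν {x} = 0 := S.null_of_subsingleton Set.subsingleton_singleton
  by_cases hx : x ∈ Set.range fun t => (a t, b t)
  swap
  · have : transport a b τ ⁻¹' {x} = ∅ := by
      ext y
      simp only [Set.mem_preimage, Set.mem_singleton_iff, Set.mem_empty_iff_false, iff_false]
      rintro rfl
      exact hx (transport_mem_range a b τ y)
    rw [this, measure_empty]
  obtain ⟨t, rfl⟩ := hx
  have hfib : ∀ᵐ y ∂ν, y ∉ segs a b → τ y ≠ t := by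
    by_cases ht : (a t, b t) ∈ segs a b
    · filter_upwards [S.ae_mem_strictParams, T.wellPosed] with y h1 h2 hy e
      have h3 := h1 hy _ (h2 hy).2
      obtain ⟨s, r, hsr, hr, hor⟩ := ht
      have htr : t = r := by
        rw [← h.add_eq t, ← h.add_eq r]
        exact congrArg (fun p : ℝ × ℝ => p.1 + p.2) hr
      rw [e, htr] at h3
      obtain ⟨k1, k2⟩ := h3 s hsr
      exact hor.elim k1 k2
    · have := measure_eq_zero_iff_ae_notMem.1 (S.measure_fiber_eq_zero T ht)
      rwa [ae_restrict_iff' h.measurableSet_segs.compl] at this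
  rw [measure_eq_zero_iff_ae_notMem]
  filter_upwards [hfib, measure_eq_zero_iff_ae_notMem.1 hsing] with y h1 h2 h3
  by_cases hy : y ∈ segs a b
  · have h4 : transport a b τ y = (a t, b t) := h3
    rw [transport_of_mem hy] at h4
    exact h2 h4
  · have h4 : transport a b τ y = (a t, b t) := h3
    rw [transport_of_notMem hy] at h4
    refine h1 hy ?_
    rw [← h.add_eq (τ y), ← h.add_eq t]
    exact congrArg (fun p : ℝ × ℝ => p.1 + p.2) h4

theorem RegularOptPair.isDRegular_map_transport (S : RegularOptPair ν a b)
    (T : RegularOptPair.Selection ν a b τ) : IsDRegular (ν.map (transport a b τ)) := by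
  have h := S.isPair
  have hTm := h.measurable_transport T.measurable
  rintro D ⟨I, f, K, -, -, -, hK, hf, rfl⟩
  set R := Set.range fun t => (a t, b t) with hR
  have hsub : ((fun t => (t, f t)) '' I ∩ R).Subsingleton := by
    rintro x ⟨⟨s, hs, rfl⟩, hx⟩ z ⟨⟨t, ht, rfl⟩, hz⟩
    have hmon := h.isMaximalMonotone.1 _ hx _ hz
    simp only [cost] at hmon
    rcases lt_trichotomy s t with hlt | rfl | hlt
    · have := (hf s hs t ht hlt).1
      have h1 : 0 < 1 / K * (t - s) := mul_pos (by positivity) (by linarith)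
      nlinarith
    · rfl
    · have := (hf t ht s hs hlt).1
      have h1 : 0 < 1 / K * (s - t) := mul_pos (by positivity) (by linarith)
      nlinarith
  have hsingle : ∀ x, ν.map (transport a b τ) {x} = 0 := fun x => by
    rw [Measure.map_apply hTm (measurableSet_singleton x)]
    exact S.measure_transport_fiber T x
  have hRae : ∀ᵐ x ∂(ν.map (transport a b τ)), x ∈ R := by
    have hRm : MeasurableSet R := by
      have : R = {y | a (y.1 + y.2) = y.1 ∧ b (y.1 + y.2) = y.2} := by
        ext y
        constructor
        · rintro ⟨t, rfl⟩; simp [h.add_eq]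
        · rintro ⟨h1, h2⟩; exact ⟨y.1 + y.2, Prod.ext h1 h2⟩
      rw [this]
      have hs : Measurable fun y : ℝ × ℝ => y.1 + y.2 := by fun_prop
      exact (measurableSet_eq_fun (h.continuous.measurable.comp hs) measurable_fst).inter
        (measurableSet_eq_fun (h.swap.continuous.measurable.comp hs) measurable_snd)
    exact (ae_map_iff hTm.aemeasurable hRm).2
      (Eventually.of_forall fun y => transport_mem_range a b τ y)
  rw [measure_eq_zero_iff_ae_notMem]
  rcases hsub.eq_empty_or_singleton with hemp | ⟨x, hx⟩
  · filter_upwards [hRae] with z hz hzD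
    have : z ∈ (fun t => (t, f t)) '' I ∩ R := ⟨hzD, hz⟩
    rw [hemp] at this; exact this
  · filter_upwards [hRae, measure_eq_zero_iff_ae_notMem.1 (hsingle x)] with z hz hzx hzD
    have : z ∈ (fun t => (t, f t)) '' I ∩ R := ⟨hzD, hz⟩
    rw [hx] at this; exact hzx this

end BackwardTransport

namespace BackwardTransport

variable {a b : ℝ → ℝ} {τ : ℝ × ℝ → ℝ}

/-! ### Weak duality -/

theorem integral_mul_sub_eq_zero {Ω : Type*} {m : MeasurableSpace Ω} [mΩ : MeasurableSpace Ω] {P : Measure Ω}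
    [IsProbabilityMeasure P] (hm : m ≤ mΩ) {U V W : Ω → ℝ} (hU : Measurable[m] U)
    (hU2 : MemLp U 2 P) (hV2 : MemLp V 2 P) (hW2 : MemLp W 2 P) (hVW : P[V | m] =ᵐ[P] W) :
    ∫ ω, U ω * (W ω - V ω) ∂P = 0 := by
  have hUV : Integrable (U * V) P := hU2.integrable_mul hV2
  have hUW : Integrable (U * W) P := hU2.integrable_mul hW2
  have h1 := condExp_mul_of_stronglyMeasurable_left (μ := P) hU.stronglyMeasurable hUV
    (hV2.integrable one_le_two)
  have h2 : ∫ ω, (U * V) ω ∂P = ∫ ω, (U * W) ω ∂P := by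
    rw [← integral_condExp hm]
    refine integral_congr_ae ?_
    filter_upwards [h1, hVW] with ω k1 k2
    rw [k1, Pi.mul_apply, Pi.mul_apply, k2]
  have h3 := integral_sub hUW hUV
  rw [← h2, sub_self] at h3
  rw [← h3]
  exact integral_congr_ae (Eventually.of_forall fun ω => by simp only [Pi.mul_apply]; ring)

theorem integrable_cost {Ω : Type*} [MeasurableSpace Ω] {P : Measure Ω} {X Y : Ω → ℝ × ℝ}
    (hX2 : MemLp X 2 P) (hY2 : MemLp Y 2 P) :
    Integrable (fun ω => cost (X ω) (Y ω)) P :=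
  (hX2.fst.sub hY2.fst).integrable_mul (hX2.snd.sub hY2.snd)

section Duality

variable {Ω : Type*} [MeasurableSpace Ω] {P : Measure Ω} [IsProbabilityMeasure P]
  {X Y : Ω → ℝ × ℝ}

theorem IsPair.memLp_comp (h : IsPair a b) {z : Ω → ℝ} (hz : MemLp z 2 P) :
    MemLp (fun ω => a (z ω)) 2 P := by
  refine MemLp.of_le ((memLp_const |a 0|).add hz.norm)
    (h.continuous.comp_aestronglyMeasurable hz.1) (Eventually.of_forall fun ω => ?_)
  have := h.abs_sub_le (z ω) 0
  rw [sub_zero] at this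
  simp only [Pi.add_apply, Real.norm_eq_abs]
  rw [abs_of_nonneg (by positivity : 0 ≤ |a 0| + |z ω|)]
  have e : a (z ω) = (a (z ω) - a 0) + a 0 := by ring
  rw [e]
  exact (abs_add_le _ _).trans (by linarith)

theorem IsPair.integral_cost_eq (h : IsPair a b) (hX : Measurable X) (hX2 : MemLp X 2 P)
    (hY2 : MemLp Y 2 P)
    (hm : P[Y | MeasurableSpace.comap X inferInstance] =ᵐ[P] X) :
    Integrable (fun ω => (a ((X ω).1 + (X ω).2) - (X ω).1) ^ 2) P ∧
    Integrable (fun ω => profile a b (Y ω) ((X ω).1 + (X ω).2)) P ∧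
    ∫ ω, cost (X ω) (Y ω) ∂P = ∫ ω, profile a b (Y ω) ((X ω).1 + (X ω).2) ∂P +
      ∫ ω, (a ((X ω).1 + (X ω).2) - (X ω).1) ^ 2 ∂P := by
  have hle : MeasurableSpace.comap X inferInstance ≤ (inferInstance : MeasurableSpace Ω) :=
    hX.comap_le
  have hYi : Integrable Y P := hY2.integrable one_le_two
  have c1 : P[fun ω => (Y ω).1 | MeasurableSpace.comap X inferInstance] =ᵐ[P]
      fun ω => (X ω).1 := by
    filter_upwards [(ContinuousLinearMap.fst ℝ ℝ ℝ).comp_condExp_comm (m :=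
      MeasurableSpace.comap X inferInstance) hYi, hm] with ω k1 k2
    rw [Function.comp_apply, k2] at k1
    exact k1.symm
  have c2 : P[fun ω => (Y ω).2 | MeasurableSpace.comap X inferInstance] =ᵐ[P]
      fun ω => (X ω).2 := by
    filter_upwards [(ContinuousLinearMap.snd ℝ ℝ ℝ).comp_condExp_comm (m :=
      MeasurableSpace.comap X inferInstance) hYi, hm] with ω k1 k2
    rw [Function.comp_apply, k2] at k1
    exact k1.symm
  have hz2 : MemLp (fun ω => (X ω).1 + (X ω).2) 2 P := hX2.fst.add hX2.snd
  have ha2 := h.memLp_comp hz2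
  have hU2 : MemLp (fun ω => a ((X ω).1 + (X ω).2) - (X ω).1) 2 P := ha2.sub hX2.fst
  have hUm : Measurable[MeasurableSpace.comap X inferInstance]
      fun ω => a ((X ω).1 + (X ω).2) - (X ω).1 := by
    have : Measurable fun x : ℝ × ℝ => a (x.1 + x.2) - x.1 :=
      (h.continuous.measurable.comp (by fun_prop)).sub measurable_fst
    exact this.comp (comap_measurable X)
  have z1 := integral_mul_sub_eq_zero hle hUm hU2 hY2.snd hX2.snd c2
  have z2 := integral_mul_sub_eq_zero hle hUm hU2 hY2.fst hX2.fst c1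
  have hsq : Integrable (fun ω => (a ((X ω).1 + (X ω).2) - (X ω).1) ^ 2) P := hU2.integrable_sq
  have i1 : Integrable (fun ω => (a ((X ω).1 + (X ω).2) - (X ω).1) * ((X ω).2 - (Y ω).2)) P :=
    hU2.integrable_mul (hX2.snd.sub hY2.snd)
  have i2 : Integrable (fun ω => (a ((X ω).1 + (X ω).2) - (X ω).1) * ((X ω).1 - (Y ω).1)) P :=
    hU2.integrable_mul (hX2.fst.sub hY2.fst)
  have hc := integrable_cost hX2 hY2
  have hprof : ∀ ω, profile a b (Y ω) ((X ω).1 + (X ω).2) = cost (X ω) (Y ω) +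
      (a ((X ω).1 + (X ω).2) - (X ω).1) * ((X ω).2 - (Y ω).2) -
      (a ((X ω).1 + (X ω).2) - (X ω).1) * ((X ω).1 - (Y ω).1) -
      (a ((X ω).1 + (X ω).2) - (X ω).1) ^ 2 := by
    intro ω
    have e : b ((X ω).1 + (X ω).2) = (X ω).1 + (X ω).2 - a ((X ω).1 + (X ω).2) := by
      linarith [h.add_eq ((X ω).1 + (X ω).2)]
    rw [profile, e, cost]; ring
  refine ⟨hsq, ?_, ?_⟩
  · exact (((hc.add i1).sub i2).sub hsq).congr (Eventually.of_forall fun ω => (hprof ω).symm)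
  · have i3 := hc.add i1
    have i4 := i3.sub i2
    have e1 := integral_sub i4 hsq
    have e2 := integral_sub i3 i2
    have e3 := integral_add hc i1
    have e4 := integral_congr_ae (μ := P) (Eventually.of_forall hprof)
    simp only [Pi.add_apply, Pi.sub_apply] at e1 e2 e3
    rw [e4, e1, e2, e3, z1, z2]; ring

/-- Weak duality, with the case of equality. -/
theorem IsPair.weak_duality (h : IsPair a b) (hX : Measurable X) (hX2 : MemLp X 2 P)
    (hY2 : MemLp Y 2 P) (hm : P[Y | MeasurableSpace.comap X inferInstance] =ᵐ[P] X)
    (hdom : ∀ᵐ ω ∂P, defect a b (Y ω) < ⊤)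
    (hint : Integrable (fun ω => (defect a b (Y ω)).toReal) P) :
    -∫ ω, (defect a b (Y ω)).toReal ∂P ≤ ∫ ω, cost (X ω) (Y ω) ∂P ∧
    (∫ ω, cost (X ω) (Y ω) ∂P ≤ -∫ ω, (defect a b (Y ω)).toReal ∂P → ∀ᵐ ω ∂P, ∃ t,
      X ω = (a t, b t) ∧ profile a b (Y ω) t ≤ -(defect a b (Y ω)).toReal) := by
  obtain ⟨i1, i2, e⟩ := h.integral_cost_eq hX hX2 hY2 hm
  have i3 := i2.add hint
  have hnn : ∀ᵐ ω ∂P, 0 ≤ profile a b (Y ω) ((X ω).1 + (X ω).2) + (defect a b (Y ω)).toReal := by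
    filter_upwards [hdom] with ω hω
    linarith [neg_defect_le hω ((X ω).1 + (X ω).2)]
  have h1 : ∫ ω, (profile a b (Y ω) ((X ω).1 + (X ω).2) + (defect a b (Y ω)).toReal) ∂P =
      _ := integral_add i2 hint
  have h2 := integral_nonneg_of_ae hnn
  have h3 : 0 ≤ ∫ ω, (a ((X ω).1 + (X ω).2) - (X ω).1) ^ 2 ∂P :=
    integral_nonneg fun ω => sq_nonneg _
  refine ⟨by linarith, fun hle => ?_⟩
  have k1 := (integral_eq_zero_iff_of_nonneg_ae hnn i3).1 (by linarith)
  have k2 := (integral_eq_zero_iff_of_nonneg_ae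
    (Eventually.of_forall fun ω => sq_nonneg (a ((X ω).1 + (X ω).2) - (X ω).1)) i1).1 (by linarith)
  filter_upwards [k1, k2] with ω l1 l2
  simp only [Pi.zero_apply, pow_eq_zero_iff, ne_eq, OfNat.ofNat_ne_zero,
    not_false_eq_true] at l1 l2
  refine ⟨(X ω).1 + (X ω).2, ?_, by linarith⟩
  have := h.add_eq ((X ω).1 + (X ω).2)
  ext <;> simp only <;> linarith

theorem isPlan_map (hX : Measurable X) (hY : Measurable Y) (hX2 : MemLp X 2 P)
    (hY2 : MemLp Y 2 P) (hm : P[Y | MeasurableSpace.comap X inferInstance] =ᵐ[P] X) :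
    IsPlan (P.map Y) (P.map fun ω => (X ω, Y ω)) := by
  have hXY : Measurable fun ω => (X ω, Y ω) := hX.prodMk hY
  have hprob : IsProbabilityMeasure (P.map fun ω => (X ω, Y ω)) :=
    Measure.isProbabilityMeasure_map hXY.aemeasurable
  have hmem : MemLp id 2 (P.map fun ω => (X ω, Y ω)) :=
    (memLp_map_measure_iff aestronglyMeasurable_id hXY.aemeasurable).2 (MemLp.of_fst_snd ⟨hX2, hY2⟩)
  refine ⟨hprob, hmem, ?_, ?_⟩
  · rw [Measure.map_map measurable_snd hXY]; rfl
  · symm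
    have i1 : Integrable (Prod.fst : (ℝ × ℝ) × (ℝ × ℝ) → ℝ × ℝ) (P.map fun ω => (X ω, Y ω)) :=
      hmem.fst.integrable one_le_two
    have i2 : Integrable (Prod.snd : (ℝ × ℝ) × (ℝ × ℝ) → ℝ × ℝ) (P.map fun ω => (X ω, Y ω)) :=
      hmem.snd.integrable one_le_two
    refine ae_eq_condExp_of_forall_setIntegral_eq measurable_fst.comap_le i2
      (fun s _ _ => i1.integrableOn) ?_
      (comap_measurable Prod.fst).stronglyMeasurable.aestronglyMeasurable
    rintro s ⟨B, hB, rfl⟩ -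
    rw [setIntegral_map (measurable_fst hB) i1.1 hXY.aemeasurable,
      setIntegral_map (measurable_fst hB) i2.1 hXY.aemeasurable]
    change ∫ ω in X ⁻¹' B, X ω ∂P = ∫ ω in X ⁻¹' B, Y ω ∂P
    rw [← setIntegral_condExp hX.comap_le (hY2.integrable one_le_two) ⟨B, hB, rfl⟩]
    exact integral_congr_ae (ae_restrict_of_ae (hm.mono fun ω h => h.symm))

end Duality

/-! ### The transport map is a backward martingale map -/

variable {ν : Measure (ℝ × ℝ)}

theorem RegularOptPair.memLp_fst_transport (S : RegularOptPair ν a b)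
    (T : RegularOptPair.Selection ν a b τ) : MemLp (fun y => (transport a b τ y).1) 2 ν := by
  have h := S.isPair
  have hm := h.measurable_transport T.measurable
  have hE := h.measurableSet_segs
  rw [memLp_two_iff_integrable_sq hm.fst.aestronglyMeasurable, ← integrableOn_univ,
    ← Set.union_compl_self (segs a b), integrableOn_union]
  constructor
  · refine S.integrable_fst_sq.integrableOn.congr_fun (fun y hy => ?_) hE
    simp only [transport_of_mem hy]
  · refine IntegrableOn.congr_fun (S.integrable_sq T) (fun y hy => ?_) hE.compl
    simp only [transport_of_notMem hy]

theorem transport_swap {y : ℝ × ℝ} :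
    transport b a (τ ∘ Prod.swap) y.swap = (transport a b τ y).swap := by
  by_cases hy : y ∈ segs a b
  · rw [transport_of_mem hy, transport_of_mem (swap_mem_segs.2 hy)]
  · rw [transport_of_notMem hy, transport_of_notMem (fun h => hy (swap_mem_segs.1 h))]
    simp

theorem RegularOptPair.memLp_transport (S : RegularOptPair ν a b)
    (T : RegularOptPair.Selection ν a b τ) : MemLp (transport a b τ) 2 ν := by
  refine MemLp.of_fst_snd ⟨S.memLp_fst_transport T, ?_⟩
  have h1 := S.swap.memLp_fst_transport T.swap
  have := h1.comp_of_map measurable_swap.aemeasurable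
  refine this.congr_norm ?_ (Eventually.of_forall fun y => ?_)
  · exact (S.isPair.measurable_transport T.measurable).snd.aestronglyMeasurable
  · simp [transport_swap]

theorem RegularOptPair.setIntegral_fst_transport (S : RegularOptPair ν a b)
    (T : RegularOptPair.Selection ν a b τ) {B : Set (ℝ × ℝ)} (hB : MeasurableSet B) :
    ∫ y in transport a b τ ⁻¹' B, (transport a b τ y).1 ∂ν =
      ∫ y in transport a b τ ⁻¹' B, y.1 ∂ν := by
  have := S.isProb
  have h := S.isPair
  have hm := h.measurable_transport T.measurable
  have hE := h.measurableSet_segs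
  have hg : Measurable fun t => (a t, b t) :=
    h.continuous.measurable.prodMk h.swap.continuous.measurable
  have i1 : Integrable (fun y => (transport a b τ y).1) ν :=
    (S.memLp_fst_transport T).integrable one_le_two
  have i2 := S.integrable_fst
  have hsplit : ∀ f : ℝ × ℝ → ℝ, Integrable f ν → ∫ y in transport a b τ ⁻¹' B, f y ∂ν =
      ∫ y in transport a b τ ⁻¹' B ∩ segs a b, f y ∂ν +
      ∫ y in transport a b τ ⁻¹' B ∩ (segs a b)ᶜ, f y ∂ν := fun f hf =>
    (integral_inter_add_sdiff hE hf.integrableOn).symm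
  rw [hsplit _ i1, hsplit _ i2]
  congr 1
  · refine setIntegral_congr_fun ((hm hB).inter hE) fun y hy => ?_
    simp only [transport_of_mem hy.2]
  · have hset : transport a b τ ⁻¹' B ∩ (segs a b)ᶜ =
        τ ⁻¹' ((fun t => (a t, b t)) ⁻¹' B) ∩ (segs a b)ᶜ := by
      ext y
      refine and_congr_left fun hy => ?_
      simp only [Set.mem_preimage, transport_of_notMem hy]
    have hm' := T.measurable (hg hB)
    rw [hset]
    have e := S.setIntegral_eq T (hg hB)
    rw [Measure.restrict_restrict hm'] at e
    rw [← e]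
    refine setIntegral_congr_fun (hm'.inter hE.compl) fun y hy => ?_
    simp only [transport_of_notMem hy.2]

theorem RegularOptPair.setIntegral_transport (S : RegularOptPair ν a b)
    (T : RegularOptPair.Selection ν a b τ) {B : Set (ℝ × ℝ)} (hB : MeasurableSet B) :
    ∫ y in transport a b τ ⁻¹' B, transport a b τ y ∂ν =
      ∫ y in transport a b τ ⁻¹' B, y ∂ν := by
  have := S.isProb
  have hm := S.isPair.measurable_transport T.measurable
  have i1 : Integrable (transport a b τ) ν := (S.memLp_transport T).integrable one_le_two
  have i3 : Integrable (fun y : ℝ × ℝ => y.2) ν := by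
    have := S.swap.integrable_fst.comp_measurable measurable_swap
    exact this
  have i2 : Integrable (fun y : ℝ × ℝ => y) ν := S.integrable_fst.prodMk i3
  refine Prod.ext ?_ ?_
  · rw [fst_integral i1.integrableOn, fst_integral i2.integrableOn]
    exact S.setIntegral_fst_transport T hB
  · rw [snd_integral i1.integrableOn, snd_integral i2.integrableOn]
    have hm2 := S.swap.isPair.measurable_transport T.swap.measurable
    have hB2 : MeasurableSet (Prod.swap ⁻¹' B : Set (ℝ × ℝ)) := measurable_swap hB
    have e := S.swap.setIntegral_fst_transport T.swap hB2
    rw [setIntegral_map (hm2 hB2) hm2.fst.aestronglyMeasurable measurable_swap.aemeasurable,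
      setIntegral_map (hm2 hB2) measurable_fst.aestronglyMeasurable
        measurable_swap.aemeasurable] at e
    have hset : Prod.swap ⁻¹' (transport b a (τ ∘ Prod.swap) ⁻¹' (Prod.swap ⁻¹' B)) =
        transport a b τ ⁻¹' B := by
      ext y
      simp only [Set.mem_preimage, transport_swap, Prod.swap_swap]
    rw [hset] at e
    simpa only [transport_swap, Prod.fst_swap] using e

theorem RegularOptPair.ae_cost_transport (S : RegularOptPair ν a b)
    (T : RegularOptPair.Selection ν a b τ) :
    ∀ᵐ y ∂ν, cost (transport a b τ y) y = -(defect a b y).toReal := by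
  have h := S.isPair
  filter_upwards [T.wellPosed] with y hy
  by_cases hE : y ∈ segs a b
  · rw [transport_of_mem hE]
    obtain ⟨-, t, -, rfl, -⟩ := hE
    simp [cost, h.defect_eq_zero]
  · obtain ⟨h1, h2⟩ := hy hE
    rw [transport_of_notMem hE]
    exact le_antisymm (h.wellPosed_profile h2) (neg_defect_le h1 _)

/-- Off the segments, a plan carried by the minimizers is determined by its second marginal. -/
theorem restrict_eq_of_ae_eq {γ : Measure ((ℝ × ℝ) × (ℝ × ℝ))} {f : ℝ × ℝ → ℝ × ℝ}
    (hf : Measurable f) {E : Set (ℝ × ℝ)} (hE : MeasurableSet E) (hγ : γ.map Prod.snd = ν)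
    (hae : ∀ᵐ z ∂γ, z.2 ∉ E → z.1 = f z.2) :
    γ.restrict {z | z.2 ∉ E} = (ν.restrict Eᶜ).map fun y => (f y, y) := by
  have hg : Measurable fun y : ℝ × ℝ => (f y, y) := hf.prodMk measurable_id
  refine Measure.ext fun A hA => ?_
  rw [Measure.restrict_apply hA, Measure.map_apply hg hA, Measure.restrict_apply (hg hA), ← hγ,
    Measure.map_apply measurable_snd ((hg hA).inter hE.compl)]
  refine measure_congr ?_
  filter_upwards [hae] with z hz
  refine propext (and_congr_left fun hzE => ?_)
  have hz' := hz hzE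
  change z ∈ A ↔ (f z.2, z.2) ∈ A
  rw [← hz']

end BackwardTransport

open BackwardTransport
theorem theorem4 {Ω : Type*} [MeasurableSpace Ω] (P : Measure Ω) [IsProbabilityMeasure P]
    (Y : Ω → ℝ × ℝ) (hY : Measurable Y) (hY2 : MemLp Y 2 P)
    (hreg : IsDRegular (P.map Y))
    (G : Set (ℝ × ℝ)) (hG : IsDualMaximizer (P.map Y) G)
    (X : Ω → ℝ × ℝ)
    (hX : ∀ᵐ ω ∂P, X ω =
      (segments G).indicator id (Y ω) + (segments G)ᶜ.indicator (Dc G) (Y ω)) :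
    (∀ᵐ ω ∂P, Y ω ∉ segments G → Y ω ∈ domGrad G) ∧
    IsOptimalMap P Y X ∧
    IsOptimalPlan (P.map Y) (P.map (fun ω => (X ω, Y ω))) ∧
    IsDRegular (P.map X) ∧
    (∀ X' : Ω → ℝ × ℝ, IsOptimalMap P Y X' →
      ∀ᵐ ω ∂P, Y ω ∉ segments G → X ω = X' ω) ∧
    (∀ γ' : Measure ((ℝ × ℝ) × (ℝ × ℝ)), IsOptimalPlan (P.map Y) γ' →
      (P.map (fun ω => (X ω, Y ω))).restrict {z | z.2 ∉ segments G} =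
        γ'.restrict {z | z.2 ∉ segments G}) := by
  obtain ⟨a, b, hopt, rfl⟩ := hG.exists_pair
  have h := hopt.isPair
  rw [segments_range h] at hX ⊢
  set ν := P.map Y with hν
  have hνprob : IsProbabilityMeasure ν := Measure.isProbabilityMeasure_map hY.aemeasurable
  have S : RegularOptPair ν a b := by
    refine ⟨hνprob, hopt, ?_, fun K hK A hA => hreg.measure_eq_zero hK hA⟩
    rw [hν, lintegral_map (by fun_prop) hY]
    have hi : Integrable (fun ω => (Y ω).1 ^ 2 + (Y ω).2 ^ 2) P :=
      hY2.fst.integrable_sq.add hY2.snd.integrable_sq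
    exact (((hasFiniteIntegral_iff_ofReal
      (Eventually.of_forall fun ω => by positivity)).1 hi.2).ne)
  obtain ⟨τ, hτm, hτ⟩ := S.exists_selection
  have T : RegularOptPair.Selection ν a b τ := ⟨hτm, hτ⟩
  have hfm := h.measurable_transport hτm
  have hE := h.measurableSet_segs
  have hτP : ∀ᵐ ω ∂P, Y ω ∉ segs a b → defect a b (Y ω) < ⊤ ∧ WellPosed a b (Y ω) (τ (Y ω)) :=
    ae_of_ae_map hY.aemeasurable hτ
  set Z : Ω → ℝ × ℝ := fun ω => transport a b τ (Y ω) with hZ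
  have hZm : Measurable Z := hfm.comp hY
  have hXZ : X =ᵐ[P] Z := by
    filter_upwards [hX, hτP] with ω h1 h2
    rw [h1, hZ]
    by_cases hy : Y ω ∈ segs a b
    · simp [hy, transport_of_mem hy]
    · obtain ⟨k1, k2⟩ := h2 hy
      simp [hy, transport_of_notMem hy, h.Dc_eq k1 hy k2]
  have hZ2 : MemLp Z 2 P := (S.memLp_transport T).comp_of_map hY.aemeasurable
  have hZmart : P[Y | MeasurableSpace.comap Z inferInstance] =ᵐ[P] Z := by
    symm
    refine ae_eq_condExp_of_forall_setIntegral_eq hZm.comap_le (hY2.integrable one_le_two)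
      (fun s _ _ => (hZ2.integrable one_le_two).integrableOn) ?_
      (comap_measurable Z).stronglyMeasurable.aestronglyMeasurable
    rintro s ⟨B, hB, rfl⟩ -
    have e := S.setIntegral_transport T hB
    rwa [setIntegral_map (hfm hB) hfm.aestronglyMeasurable hY.aemeasurable,
      setIntegral_map (f := fun y => y) (hfm hB) measurable_id.aestronglyMeasurable hY.aemeasurable] at e
  have hXmap : IsMap P Y X := ⟨hZ2.ae_eq hXZ.symm, Z, hXZ, hfm.comp (comap_measurable Y), hZmart⟩
  have hdomν := S.ae_defect_lt_top
  have hdom : ∀ᵐ ω ∂P, defect a b (Y ω) < ⊤ := ae_of_ae_map hY.aemeasurable hdomν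
  have hintν : Integrable (fun y => (defect a b y).toReal) ν :=
    integrable_toReal_of_lintegral_ne_top (measurable_defect a b).aemeasurable
      S.lintegral_defect_ne_top
  have hint : Integrable (fun ω => (defect a b (Y ω)).toReal) P := hintν.comp_measurable hY
  have hvalν : ∫ y, (defect a b y).toReal ∂ν = ∫ ω, (defect a b (Y ω)).toReal ∂P :=
    integral_map hY.aemeasurable hintν.1
  have hcost : ∫ ω, cost (X ω) (Y ω) ∂P = -∫ ω, (defect a b (Y ω)).toReal ∂P := by
    rw [← integral_neg]
    refine integral_congr_ae ?_
    filter_upwards [hXZ, ae_of_ae_map hY.aemeasurable (S.ae_cost_transport T)] with ω h1 h2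
    rw [h1]; exact h2
  have hmaps : ∀ X', IsMap P Y X' → -∫ ω, (defect a b (Y ω)).toReal ∂P ≤
      ∫ ω, cost (X' ω) (Y ω) ∂P ∧
      (∫ ω, cost (X' ω) (Y ω) ∂P ≤ -∫ ω, (defect a b (Y ω)).toReal ∂P → ∀ᵐ ω ∂P, ∃ t,
        X' ω = (a t, b t) ∧ profile a b (Y ω) t ≤ -(defect a b (Y ω)).toReal) := by
    rintro X' ⟨h2, X'', hae, hm, hmart⟩
    have hm' : Measurable X'' := hm.mono hY.comap_le le_rfl
    have hwd := h.weak_duality hm' (h2.ae_eq hae) hY2 hmart hdom hint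
    have e : ∫ ω, cost (X' ω) (Y ω) ∂P = ∫ ω, cost (X'' ω) (Y ω) ∂P :=
      integral_congr_ae (hae.mono fun ω hω => by simp only [hω])
    rw [e]
    refine ⟨hwd.1, fun hle => ?_⟩
    filter_upwards [hwd.2 hle, hae] with ω k1 k2
    rwa [k2]
  have hplans : ∀ γ, IsPlan ν γ → -∫ ω, (defect a b (Y ω)).toReal ∂P ≤
      ∫ z, cost z.1 z.2 ∂γ ∧
      (∫ z, cost z.1 z.2 ∂γ ≤ -∫ ω, (defect a b (Y ω)).toReal ∂P → ∀ᵐ z ∂γ, ∃ t,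
        z.1 = (a t, b t) ∧ profile a b z.2 t ≤ -(defect a b z.2).toReal) := by
    intro γ hγ
    have := hγ.isProb
    have hdomγ : ∀ᵐ z ∂γ, defect a b z.2 < ⊤ :=
      ae_of_ae_map measurable_snd.aemeasurable (hγ.marginal.symm ▸ hdomν)
    have hintγ : Integrable (fun y => (defect a b y).toReal) (γ.map Prod.snd) :=
      hγ.marginal.symm ▸ hintν
    have hwd := h.weak_duality (P := γ) (X := Prod.fst) (Y := Prod.snd) measurable_fst hγ.memLp.fst hγ.memLp.snd hγ.martingale
      hdomγ (hintγ.comp_measurable measurable_snd)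
    have e : ∫ z, (defect a b z.2).toReal ∂γ = ∫ ω, (defect a b (Y ω)).toReal ∂P := by
      rw [← hvalν, ← hγ.marginal, integral_map measurable_snd.aemeasurable hintγ.1]
    rwa [e] at hwd
  have hplan : IsPlan ν (P.map fun ω => (X ω, Y ω)) := by
    rw [Measure.map_congr (g := fun ω => (Z ω, Y ω)) (hXZ.mono fun ω hω => by simp only [hω])]
    exact isPlan_map hZm hY hZ2 hY2 hZmart
  have hplancost : ∫ z, cost z.1 z.2 ∂(P.map fun ω => (X ω, Y ω)) =
      ∫ ω, cost (X ω) (Y ω) ∂P := by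
    refine integral_map ((hZm.aemeasurable.congr hXZ.symm).prodMk hY.aemeasurable) ?_
    unfold cost
    exact Measurable.aestronglyMeasurable (by fun_prop)
  have hrestrict : ∀ γ, IsPlan ν γ → ∫ z, cost z.1 z.2 ∂γ ≤ -∫ ω, (defect a b (Y ω)).toReal ∂P →
      γ.restrict {z | z.2 ∉ segs a b} =
        (ν.restrict (segs a b)ᶜ).map fun y => (transport a b τ y, y) := by
    intro γ hγ hle
    refine restrict_eq_of_ae_eq hfm hE hγ.marginal ?_
    have hτγ : ∀ᵐ z ∂γ, z.2 ∉ segs a b → defect a b z.2 < ⊤ ∧ WellPosed a b z.2 (τ z.2) :=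
      ae_of_ae_map measurable_snd.aemeasurable (hγ.marginal.symm ▸ hτ)
    filter_upwards [(hplans γ hγ).2 hle, hτγ] with z ⟨t, h1, h2⟩ h3 hz
    rw [h1, transport_of_notMem hz, (h3 hz).2.eq h2]
  refine ⟨?_, ⟨hXmap, fun X' hX' => hcost.trans_le (hmaps X' hX').1⟩,
    ⟨hplan, fun γ hγ => (hplancost.trans hcost).trans_le (hplans γ hγ).1⟩, ?_, ?_, ?_⟩
  · filter_upwards [hτP] with ω h1 hy
    exact ⟨_, h.hasGrad (h1 hy).1 hy (h1 hy).2⟩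
  · rw [Measure.map_congr hXZ, hZ]
    have := S.isDRegular_map_transport T
    rwa [hν, Measure.map_map hfm hY] at this
  · intro X' hX'
    have hle := (hX'.2 X hXmap).trans hcost.le
    filter_upwards [(hmaps X' hX'.1).2 hle, hXZ, hτP] with ω ⟨t, h1, h2⟩ h3 h4 hy
    rw [h3, h1, hZ]
    simp only [transport_of_notMem hy]
    rw [(h4 hy).2.eq h2]
  · intro γ' hγ'
    rw [hrestrict _ hplan (hplancost.trans hcost).le,
      hrestrict γ' hγ'.1 ((hγ'.2 _ hplan).trans (hplancost.trans hcost).le)]
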